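/- **Conventions.** For a class $\mathsf X$ of morphisms in a complete category $\mathsf C$, an *$\mathsf X$-Postnikov tower* is the composite $\lim_{\lambda^{op}}Y^\beta\to Y^0$ of a functor $Y:\lambda^{op}\to\mathsf C$ ($\lambda>0$ an ordinal) such that each $Y^{\beta+1}\to Y^\beta$ (with $\beta+1<\lambda$) is a pullback of a morphism of $\mathsf X$ and $Y^\gamma=\lim_{\beta<\gamma}Y^\beta$ for every limit ordinal $\gamma<\lambda$. Write $\mathsf{Post}_{\mathsf X}$ for the class of these, and $\widehat{\mathsf{Post}_{\mathsf X}}$ for the class of all retracts of its members. A model category is a bicomplete category with classes $\mathcal F,\mathcal C,\mathcal W$ (fibrations, cofibrations, weak equivalences) such that $\mathcal W$ contains the identities and satisfies 2-out-of-3 and $(\mathcal C,\mathcal F\cap\mathcal W)$, $(\mathcal C\cap\mathcal W,\mathcal F)$ are weak factorization systems. It has the *Postnikov presentation* $(\mathsf X,\mathsf Z)$, for classes $\mathsf X,\mathsf Z$ of morphisms, if $\mathcal F=\widehat{\mathsf{Post}_{\mathsf X}}$ and $\mathcal F\cap\mathcal W=\widehat{\mathsf{Post}_{\mathsf Z}}$.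 A *Reedy category* is a small category $\mathsf R$ with a degree function $\deg:\operatorname{Ob}\mathsf R\to\mathbb N$ and wide subcategories $\mathsf R^+,\mathsf R^-$ such that non-identity morphisms of $\mathsf R^+$ (of $\mathsf R^-$) strictly raise (strictly lower) degree and every morphism factors uniquely as a morphism of $\mathsf R^-$ followed by one of $\mathsf R^+$. For $\Phi\in\mathsf C^{\mathsf R}$ and $r\in\mathsf R$ let $L_r\Phi$ be the colimit of $\Phi$ over the category of morphisms $s\to r$ in $\mathsf R^+$ with $\deg s<\deg r$ (morphisms: commutative triangles in $\mathsf R^+$) and $M_r\Phi$ the limit of $\Phi$ over the category of morphisms $r\to s$ in $\mathsf R^-$ with $\deg s<\deg r$ (morphisms: commutative triangles in $\mathsf R^-$). A morphism $\tau:\Phi\to\Psi$ has relative latching and matching maps $$\ell_r(\tau):\Phi(r)\sqcup_{L_r\Phi}L_r\Psi\to\Psi(r),\qquad m_r(\tau):\Phi(r)\to M_r\Phi\times_{M_r\Psi}\Psi(r).$$ For a set-valued presheaf $S$ on $\mathsf R$ and $E\in\mathsf C$ let $E\pitchfork S\in\mathsf C^{\mathsf R}$ be $d\mapsto\prod_{S(d)}E$.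 Let $\kappa^r:\partial\mathsf R(-,r)\hookrightarrow\mathsf R(-,r)$ be the subfunctor of the morphisms to $r$ that factor through an object of degree less than $\deg r$. For $p:E\to B$ let $$p\,\widehat\pitchfork\,\kappa^r:\ E\pitchfork\mathsf R(-,r)\to \big(E\pitchfork\partial\mathsf R(-,r)\big)\times_{B\pitchfork\partial\mathsf R(-,r)}\big(B\pitchfork\mathsf R(-,r)\big)$$ be the induced map, and put $\mathsf X\,\widehat\pitchfork\,\mathsf R=\{p\,\widehat\pitchfork\,\kappa^r\mid p\in\mathsf X,\ r\in\operatorname{Ob}\mathsf R\}$. **Theorem.** Let $(\mathsf M,\mathcal F,\mathcal C,\mathcal W)$ be a model category with a Postnikov presentation $(\mathsf X,\mathsf Z)$ and let $\mathsf R$ be a Reedy category. Then $\mathsf M^{\mathsf R}$ carries the Reedy model structure, in which $\tau$ is a weak equivalence iff every $\tau_r\in\mathcal W$, a cofibration iff every $\ell_r(\tau)\in\mathcal C$, and a fibration iff every $m_r(\tau)\in\mathcal F$; and this model category has the Postnikov presentation $(\mathsf X\,\widehat\pitchfork\,\mathsf R,\ \mathsf Z\,\widehat\pitchfork\,\mathsf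 R)$. -/

import Mathlib

open CategoryTheory CategoryTheory.Limits HomotopicalAlgebra Opposite

-- Morphisms of a category are always taken in its own quiver, as everywhere in the category library.
attribute [-instance] CategoryTheory.catToReflQuiver

universe v u

namespace ReedyPostnikov

/-! ### Postnikov towers and Postnikov presentations -/

section Postnikov

variable {C : Type u} [Category.{v} C]

/-- The class `Post_X` of `X`-Postnikov towers. A morphism `f : P ⟶ B` of `C` belongs to it when
there are a (nonempty, small) well-ordered type `J` and a tower `Y : Jᵒᵖ ⥤ C`, here recorded as a
functor `J ⥤ Cᵒᵖ`, such that every `Y (j + 1) ⟶ Y j` is a pullback of a morphism of `X`,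
`Y m = lim_{j < m} Y j` for every limit element `m`, and `f` is the composite
`P = lim_J Y ⟶ Y ⊥ ≅ B`. -/
def post (X : MorphismProperty C) : MorphismProperty C :=
  (MorphismProperty.transfiniteCompositions.{v} X.pullbacks.op).unop

variable (C) in
/-- `(X, Z)` is a Postnikov presentation of the model category `C`: the fibrations are exactly the
retracts of `X`-Postnikov towers, and the acyclic fibrations are exactly the retracts of
`Z`-Postnikov towers. (In a model category `(trivialCofibrations C, fibrations C)` and
`(cofibrations C, trivialFibrations C)` are weak factorization systems.) -/
structure IsPostnikovPresentation [ModelCategory C] (X Z : MorphismProperty C) : Prop where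
  fibrations_eq : fibrations C = (post X).retracts
  trivialFibrations_eq : trivialFibrations C = (post Z).retracts

end Postnikov

/-! ### Latching and matching objects, the Reedy classes

The Reedy category is a small category `R` with `Rm = R⁻`, `Rp = R⁺` and a Reedy structure
`ρ : ReedyStructure Rm Rp ℕ`. -/

section Reedy

variable {R : Type v} [SmallCategory R] {Rm Rp : MorphismProperty R}
  [Rm.IsMultiplicative] [Rp.IsMultiplicative] (ρ : ReedyStructure Rm Rp ℕ)

/-- An object of the category `R⁺_{< deg r} / r`: a morphism `s ⟶ r` of `R⁺` with
`deg s < deg r`. -/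
structure LatchingCategory (r : R) : Type v where
  /-- the source `s` -/
  src : R
  /-- the morphism `s ⟶ r` -/
  hom : src ⟶ r
  mem : Rp hom
  deg_lt : ρ.deg src < ρ.deg r

/-- A morphism of `R⁺_{< deg r} / r`: a commutative triangle in `R⁺`. -/
@[ext]
structure LatchingCategory.Hom {r : R} (f g : LatchingCategory ρ r) : Type v where
  /-- the underlying morphism of `R` -/
  val : f.src ⟶ g.src
  mem : Rp val
  w : val ≫ g.hom = f.hom

instance (r : R) : SmallCategory (LatchingCategory ρ r) where
  Hom f g := LatchingCategory.Hom ρ f g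
  id f := ⟨𝟙 _, Rp.id_mem _, Category.id_comp _⟩
  comp a b := ⟨a.val ≫ b.val, Rp.comp_mem _ _ a.mem b.mem, by rw [Category.assoc, b.w, a.w]⟩
  id_comp _ := LatchingCategory.Hom.ext (Category.id_comp _)
  comp_id _ := LatchingCategory.Hom.ext (Category.comp_id _)
  assoc _ _ _ := LatchingCategory.Hom.ext (Category.assoc _ _ _)

/-- The forgetful functor `(s ⟶ r) ↦ s`. -/
abbrev latchingForget (r : R) : LatchingCategory ρ r ⥤ R where
  obj f := f.src
  map a := a.val

/-- An object of the category `r / R⁻_{< deg r}`: a morphism `r ⟶ s` of `R⁻` with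
`deg s < deg r`. -/
structure MatchingCategory (r : R) : Type v where
  /-- the target `s` -/
  tgt : R
  /-- the morphism `r ⟶ s` -/
  hom : r ⟶ tgt
  mem : Rm hom
  deg_lt : ρ.deg tgt < ρ.deg r

/-- A morphism of `r / R⁻_{< deg r}`: a commutative triangle in `R⁻`. -/
@[ext]
structure MatchingCategory.Hom {r : R} (f g : MatchingCategory ρ r) : Type v where
  /-- the underlying morphism of `R` -/
  val : f.tgt ⟶ g.tgt
  mem : Rm val
  w : f.hom ≫ val = g.hom

instance (r : R) : SmallCategory (MatchingCategory ρ r) where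
  Hom f g := MatchingCategory.Hom ρ f g
  id f := ⟨𝟙 _, Rm.id_mem _, Category.comp_id _⟩
  comp a b := ⟨a.val ≫ b.val, Rm.comp_mem _ _ a.mem b.mem, by rw [← Category.assoc, a.w, b.w]⟩
  id_comp _ := MatchingCategory.Hom.ext (Category.id_comp _)
  comp_id _ := MatchingCategory.Hom.ext (Category.comp_id _)
  assoc _ _ _ := MatchingCategory.Hom.ext (Category.assoc _ _ _)

/-- The forgetful functor `(r ⟶ s) ↦ s`. -/
abbrev matchingForget (r : R) : MatchingCategory ρ r ⥤ R where
  obj f := f.tgt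
  map a := a.val

variable {M : Type u} [Category.{v} M]

section Latching

variable [HasColimits M]

/-- The latching object `L_r Φ`. -/
noncomputable abbrev latchingObj (r : R) (Φ : R ⥤ M) : M :=
  colimit (latchingForget ρ r ⋙ Φ)

/-- The canonical map `L_r Φ ⟶ Φ r`. -/
noncomputable def latchingMap (r : R) (Φ : R ⥤ M) : latchingObj ρ r Φ ⟶ Φ.obj r :=
  colimit.desc (latchingForget ρ r ⋙ Φ)
    { pt := Φ.obj r
      ι :=
        { app := fun f => Φ.map f.hom
          naturality := fun f g a => by
            dsimp
            rw [← Φ.map_comp, a.w, Category.comp_id] } }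

/-- Functoriality of the latching object, `L_r τ : L_r Φ ⟶ L_r Ψ`. -/
noncomputable def latchingObjMap (r : R) {Φ Ψ : R ⥤ M} (τ : Φ ⟶ Ψ) :
    latchingObj ρ r Φ ⟶ latchingObj ρ r Ψ :=
  colimMap (Functor.whiskerLeft (latchingForget ρ r) τ)

lemma latchingMap_naturality (r : R) {Φ Ψ : R ⥤ M} (τ : Φ ⟶ Ψ) :
    latchingMap ρ r Φ ≫ τ.app r = latchingObjMap ρ r τ ≫ latchingMap ρ r Ψ := by
  apply colimit.hom_ext
  intro f
  simp [latchingMap, latchingObjMap]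

/-- The relative latching map `ℓ_r(τ) : Φ r ⊔_{L_r Φ} L_r Ψ ⟶ Ψ r`. -/
noncomputable def relativeLatchingMap (r : R) {Φ Ψ : R ⥤ M} (τ : Φ ⟶ Ψ) :
    pushout (latchingMap ρ r Φ) (latchingObjMap ρ r τ) ⟶ Ψ.obj r :=
  pushout.desc (τ.app r) (latchingMap ρ r Ψ) (latchingMap_naturality ρ r τ)

end Latching

section Matching

variable [HasLimits M]

/-- The matching object `M_r Φ`. -/
noncomputable abbrev matchingObj (r : R) (Φ : R ⥤ M) : M :=
  limit (matchingForget ρ r ⋙ Φ)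

/-- The canonical map `Φ r ⟶ M_r Φ`. -/
noncomputable def matchingMap (r : R) (Φ : R ⥤ M) : Φ.obj r ⟶ matchingObj ρ r Φ :=
  limit.lift (matchingForget ρ r ⋙ Φ)
    { pt := Φ.obj r
      π :=
        { app := fun f => Φ.map f.hom
          naturality := fun f g a => by
            dsimp
            rw [← Φ.map_comp, a.w, Category.id_comp] } }

/-- Functoriality of the matching object, `M_r τ : M_r Φ ⟶ M_r Ψ`. -/
noncomputable def matchingObjMap (r : R) {Φ Ψ : R ⥤ M} (τ : Φ ⟶ Ψ) :
    matchingObj ρ r Φ ⟶ matchingObj ρ r Ψ :=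
  limMap (Functor.whiskerLeft (matchingForget ρ r) τ)

lemma matchingMap_naturality (r : R) {Φ Ψ : R ⥤ M} (τ : Φ ⟶ Ψ) :
    matchingMap ρ r Φ ≫ matchingObjMap ρ r τ = τ.app r ≫ matchingMap ρ r Ψ := by
  apply limit.hom_ext
  intro f
  simp [matchingMap, matchingObjMap]

/-- The relative matching map `m_r(τ) : Φ r ⟶ M_r Φ ×_{M_r Ψ} Ψ r`. -/
noncomputable def relativeMatchingMap (r : R) {Φ Ψ : R ⥤ M} (τ : Φ ⟶ Ψ) :
    Φ.obj r ⟶ pullback (matchingObjMap ρ r τ) (matchingMap ρ r Ψ) :=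
  pullback.lift (matchingMap ρ r Φ) (τ.app r) (matchingMap_naturality ρ r τ)

end Matching

/-- `K` is the Reedy model structure on `R ⥤ M`: weak equivalences are objectwise, cofibrations
(resp. fibrations) are the morphisms all of whose relative latching (resp. matching) maps are
cofibrations (resp. fibrations) of `M`. -/
structure IsReedyModelStructure [HasLimits M] [HasColimits M] [ModelCategory M]
    (K : ModelCategory (R ⥤ M)) : Prop where
  weakEquivalences_iff {Φ Ψ : R ⥤ M} (τ : Φ ⟶ Ψ) :
    weakEquivalences (R ⥤ M) τ ↔ ∀ r : R, weakEquivalences M (τ.app r)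
  cofibrations_iff {Φ Ψ : R ⥤ M} (τ : Φ ⟶ Ψ) :
    cofibrations (R ⥤ M) τ ↔ ∀ r : R, cofibrations M (relativeLatchingMap ρ r τ)
  fibrations_iff {Φ Ψ : R ⥤ M} (τ : Φ ⟶ Ψ) :
    fibrations (R ⥤ M) τ ↔ ∀ r : R, fibrations M (relativeMatchingMap ρ r τ)

/-! ### The pullback-cotensor construction -/

/-- The subfunctor `∂R(-, r)` of `R(-, r)` consisting of the morphisms with codomain `r` that
factor through an object of degree less than `deg r`. -/
def boundary (r : R) : Subfunctor (yoneda.obj r) where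
  obj d := {f : d.unop ⟶ r |
    ∃ (s : R) (g : d.unop ⟶ s) (h : s ⟶ r), ρ.deg s < ρ.deg r ∧ g ≫ h = f}
  map := by
    rintro d e a f ⟨s, g, h, hs, rfl⟩
    exact ⟨s, a.unop ≫ g, h, hs, by simp⟩

/-- The inclusion `κ^r : ∂R(-, r) ⟶ R(-, r)`. -/
abbrev boundaryInclusion (r : R) : (boundary ρ r).toFunctor ⟶ yoneda.obj r :=
  (boundary ρ r).ι

variable (R M) in
/-- The power bifunctor `(S, E) ↦ E ⋔ S`, where `(E ⋔ S)(d) = ∏_{S(d)} E`. -/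
noncomputable def power [HasLimits M] : (Rᵒᵖ ⥤ Type v)ᵒᵖ ⥤ M ⥤ R ⥤ M where
  obj S :=
    { obj := fun E => S.unop.rightOp ⋙ piConst.obj E
      map := fun p => Functor.whiskerLeft S.unop.rightOp (piConst.map p) }
  map α :=
    { app := fun E => Functor.whiskerRight (NatTrans.rightOp α.unop) (piConst.obj E) }

/-- The pullback-cotensor
`p ⋔̂ κ^r : E ⋔ R(-, r) ⟶ (E ⋔ ∂R(-, r)) ×_{B ⋔ ∂R(-, r)} (B ⋔ R(-, r))` of `p : E ⟶ B`. -/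
noncomputable abbrev pullbackCotensor [HasLimits M] {E B : M} (p : E ⟶ B) (r : R) :=
  (Functor.PullbackObjObj.ofHasPullback (power R M) (boundaryInclusion ρ r) p).π

/-- The class `X ⋔̂ R` of all `p ⋔̂ κ^r` with `p` in `X` and `r` an object of `R`. -/
inductive reedyCotensor [HasLimits M] (X : MorphismProperty M) : MorphismProperty (R ⥤ M)
  | mk {E B : M} (p : E ⟶ B) (hp : X p) (r : R) : reedyCotensor X (pullbackCotensor ρ p r)

end Reedy

end ReedyPostnikov

namespace ReedyPostnikov

/-! ### Transfinite compositions -/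

/-! By Yoneda, `f` lifts against `p ⋔̂ κ^r` exactly when `ℓ_r(f)` lifts against `p`
(`hasLiftingProperty_pullbackCotensor_iff_relativeLatchingMap`). Moreover the relative matching map
of `p ⋔̂ κ^r` behaves, for lifting, like an isomorphism at objects other than `r` and like a base
change of `p` at `r` (`matchingSquare_pullbackCotensor_hasLift`).

The engine is a tower. Given `f : Φ ⟶ Ψ` and a way of factoring the morphisms of `M`, put `Z_0 = Ψ`
and obtain `Z_{n+1}` by pulling back to `Z_n` the product, over all `r` of degree `n`, of the maps
`p_r ⋔̂ κ^r`, where `p_r` is the second factor of `ℓ_r(Φ ⟶ Z_n)`; the attaching map is the transpose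
of the square given by the first factor. Step `n` changes nothing in degrees below `n` and puts the
middle object of the factorization at each `r` of degree `n`. Hence the relative latching maps of `Φ
⟶ lim Z_n` are the chosen first factors, and `lim Z_n ⟶ Ψ` is a countable tower of base changes of
products of the `p_r ⋔̂ κ^r`.

Two factorizations matter. Those of the weak factorization systems of `M` yield the Reedy
factorizations. The factorization into an isomorphism followed by an arbitrary map makes `Φ ⟶ lim
Z_n` invertible and `p_r` isomorphic to `m_r(f)`: every `f` is a tower of the maps `m_r(f) ⋔̂ κ^r`.
So a class closed under base change, products and sequential limits contains `f` as soon as it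
contains these (`IsTowerClosed.of_pullbackCotensor`). For right lifting classes this gives the Reedy
lifting axioms and the lifting properties of the components, hence the description of the acyclic
classes. For the retracts of `(X ⋔̂ R)`-Postnikov towers it gives the Postnikov presentation.

The last application needs two facts: these retracts form such a closed class
(`isTowerClosed_retracts_post`), and `- ⋔̂ κ^r` carries Postnikov towers to Postnikov towers,
because powers preserve limits (`post_pullbackCotensor`). Both are proved for transfinite
compositions in the opposite category. There towers have to be concatenated, which creates
isomorphism steps that have to be deleted, since pullbacks of `X` need not include all isomorphisms.
The reverse inclusion is formal: the maps of `X ⋔̂ R` are Reedy fibrations, and these form a right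
lifting class. -/

section WellOrderContinuous

variable {C : Type*} [Category* C]

/-- Colimits commute with colimits: if `c` is a pointwise colimit of functors `K d : I ⥤ C`, each
of which has the colimit `L d`, then the colimit of `c.pt` is the colimit of `L`. -/
def isColimitOfPointwise {D I : Type*} [Category* D] [Category* I] {K : D ⥤ I ⥤ C} {c : Cocone K}
    (hc : ∀ i, IsColimit (((evaluation I C).obj i).mapCocone c)) {L : D ⥤ C} {cL : Cocone L}
    (hL : IsColimit cL) (s : ∀ d, K.obj d ⟶ (Functor.const I).obj (L.obj d))
    (hs : ∀ d, IsColimit (Cocone.mk _ (s d)))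
    (nat : ∀ {d d' : D} (f : d ⟶ d') (i : I),
      (K.map f).app i ≫ (s d').app i = (s d).app i ≫ L.map f)
    (t : c.pt ⟶ (Functor.const I).obj cL.pt)
    (ht : ∀ d i, (c.ι.app d).app i ≫ t.app i = (s d).app i ≫ cL.ι.app d) :
    IsColimit (Cocone.mk _ t) := by
  let q (T : Cocone c.pt) (d : D) : L.obj d ⟶ T.pt := (hs d).desc
    { pt := T.pt
      ι := c.ι.app d ≫ T.ι }
  have hq (T : Cocone c.pt) (d : D) (i : I) :
      (s d).app i ≫ q T d = (c.ι.app d).app i ≫ T.ι.app i := (hs d).fac _ i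
  refine
    { desc := fun T => hL.desc
        { pt := T.pt
          ι :=
            { app := q T
              naturality := fun d d' f => (hs d).hom_ext (fun i => ?_) } }
      fac := fun T i => (hc i).hom_ext (fun d => ?_)
      uniq := fun T m hm => hL.hom_ext (fun d => (hs d).hom_ext (fun i => ?_)) }
  · have h1 := nat f i
    have h2 := congr_app (c.w f) i
    dsimp at h1 h2 ⊢
    rw [Category.comp_id, ← reassoc_of% h1, hq, hq, ← h2, Category.assoc]
  · have h1 := ht d i
    dsimp at h1 ⊢
    rw [reassoc_of% h1, hL.fac, hq]
  · have h1 := ht d i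
    have h2 := hm i
    dsimp at h1 h2 ⊢
    rw [hL.fac, hq, ← h2, reassoc_of% h1]

/-- Continuity at a limit index is itself a colimit condition, and colimits commute with colimits.
-/
lemma isWellOrderContinuous_of_isColimit {J : Type*} [PartialOrder J]
    {D : Type*} [Category* D] {K : D ⥤ J ⥤ C} (hK : ∀ d, (K.obj d).IsWellOrderContinuous)
    {c : Cocone K} (hc : ∀ j, IsColimit (((evaluation J C).obj j).mapCocone c)) :
    c.pt.IsWellOrderContinuous where
  nonempty_isColimit m hm := ⟨by
    let W : (J ⥤ C) ⥤ (Set.Iio m ⥤ C) :=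
      (Functor.whiskeringLeft _ _ C).obj (Set.principalSegIio m).monotone.functor
    exact isColimitOfPointwise (K := K ⋙ W) (c := W.mapCocone c)
      (fun i => hc i) (L := K ⋙ (evaluation J C).obj m)
      (cL := ((evaluation J C).obj m).mapCocone c) (hc m)
      (fun d => ((Set.principalSegIio m).cocone (K.obj d)).ι)
      (fun d => (K.obj d).isColimitOfIsWellOrderContinuous m hm)
      (fun f i => ((K.map f).naturality _).symm) _ (fun d i => ((c.ι.app d).naturality _).symm)⟩

lemma isConnected_of_linearOrder (J : Type*) [LinearOrder J] [Nonempty J] : IsConnected J :=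
  IsFiltered.isConnected J

instance isWellOrderContinuous_const {J : Type*} [LinearOrder J] (X : C) :
    ((Functor.const J).obj X).IsWellOrderContinuous where
  nonempty_isColimit m hm := by
    obtain ⟨i, hi⟩ := not_isMin_iff.1 hm.1
    have : Nonempty (Set.Iio m) := ⟨⟨i, hi⟩⟩
    have := isConnected_of_linearOrder (Set.Iio m)
    exact ⟨isColimitConstCocone (Set.Iio m) X⟩

/-! ### Pushouts of towers -/

section Pushout

variable {J : Type*} [Category* J] {U V V' : J ⥤ C} (a : U ⟶ V) (b : U ⟶ V') [HasPushouts C]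

lemma isPushout_app (j : J) :
    IsPushout (a.app j) (b.app j) ((pushout.inl a b).app j) ((pushout.inr a b).app j) :=
  (IsPushout.of_hasPushout a b).map ((evaluation J C).obj j)

lemma isWellOrderContinuous_pushout {J : Type*} [PartialOrder J] {U V V' : J ⥤ C} (a : U ⟶ V)
    (b : U ⟶ V') [hU : U.IsWellOrderContinuous] [hV : V.IsWellOrderContinuous]
    [hV' : V'.IsWellOrderContinuous] : (pushout a b).IsWellOrderContinuous :=
  isWellOrderContinuous_of_isColimit (K := span a b) (by rintro (_ | _ | _) <;> assumption)
    (c := colimit.cocone (span a b))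
    (fun _ => isColimitOfPreserves _ (colimit.isColimit _))

/-- The colimit of a pushout of functors is the pushout of the colimits. -/
noncomputable def isColimitPushout {x y y' P : C} {f : x ⟶ y} {g : x ⟶ y'} {h : y ⟶ P}
    {k : y' ⟶ P} (sq : IsPushout f g h k)
    (sU : U ⟶ (Functor.const J).obj x) (hU : IsColimit (Cocone.mk _ sU))
    (sV : V ⟶ (Functor.const J).obj y) (hV : IsColimit (Cocone.mk _ sV))
    (sV' : V' ⟶ (Functor.const J).obj y') (hV' : IsColimit (Cocone.mk _ sV'))
    (ha : ∀ j, a.app j ≫ sV.app j = sU.app j ≫ f) (hb : ∀ j, b.app j ≫ sV'.app j = sU.app j ≫ g)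
    (t : pushout a b ⟶ (Functor.const J).obj P)
    (h₁ : ∀ j, (pushout.inl a b).app j ≫ t.app j = sV.app j ≫ h)
    (h₂ : ∀ j, (pushout.inr a b).app j ≫ t.app j = sV'.app j ≫ k) :
    IsColimit (Cocone.mk _ t) :=
  isColimitOfPointwise (K := span a b) (c := colimit.cocone (span a b))
    (fun _ => isColimitOfPreserves _ (colimit.isColimit _)) (L := span f g)
    (cL := PushoutCocone.mk h k sq.w) sq.isColimit
    (s := fun d => match d with
      | none => sU
      | some .left => sV
      | some .right => sV')
    (by rintro (_ | _ | _) <;> assumption)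
    (by
      rintro _ _ (_ | _ | _) i
      · simp
      · exact ha i
      · exact hb i) t
    (by
      rintro (_ | _ | _) i
      · have h1 := h₁ i
        have h2 : (colimit.ι (span a b) none).app i =
            a.app i ≫ (pushout.inl a b).app i := congr_app (colimit.w (span a b)
              WalkingSpan.Hom.fst).symm i
        have h3 := ha i
        have h4 : a.app i ≫ (pushout.inl a b).app i ≫ t.app i = sU.app i ≫ f ≫ h := by
          rw [h1, reassoc_of% h3]
        dsimp at h2 ⊢
        rw [h2, Category.assoc]
        exact h4
      · exact h₁ i
      · exact h₂ i)

end Pushout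

end WellOrderContinuous

/-! ### Cobase changes and corner maps of transfinite compositions -/

section TransfiniteCompositions

variable {C : Type u} [Category.{v} C]

lemma transfiniteCompositions_of_isColimit {J : Type v} [LinearOrder J] [SuccOrder J] [OrderBot J]
    [WellFoundedLT J] (W : MorphismProperty C) (F : J ⥤ C) [F.IsWellOrderContinuous]
    (hF : ∀ j, ¬ IsMax j → W (F.map (homOfLE (Order.le_succ j)))) {X Y : C}
    (t : F ⟶ (Functor.const J).obj Y) (ht : IsColimit (Cocone.mk _ t)) (e : F.obj ⊥ ≅ X)
    {f : X ⟶ Y} (hf : e.hom ≫ f = t.app ⊥) :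
    MorphismProperty.transfiniteCompositions.{v} W f :=
  MorphismProperty.transfiniteCompositionsOfShape_le_transfiniteCompositions W J _
    ⟨{ F := F
       isoBot := e
       incl := t
       isColimit := ht
       fac := by rw [← hf, Iso.inv_hom_id_assoc]
       map_mem := hF }⟩

/-- Push the whole tower out along `g`: stage `j` becomes `F j ⊔_X X'`, the colimit becomes the
pushout of the colimits, and the successor maps are cobase changes of the old ones by cancelling
pushout squares. -/
instance isStableUnderCobaseChange_transfiniteCompositions [HasPushouts C]
    (W : MorphismProperty C) [W.IsStableUnderCobaseChange] :
    (MorphismProperty.transfiniteCompositions.{v} W).IsStableUnderCobaseChange where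
  of_isPushout {X Y X' Y' f g f' g'} sq hf := by
    rw [MorphismProperty.transfiniteCompositions_iff] at hf
    obtain ⟨J, _, _, _, _, ⟨h⟩⟩ := hf
    let a : (Functor.const J).obj X ⟶ h.F :=
      { app := fun j => h.isoBot.inv ≫ h.F.map (homOfLE bot_le)
        naturality := fun i j φ => by
          dsimp
          rw [Category.id_comp, Category.assoc, ← Functor.map_comp]
          rfl }
    have ha : ∀ {i j : J} (φ : i ⟶ j), a.app i ≫ h.F.map φ = a.app j := fun φ => by
      rw [← a.naturality φ]
      exact Category.id_comp _
    have ha' : a.app ⊥ = h.isoBot.inv := by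
      have : h.F.map (homOfLE (bot_le (a := (⊥ : J)))) = 𝟙 _ := h.F.map_id _
      simp [a]
    have ha'' : ∀ j, a.app j ≫ h.incl.app j = f := fun j => by
      have := h.incl.naturality (homOfLE (bot_le (a := j)))
      dsimp at this
      rw [Category.comp_id] at this
      simp only [a, Category.assoc, this, h.fac]
    let b : (Functor.const J).obj X ⟶ (Functor.const J).obj X' := (Functor.const J).map g
    have hb : ∀ {i j : J} (φ : i ⟶ j),
        (pushout.inr a b).app i ≫ (pushout a b).map φ = (pushout.inr a b).app j := fun φ => by
      rw [← (pushout.inr a b).naturality φ]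
      exact Category.id_comp _
    have hp := isPushout_app a b
    have hcomp : a ≫ h.incl ≫ (Functor.const J).map g' = b ≫ (Functor.const J).map f' := by
      ext j
      simp [b, reassoc_of% ha'', sq.w]
    have := isWellOrderContinuous_pushout a b
    have := isConnected_of_linearOrder J
    have : IsIso (a.app ⊥) := by rw [ha']; infer_instance
    have := (hp ⊥).isIso_inr_of_isIso
    have hl (j : J) : (pushout.inl a b).app j ≫ (pushout.desc (h.incl ≫ (Functor.const J).map g')
        ((Functor.const J).map f') hcomp).app j = h.incl.app j ≫ g' :=
      congr_app (pushout.inl_desc _ _ hcomp) j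
    have hr (j : J) : (pushout.inr a b).app j ≫ (pushout.desc (h.incl ≫ (Functor.const J).map g')
        ((Functor.const J).map f') hcomp).app j = f' :=
      congr_app (pushout.inr_desc _ _ hcomp) j
    refine transfiniteCompositions_of_isColimit W (pushout a b) (fun j hj => ?_)
      (pushout.desc (h.incl ≫ (Functor.const J).map g') ((Functor.const J).map f') hcomp)
      (isColimitPushout a b sq.flip (𝟙 _) (isColimitConstCocone J X) h.incl h.isColimit (𝟙 _)
        (isColimitConstCocone J X') ?_ ?_ _ hl (fun j => (hr j).trans (Category.id_comp _).symm))
      (asIso ((pushout.inr a b).app ⊥)).symm ?_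
    · have H : IsPushout (a.app j ≫ h.F.map (homOfLE (Order.le_succ j))) (b.app j)
          ((pushout.inl a b).app (Order.succ j))
          ((pushout.inr a b).app j ≫ (pushout a b).map (homOfLE (Order.le_succ j))) := by
        rw [ha, hb]
        exact hp _
      exact MorphismProperty.of_isPushout
        (H.of_left ((pushout.inl a b).naturality _) (hp j)).flip (h.map_mem j hj)
    · intro j
      exact (ha'' j).trans (Category.id_comp _).symm
    · intro j
      exact (Category.comp_id _).trans (Category.id_comp _).symm
    · dsimp
      rw [IsIso.inv_comp_eq]
      exact (hr ⊥).symm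

/-- By cancellation `Z = P ⊔_{AY} AZ`, while `Z' = BY ⊔_{AY} AZ`. As `AY ⟶ BY` factors through `P`,
a second cancellation gives `Z' = BY ⊔_P Z`. In the application `P ⟶ BY` is the corner map of one
step and `Z ⟶ Z'` the successor map of the new tower. -/
lemma isPushout_corner {D : Type*} [Category* D] {AX BX AY BY AZ P Z Z' : D} {αX : AX ⟶ BX}
    {αY : AY ⟶ BY} {f : AX ⟶ AY} {h : AY ⟶ AZ} {i : BX ⟶ P} {k : AY ⟶ P}
    (hP : IsPushout αX f i k) {inl : BX ⟶ Z} {inr : AZ ⟶ Z} (hZ : IsPushout αX (f ≫ h) inl inr)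
    {inl' : BY ⟶ Z'} {inr' : AZ ⟶ Z'} (hZ' : IsPushout αY h inl' inr') {c : P ⟶ BY} {m : P ⟶ Z}
    {z : Z ⟶ Z'} (hkc : k ≫ c = αY) (him : i ≫ m = inl) (hkm : k ≫ m = h ≫ inr)
    (hz : inr ≫ z = inr') (hc : i ≫ c ≫ inl' = inl ≫ z) : IsPushout c m inl' z := by
  subst hkc him hz
  refine IsPushout.of_left hZ' ?_ (IsPushout.of_left hZ.flip hkm.symm hP.flip).flip
  apply hP.hom_ext
  · simpa using hc
  · rw [reassoc_of% hkm, ← hZ'.w, Category.assoc]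

/-- The pushout-corner map of a transfinite composition, for a natural transformation between
cocontinuous functors, is a transfinite composition of cobase changes of corner maps. -/
lemma transfiniteCompositions_corner {D : Type*} [Category.{v} D] [HasPushouts D] {A B : C ⥤ D}
    (α : A ⟶ B) [PreservesColimitsOfSize.{v, v} A] [PreservesColimitsOfSize.{v, v} B]
    {W : MorphismProperty C} {W' : MorphismProperty D} [W'.IsStableUnderCobaseChange]
    (hW : ∀ ⦃X Y : C⦄ (w : X ⟶ Y), W w → ∀ ⦃P : D⦄ (i : B.obj X ⟶ P) (k : A.obj Y ⟶ P)
      (c : P ⟶ B.obj Y), IsPushout (α.app X) (A.map w) i k → i ≫ c = B.map w →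
        k ≫ c = α.app Y → W' c)
    {X Y : C} (f : X ⟶ Y) (hf : MorphismProperty.transfiniteCompositions.{v} W f)
    {P : D} (i : B.obj X ⟶ P) (k : A.obj Y ⟶ P) (c : P ⟶ B.obj Y)
    (sq : IsPushout (α.app X) (A.map f) i k) (hi : i ≫ c = B.map f) (hk : k ≫ c = α.app Y) :
    MorphismProperty.transfiniteCompositions.{v} W' c := by
  rw [MorphismProperty.transfiniteCompositions_iff] at hf
  obtain ⟨J, _, _, _, _, ⟨h⟩⟩ := hf
  let a : h.F ⋙ A ⟶ h.F ⋙ B := Functor.whiskerLeft h.F α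
  let b : h.F ⋙ A ⟶ (Functor.const J).obj (A.obj Y) :=
    { app := fun j => A.map (h.incl.app j)
      naturality := fun i j φ => by
        dsimp
        rw [← A.map_comp, h.incl.naturality, ← A.map_id, ← A.map_comp]
        rfl }
  let b' : h.F ⋙ B ⟶ (Functor.const J).obj (B.obj Y) :=
    { app := fun j => B.map (h.incl.app j)
      naturality := fun i j φ => by
        dsimp
        rw [← B.map_comp, h.incl.naturality, ← B.map_id, ← B.map_comp]
        rfl }
  -- Stage `j` of the new tower is `B (F j) ⊔_{A (F j)} A Y`. At the bottom this is `P`, since `F ⊥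
  -- ≅ X`; in the colimit it is `B Y`, since `A` and `B` preserve the colimit of `F`.
  have hp := isPushout_app a b
  have hcomp : a ≫ b' = b ≫ (Functor.const J).map (α.app Y) := by
    ext j
    simp [a, b, b']
  have : PreservesWellOrderContinuousOfShape J A := {}
  have : PreservesWellOrderContinuousOfShape J B := {}
  have := isWellOrderContinuous_pushout a b
  have := isConnected_of_linearOrder J
  have hl (j : J) : (pushout.inl a b).app j ≫ (pushout.desc b'
      ((Functor.const J).map (α.app Y)) hcomp).app j = B.map (h.incl.app j) :=
    congr_app (pushout.inl_desc _ _ hcomp) j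
  have hr (j : J) : (pushout.inr a b).app j ≫ (pushout.desc b'
      ((Functor.const J).map (α.app Y)) hcomp).app j = α.app Y :=
    congr_app (pushout.inr_desc _ _ hcomp) j
  have hb : ∀ {i j : J} (φ : i ⟶ j),
      (pushout.inr a b).app i ≫ (pushout a b).map φ = (pushout.inr a b).app j := fun φ => by
    rw [← (pushout.inr a b).naturality φ]
    exact Category.id_comp _
  have sq' : IsPushout (α.app (h.F.obj ⊥)) (A.map h.isoBot.hom) (B.map h.isoBot.hom) (α.app X) :=
    IsPushout.of_vert_isIso ⟨(α.naturality _).symm⟩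
  have hfac : h.isoBot.hom ≫ f = h.incl.app ⊥ := by simp [← Iso.eq_inv_comp]
  have sq'' : IsPushout (a.app ⊥) (b.app ⊥) (B.map h.isoBot.hom ≫ i) k := by
    have := sq'.paste_vert sq
    rw [← A.map_comp, hfac] at this
    exact this
  refine transfiniteCompositions_of_isColimit W' (pushout a b) (fun j hj => ?_)
      (pushout.desc b' ((Functor.const J).map (α.app Y)) hcomp)
      (isColimitPushout a b (IsPushout.id_vert (α.app Y)) b (isColimitOfPreserves A h.isColimit) b'
        (isColimitOfPreserves B h.isColimit) (𝟙 _)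
        (isColimitConstCocone J (A.obj Y)) ?_ (fun _ => rfl) _
        (fun j => (hl j).trans (Category.comp_id _).symm)
        (fun j => (hr j).trans (Category.id_comp _).symm))
      ((hp ⊥).isoIsPushout _ _ sq'') ?_
  · have h₁ := IsPushout.of_hasPushout (α.app (h.F.obj j))
      (A.map (h.F.map (homOfLE (Order.le_succ j))))
    let c₀ : pushout (α.app (h.F.obj j)) (A.map (h.F.map (homOfLE (Order.le_succ j)))) ⟶
        B.obj (h.F.obj (Order.succ j)) :=
      pushout.desc (B.map (h.F.map (homOfLE (Order.le_succ j)))) (α.app _) (α.naturality _).symm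
    have hAb : A.map (h.F.map (homOfLE (Order.le_succ j))) ≫ b.app (Order.succ j) = b.app j :=
      (b.naturality _).trans (Category.comp_id _)
    have hcom : α.app (h.F.obj j) ≫ (pushout.inl a b).app j =
      A.map (h.F.map (homOfLE (Order.le_succ j))) ≫ b.app (Order.succ j) ≫
        (pushout.inr a b).app j := by
      rw [reassoc_of% hAb]
      exact (hp j).w
    let m : pushout (α.app (h.F.obj j)) (A.map (h.F.map (homOfLE (Order.le_succ j)))) ⟶
        (pushout a b).obj j :=
      pushout.desc ((pushout.inl a b).app j)
        (b.app (Order.succ j) ≫ (pushout.inr a b).app j) hcom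
    have hm₁ : pushout.inl _ _ ≫ m = (pushout.inl a b).app j := pushout.inl_desc _ _ _
    have hm₂ : pushout.inr _ _ ≫ m = b.app (Order.succ j) ≫ (pushout.inr a b).app j :=
      pushout.inr_desc _ _ _
    have hc₁ : pushout.inl _ _ ≫ c₀ = B.map (h.F.map (homOfLE (Order.le_succ j))) :=
      pushout.inl_desc _ _ _
    have hc₂ : pushout.inr _ _ ≫ c₀ = α.app _ := pushout.inr_desc _ _ _
    have h₃ : IsPushout c₀ m ((pushout.inl a b).app (Order.succ j))
        ((pushout a b).map (homOfLE (Order.le_succ j))) := by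
      refine isPushout_corner h₁ (h := b.app (Order.succ j)) ?_ (hp _) hc₂ hm₁ hm₂ (hb _) ?_
      · rw [hAb]
        exact hp j
      · rw [reassoc_of% hc₁]
        exact (pushout.inl a b).naturality _
    exact MorphismProperty.of_isPushout h₃.flip (hW _ (h.map_mem j hj) _ _ c₀ h₁ hc₁ hc₂)
  · exact fun j => (α.naturality _).symm
  · apply (hp ⊥).hom_ext
    · rw [IsPushout.inl_isoIsPushout_hom_assoc, Category.assoc, hi, hl, ← B.map_comp, hfac]
    · rw [IsPushout.inr_isoIsPushout_hom_assoc, hk, hr]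

end TransfiniteCompositions

/-! ### Replacing the summands of a coproduct one at a time -/

section

variable {C : Type*} [Category* C]

/-- A cocone on a functor from a linear order is colimiting when its legs are eventually
isomorphisms. -/
noncomputable def isColimitOfEventuallyIsIso {J : Type*} [LinearOrder J] {F : J ⥤ C} {Y : C}
    (t : F ⟶ (Functor.const J).obj Y) (j₀ : J) (h : ∀ j, j₀ ≤ j → IsIso (t.app j)) :
    IsColimit (Cocone.mk _ t) :=
  have := h j₀ le_rfl
  { desc := fun T => inv (t.app j₀) ≫ T.ι.app j₀
    fac := fun T j => by
      have := h (max j j₀) (le_max_right _ _)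
      have h₁ := t.naturality (homOfLE (le_max_left j j₀))
      have h₂ := t.naturality (homOfLE (le_max_right j j₀))
      have h₃ := T.w (homOfLE (le_max_left j j₀))
      have h₄ := T.w (homOfLE (le_max_right j j₀))
      dsimp at h₁ h₂ ⊢
      rw [Category.comp_id] at h₁ h₂
      have e : inv (t.app j₀) ≫ F.map (homOfLE (le_max_right j j₀)) = inv (t.app (max j j₀)) := by
        rw [IsIso.inv_comp_eq, IsIso.eq_comp_inv, h₂]
      rw [← h₃, ← h₄, reassoc_of% e, ← h₁, Category.assoc, IsIso.hom_inv_id_assoc]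
    uniq := fun T m hm => by
      have := hm j₀
      dsimp at this
      simp [← this] }

/-- Away from `s₀` the component of a map out of `∐ B` is forced, by inverting `g s`; only the
summand `s₀` carries a condition. -/
lemma isPushout_sigmaMap {S : Type*} {A B : S → C} [HasCoproduct A] [HasCoproduct B]
    (g : ∀ s, A s ⟶ B s) (s₀ : S) (hg : ∀ s, s ≠ s₀ → IsIso (g s)) :
    IsPushout (Sigma.ι A s₀) (g s₀) (Limits.Sigma.map g) (Sigma.ι B s₀) := by
  have key (T : PushoutCocone (Sigma.ι A s₀) (g s₀)) (s : S) : ∃ d : B s ⟶ T.pt,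
      g s ≫ d = Sigma.ι A s ≫ T.inl ∧ ∀ h : s₀ = s, eqToHom (congrArg B h) ≫ d = T.inr := by
    by_cases h : s₀ = s
    · subst h
      exact ⟨T.inr, T.condition.symm, fun _ => by simp⟩
    · have := hg s (Ne.symm h)
      exact ⟨inv (g s) ≫ Sigma.ι A s ≫ T.inl, by simp, fun h' => (h h').elim⟩
  choose d hd₁ hd₂ using key
  refine ⟨⟨by simp⟩, ⟨PushoutCocone.IsColimit.mk _ (fun T => Sigma.desc (d T))
    (fun T => Sigma.hom_ext _ _ (fun s => by simp [hd₁])) (fun T => ?_) (fun T m hm₁ hm₂ => ?_)⟩⟩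
  · simpa using hd₂ T s₀ rfl
  · refine Sigma.hom_ext _ _ (fun s => ?_)
    rw [Sigma.ι_desc]
    by_cases h : s₀ = s
    · subst h
      rw [hm₂]
      simpa using (hd₂ T s₀ rfl).symm
    · have := hg s (Ne.symm h)
      rw [← cancel_epi (g s), hd₁, ← hm₁, Sigma.ι_map_assoc]

lemma isPullback_piMap {S : Type*} {A B : S → C} [HasProduct A] [HasProduct B]
    (g : ∀ s, A s ⟶ B s) (s₀ : S) (hg : ∀ s, s ≠ s₀ → IsIso (g s)) :
    IsPullback (Pi.π A s₀) (Limits.Pi.map g) (g s₀) (Pi.π B s₀) := by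
  have key (T : PullbackCone (g s₀) (Pi.π B s₀)) (s : S) : ∃ d : T.pt ⟶ A s,
      d ≫ g s = T.snd ≫ Pi.π B s ∧ ∀ h : s = s₀, d ≫ eqToHom (congrArg A h) = T.fst := by
    by_cases h : s = s₀
    · subst h
      exact ⟨T.fst, T.condition, fun _ => by simp⟩
    · have := hg s h
      exact ⟨T.snd ≫ Pi.π B s ≫ inv (g s), by simp, fun h' => (h h').elim⟩
  choose d hd₁ hd₂ using key
  refine ⟨⟨by simp⟩, ⟨PullbackCone.IsLimit.mk _ (fun T => Pi.lift (d T)) (fun T => ?_)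
    (fun T => Pi.hom_ext _ _ (fun s => by simp [hd₁])) (fun T m hm₁ hm₂ => ?_)⟩⟩
  · simpa using hd₂ T s₀ rfl
  · refine Pi.hom_ext _ _ (fun s => ?_)
    rw [Pi.lift_π]
    by_cases h : s = s₀
    · subst h
      rw [hm₁]
      simpa using (hd₂ T s rfl).symm
    · have := hg s h
      rw [← cancel_mono (g s), hd₁, ← hm₂, Category.assoc, Category.assoc, Limits.Pi.map_π]

section StepFunctor

variable {J : Type*} {A B : C}

/-- The map to `{0 < 1}` classifying an up-closed predicate. -/
noncomputable def stepIndex (p : J → Prop) (j : J) : Fin 2 :=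
  open Classical in if p j then 1 else 0

lemma stepIndex_monotone [Preorder J] {p : J → Prop} (hp : Monotone p) :
    Monotone (stepIndex p) := by
  intro i j hij
  by_cases h : p i
  · have := hp hij h
    simp [stepIndex, h, this]
  · simp [stepIndex, h]

variable [Preorder J] (f : A ⟶ B) {p : J → Prop} (hp : Monotone p)

/-- The functor which is `A` where `p` fails, `B` where `p` holds, with transition map `f`. -/
noncomputable def stepFunctor : J ⥤ C :=
  (stepIndex_monotone hp).functor ⋙ ComposableArrows.mk₁ f

/-- The map from the constant functor on the source. -/
noncomputable def stepFunctorSource (j : J) : A ⟶ (stepFunctor f hp).obj j :=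
  (ComposableArrows.mk₁ f).map (homOfLE (Fin.zero_le (stepIndex p j)))

/-- The map to the constant functor on the target. -/
noncomputable def stepFunctorTarget (j : J) : (stepFunctor f hp).obj j ⟶ B :=
  (ComposableArrows.mk₁ f).map (homOfLE (Fin.le_last (stepIndex p j)))

lemma stepFunctorSource_map {i j : J} (φ : i ⟶ j) :
    stepFunctorSource f hp i ≫ (stepFunctor f hp).map φ = stepFunctorSource f hp j :=
  ((ComposableArrows.mk₁ f).map_comp (homOfLE (Fin.zero_le (stepIndex p i)))
    ((stepIndex_monotone hp).functor.map φ)).symm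

lemma map_stepFunctorTarget {i j : J} (φ : i ⟶ j) :
    (stepFunctor f hp).map φ ≫ stepFunctorTarget f hp j = stepFunctorTarget f hp i :=
  ((ComposableArrows.mk₁ f).map_comp ((stepIndex_monotone hp).functor.map φ)
    (homOfLE (Fin.le_last (stepIndex p j)))).symm

lemma map_stepFunctorTarget_assoc {i j : J} (φ : i ⟶ j) {T : C} (k : _ ⟶ T) :
    (stepFunctor f hp).map φ ≫ stepFunctorTarget f hp j ≫ k =
      stepFunctorTarget f hp i ≫ k := by
  simp only [← Category.assoc, map_stepFunctorTarget]

lemma stepFunctorSource_target (j : J) :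
    stepFunctorSource f hp j ≫ stepFunctorTarget f hp j = f :=
  ((ComposableArrows.mk₁ f).map_comp _ _).symm

lemma stepFunctorSource_target_assoc (j : J) {T : C} (k : _ ⟶ T) :
    stepFunctorSource f hp j ≫ stepFunctorTarget f hp j ≫ k =
      f ≫ k := by
  simp only [← Category.assoc, stepFunctorSource_target]

lemma isIso_map_homOfLE {I : Type*} [PartialOrder I] (F : I ⥤ C) {i j : I} (h : i ≤ j)
    (h' : i = j) : IsIso (F.map (homOfLE h)) := by
  subst h'
  exact inferInstanceAs (IsIso (F.map (𝟙 _)))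

lemma isIso_stepFunctorSource {j : J} (h : ¬ p j) : IsIso (stepFunctorSource f hp j) :=
  isIso_map_homOfLE _ _ (by simp [stepIndex, h])

lemma isIso_stepFunctorTarget {j : J} (h : p j) : IsIso (stepFunctorTarget f hp j) :=
  isIso_map_homOfLE _ _ (by simp [stepIndex, h])

lemma isIso_stepFunctor_map {i j : J} (φ : i ⟶ j) (h : p j → p i) :
    IsIso ((stepFunctor f hp).map φ) := by
  by_cases hj : p j
  · have := isIso_stepFunctorTarget f hp hj
    have := isIso_stepFunctorTarget f hp (h hj)
    rw [← map_stepFunctorTarget f hp φ] at this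
    exact IsIso.of_isIso_comp_right _ (stepFunctorTarget f hp j)
  · have hi : ¬ p i := fun hi => hj (hp (leOfHom φ) hi)
    have := isIso_stepFunctorSource f hp hi
    have := isIso_stepFunctorSource f hp hj
    rw [← stepFunctorSource_map f hp φ] at this
    exact IsIso.of_isIso_comp_left (stepFunctorSource f hp i) _

lemma nonempty_arrowIso_stepFunctor_map {i j : J} (φ : i ⟶ j) (hi : ¬ p i) (hj : p j) :
    Nonempty (Arrow.mk f ≅ Arrow.mk ((stepFunctor f hp).map φ)) := by
  have := isIso_stepFunctorSource f hp hi
  have := isIso_stepFunctorTarget f hp hj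
  refine ⟨Arrow.isoMk (f := Arrow.mk f) (g := Arrow.mk ((stepFunctor f hp).map φ))
    (asIso (stepFunctorSource f hp i) : A ≅ (stepFunctor f hp).obj i)
    ((asIso (stepFunctorTarget f hp j)).symm : B ≅ (stepFunctor f hp).obj j) ?_⟩
  change stepFunctorSource f hp i ≫ (stepFunctor f hp).map φ = f ≫ inv (stepFunctorTarget f hp j)
  rw [stepFunctorSource_map, IsIso.eq_comp_inv, stepFunctorSource_target]

/-- The hypothesis `hp'` forbids a jump at a limit index; the transition maps to a limit are then
eventually invertible. -/
lemma isWellOrderContinuous_stepFunctor {J : Type*} [LinearOrder J] {p : J → Prop}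
    (hp : Monotone p) (hp' : ∀ m, Order.IsSuccLimit m → p m → ∃ i < m, p i) :
    (stepFunctor f hp).IsWellOrderContinuous where
  nonempty_isColimit m hm := by
    obtain ⟨i, hi, h⟩ : ∃ i < m, p m → p i := by
      by_cases h : p m
      · obtain ⟨i, hi, hi'⟩ := hp' m hm h
        exact ⟨i, hi, fun _ => hi'⟩
      · obtain ⟨i, hi⟩ := not_isMin_iff.1 hm.1
        exact ⟨i, hi, fun h' => (h h').elim⟩
    exact ⟨isColimitOfEventuallyIsIso _ ⟨i, hi⟩
      (fun j hj => isIso_stepFunctor_map f hp (homOfLE (le_of_lt j.2)) (fun h' => hp hj (h h')))⟩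

end StepFunctor

end

section

variable {C : Type u} [Category.{v} C]

/-- Well-order `S` and replace `A s` by `B s` one summand at a time: each step is a cobase change of
a single `f s`. -/
lemma transfiniteCompositions_sigmaMap [HasCoproducts.{v} C] (W : MorphismProperty C)
    [W.IsStableUnderCobaseChange] {S : Type v} {A B : S → C} (f : ∀ s, A s ⟶ B s)
    (hf : ∀ s, W (f s)) :
    MorphismProperty.transfiniteCompositions.{v} W (Limits.Sigma.map f) := by
  obtain ⟨_, _⟩ := exists_wellFoundedLT S
  let : OrderBot (WithTop S) := WellFoundedLT.toOrderBot _
  let : SuccOrder (WithTop S) := SuccOrder.ofLinearWellFoundedLT _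
  -- At stage `j` the summands `s < j` have been replaced, so the step at `j` replaces exactly the
  -- summand `j`. At the added top every summand has been replaced, and this stage serves as
  -- colimit.
  have hp (s : S) : Monotone (fun j : WithTop S => (s : WithTop S) < j) :=
    fun i j hij h => lt_of_lt_of_le h hij
  let G (s : S) : WithTop S ⥤ C := stepFunctor (f s) (hp s)
  let Z : WithTop S ⥤ C :=
    { obj := fun j => ∐ fun s => (G s).obj j
      map := fun φ => Limits.Sigma.map (fun s => (G s).map φ) }
  let c : Cocone (Discrete.functor G) := Cofan.mk Z (fun s =>
    { app := fun j => Sigma.ι (fun s => (G s).obj j) s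
      naturality := fun i j φ => by simp [Z] })
  have : Z.IsWellOrderContinuous :=
    isWellOrderContinuous_of_isColimit (c := c)
      (fun s => show (stepFunctor (f s.as) (hp s.as)).IsWellOrderContinuous from
        isWellOrderContinuous_stepFunctor _ _ (fun m hm hs =>
          ⟨Order.succ (s.as : WithTop S), hm.succ_lt hs,
            Order.lt_succ_of_not_isMax hs.not_isMax⟩))
      (fun j => (isColimitMapCoconeCofanMkEquiv _ _ _).symm
        (coproductIsCoproduct (fun s => (G s).obj j)))
  let t : Z ⟶ (Functor.const (WithTop S)).obj (∐ B) :=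
    { app := fun j => Limits.Sigma.map (fun s => stepFunctorTarget (f s) (hp s) j)
      naturality := fun i j φ => Sigma.hom_ext _ _ (fun s => by
        simp [Z, G, map_stepFunctorTarget_assoc]) }
  have : IsIso (t.app ⊤) := by
    have (s : S) := isIso_stepFunctorTarget (f s) (hp s) (j := ⊤) (WithTop.coe_lt_top s)
    dsimp only [t]
    infer_instance
  have (s : S) := isIso_stepFunctorSource (f s) (hp s) (j := ⊥) not_lt_bot
  refine transfiniteCompositions_of_isColimit W Z (fun j hj => ?_) t
    (isColimitOfEventuallyIsIso t ⊤ (fun j hj => by rwa [top_le_iff.1 hj]))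
    (asIso (Limits.Sigma.map (fun s => stepFunctorSource (f s) (hp s) ⊥))).symm ?_
  · lift j to S using by rintro rfl; exact hj isMax_top
    have := isPushout_sigmaMap (fun s => (G s).map (homOfLE (Order.le_succ (j : WithTop S)))) j
      (fun s hs => isIso_stepFunctor_map _ _ _ (fun h => lt_of_le_of_ne
        ((Order.lt_succ_iff_of_not_isMax hj).1 h) (by simpa using hs)))
    refine MorphismProperty.of_isPushout this ?_
    exact (W.arrow_mk_iso_iff (nonempty_arrowIso_stepFunctor_map (f j) (hp j)
      (homOfLE (Order.le_succ (j : WithTop S))) (lt_irrefl _)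
      (Order.lt_succ_of_not_isMax hj)).some).1 (hf j)
  · dsimp [t]
    rw [IsIso.inv_comp_eq]
    exact Sigma.hom_ext _ _ (fun s => by simp [stepFunctorSource_target_assoc])

end

/-! ### Deleting isomorphism steps from a tower -/

section Trim

variable {C : Type*} [Category* C] {J : Type*} [LinearOrder J] [SuccOrder J] (F : J ⥤ C)

/-- The stage `j` is followed by an isomorphism in the tower `F`. -/
def IsIsoStep (j : J) : Prop := IsIso (F.map (homOfLE (Order.le_succ j)))

/-- The indices at which something new happens in the tower `F`: `j` is not reached from any
previous index through isomorphisms only. -/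
def IsEssential (j : J) : Prop := ∀ i < j, ∃ k, i ≤ k ∧ k < j ∧ ¬ IsIsoStep F k

variable {F}

/-- Transfinite induction on `j`. At a limit, the diagram below `j` is constant from `i` on up to
isomorphism, so its map to the colimit is invertible. -/
lemma isIso_map_of_isIsoStep [WellFoundedLT J] [F.IsWellOrderContinuous] {i j : J} (φ : i ⟶ j)
    (h : ∀ k, i ≤ k → k < j → IsIsoStep F k) : IsIso (F.map φ) := by
  induction j using SuccOrder.limitRecOn with
  | isMin j hj => exact isIso_map_homOfLE F _ (le_antisymm (leOfHom φ) (hj (leOfHom φ)))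
  | succ j hj ih =>
    rcases (leOfHom φ).eq_or_lt with rfl | hij
    · exact isIso_map_homOfLE F _ rfl
    · have hij := (Order.lt_succ_iff_of_not_isMax hj).1 hij
      have := ih (homOfLE hij) (fun k hk hk' => h k hk (hk'.trans_le (Order.le_succ j)))
      have : IsIso (F.map (homOfLE (Order.le_succ j))) :=
        h j hij (Order.lt_succ_of_not_isMax hj)
      rw [show φ = homOfLE hij ≫ homOfLE (Order.le_succ j) from rfl, F.map_comp]
      infer_instance
  | isSuccLimit j hj ih =>
    rcases (leOfHom φ).eq_or_lt with rfl | hij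
    · exact isIso_map_homOfLE F _ rfl
    · have hc : Functor.IsEventuallyConstantFrom
          ((Set.principalSegIio j).monotone.functor ⋙ F) ⟨i, hij⟩ := fun k ψ =>
        ih k.1 k.2 (homOfLE (leOfHom ψ)) (fun l hl hl' => h l hl (hl'.trans k.2))
      have : Nonempty (Set.Iio j) := ⟨⟨i, hij⟩⟩
      exact hc.isIso_ι_of_isColimit (F.isColimitOfIsWellOrderContinuous j hj)

lemma isEssential_succ {k : J} (hk : ¬ IsIsoStep F k) : IsEssential F (Order.succ k) := by
  have hk' : ¬ IsMax k := fun h =>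
    hk (isIso_map_homOfLE F _ (Order.succ_eq_iff_isMax.2 h).symm)
  exact fun i hi => ⟨k, (Order.lt_succ_iff_of_not_isMax hk').1 hi,
    Order.lt_succ_of_not_isMax hk', hk⟩

variable [WellFoundedLT J]

variable (F) in
-- Take the least `i ≤ j` from which only isomorphism steps lead to `j`; were it not essential, an
-- earlier index would do.
lemma exists_isEssential_le (j : J) :
    ∃ i, IsEssential F i ∧ i ≤ j ∧ ∀ k, i ≤ k → k < j → IsIsoStep F k := by
  let S : Set J := {i | i ≤ j ∧ ∀ k, i ≤ k → k < j → IsIsoStep F k}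
  have hS : S.Nonempty := ⟨j, le_rfl, fun k hk hk' => (hk.not_gt hk').elim⟩
  have hm := WellFounded.min_mem (wellFounded_lt (α := J)) S hS
  refine ⟨_, fun i hi => ?_, hm⟩
  by_contra! hi'
  refine WellFounded.not_lt_min (wellFounded_lt (α := J)) S (x := i)
    ⟨hi.le.trans hm.1, fun k hk hk' => ?_⟩ hi
  by_cases h : k < WellFounded.min (wellFounded_lt (α := J)) S hS
  · exact hi' k hk h
  · exact hm.2 k (not_lt.1 h) hk'

instance [OrderBot J] : OrderBot (Subtype (IsEssential F)) where
  bot := ⟨⊥, fun _ hi => (not_lt_bot hi).elim⟩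
  bot_le j := bot_le (a := j.1)

noncomputable instance : SuccOrder (Subtype (IsEssential F)) :=
  SuccOrder.ofLinearWellFoundedLT _

/-- If `m` covered some `a` in `J`, it would cover, among the essential indices, the one below `a`
that leads to `a` through isomorphisms only. -/
lemma isSuccLimit_of_isEssential {m : Subtype (IsEssential F)} (hm : Order.IsSuccLimit m) :
    Order.IsSuccLimit m.1 := by
  refine ⟨fun h => hm.1 (fun a ha => h (b := a.1) ha), fun a ha => ?_⟩
  obtain ⟨j, hj, hja, hj'⟩ := exists_isEssential_le F a
  refine hm.2 ⟨j, hj⟩ ⟨show j < m.1 from lt_of_le_of_lt hja ha.1, fun x hx hx' => ?_⟩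
  obtain ⟨k, hk, hk', hk''⟩ := x.2 j hx
  have : x.1 ≤ a := by
    by_contra! h
    exact ha.2 h hx'
  exact hk'' (hj' k hk (hk'.trans_le this))

variable (F) in
/-- The restriction of `F` to the essential indices. -/
def trim : Subtype (IsEssential F) ⥤ C := (Subtype.mono_coe (IsEssential F)).functor ⋙ F

/-- Below an essential limit the successors of the non-invertible steps are essential and cofinal,
so restricting to essential indices leaves the colimit unchanged. -/
instance [F.IsWellOrderContinuous] : (trim F).IsWellOrderContinuous where
  nonempty_isColimit m hm := ⟨by
    let f : Set.Iio m → Set.Iio m.1 := fun a => ⟨a.1.1, a.2⟩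
    have hf : Monotone f := fun _ _ h => h
    have : hf.functor.Final := by
      rw [Monotone.final_functor_iff]
      rintro ⟨i, hi⟩
      obtain ⟨k, hk, hk', hk''⟩ := m.2 i hi
      exact ⟨⟨⟨Order.succ k, isEssential_succ hk''⟩,
        (isSuccLimit_of_isEssential hm).succ_lt hk'⟩, hk.trans (Order.le_succ k)⟩
    exact (Functor.Final.isColimitWhiskerEquiv (F := hf.functor) _).2
      (F.isColimitOfIsWellOrderContinuous m.1 (isSuccLimit_of_isEssential hm))⟩

/-- Let `k` be the first non-invertible step from `j` on. Then `succ k` is the next essential index,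
and the map from `j` to it is an isomorphism followed by the single step at `k`. -/
lemma trim_map_mem [F.IsWellOrderContinuous] (W : MorphismProperty C) [W.RespectsIso]
    (hF : ∀ k, ¬ IsIsoStep F k → W (F.map (homOfLE (Order.le_succ k))))
    (j : Subtype (IsEssential F)) (hj : ¬ IsMax j) :
    W ((trim F).map (homOfLE (Order.le_succ j))) := by
  obtain ⟨k₀, hk₀, hk₀', hk₀''⟩ := (Order.succ j).2 j (Order.lt_succ_of_not_isMax hj)
  let S : Set J := {k | j.1 ≤ k ∧ ¬ IsIsoStep F k}
  have hS : S.Nonempty := ⟨k₀, hk₀, hk₀''⟩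
  obtain ⟨hk₁, hk₂⟩ := WellFounded.min_mem (wellFounded_lt (α := J)) S hS
  have hk₃ (k : J) (hk : j.1 ≤ k) (hk' : k < WellFounded.min wellFounded_lt S hS) :
      IsIsoStep F k := by
    by_contra h
    exact WellFounded.not_lt_min (wellFounded_lt (α := J)) S (x := k) ⟨hk, h⟩ hk'
  have hk₄ : WellFounded.min wellFounded_lt S hS < (Order.succ j).1 :=
    lt_of_le_of_lt (not_lt.1 (WellFounded.not_lt_min (wellFounded_lt (α := J)) S (x := k₀)
      ⟨hk₀, hk₀''⟩)) hk₀'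
  generalize WellFounded.min wellFounded_lt S hS = k at *
  have hk₅ : (Order.succ j).1 = Order.succ k := by
    refine le_antisymm (Order.succ_le_of_lt (a := j) (b := ⟨_, isEssential_succ hk₂⟩)
      (show j.1 < Order.succ k from lt_of_le_of_lt hk₁
        (Order.lt_succ_of_not_isMax hk₄.not_isMax))) (Order.succ_le_of_lt hk₄)
  have key : ∀ x (hx : x = Order.succ k) (h : j.1 ≤ x), W (F.map (homOfLE h)) := by
    rintro _ rfl h
    have := isIso_map_of_isIsoStep (homOfLE hk₁) hk₃
    rw [show homOfLE h = homOfLE hk₁ ≫ homOfLE (Order.le_succ k) from rfl, F.map_comp]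
    exact (W.cancel_left_of_respectsIso _ _).2 (hF k hk₂)
  exact key _ hk₅ _

/-- If there is a last essential index, the tower is constant from it on up to isomorphism;
otherwise the essential indices are cofinal. -/
lemma nonempty_isColimit_trim [F.IsWellOrderContinuous] {Y : C}
    (t : F ⟶ (Functor.const J).obj Y) (ht : IsColimit (Cocone.mk _ t)) :
    Nonempty (IsColimit (Cocone.mk Y
      ((Subtype.mono_coe (IsEssential F)).functor.whiskerLeft t : trim F ⟶ _))) := by
  by_cases h : ∃ j : Subtype (IsEssential F), IsMax j
  · obtain ⟨j, hj⟩ := h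
    have : Nonempty J := ⟨j.1⟩
    have hc : F.IsEventuallyConstantFrom j.1 := fun k φ =>
      isIso_map_of_isIsoStep φ (fun l hl hl' => by
        by_contra hl''
        have h₁ : Order.succ l ≤ j.1 := hj (b := ⟨_, isEssential_succ hl''⟩)
          (hl.trans (Order.le_succ l))
        exact (h₁.trans hl).not_gt (Order.lt_succ_of_not_isMax hl'.not_isMax))
    refine ⟨isColimitOfEventuallyIsIso _ j (fun k hk => ?_)⟩
    obtain rfl := hj.eq_of_le hk
    exact hc.isIso_ι_of_isColimit ht
  · push Not at h
    have : (Subtype.mono_coe (IsEssential F)).functor.Final := by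
      rw [Monotone.final_functor_iff]
      intro i
      obtain ⟨j, hj, hji, hj'⟩ := exists_isEssential_le F i
      obtain ⟨j', hjj'⟩ := not_isMax_iff.1 (h ⟨j, hj⟩)
      obtain ⟨k, hk, hk', hk''⟩ := j'.2 j hjj'
      refine ⟨j', le_trans ?_ hk'.le⟩
      by_contra! hki
      exact hk'' (hj' k hk hki)
    exact ⟨(Functor.Final.isColimitWhiskerEquiv _ _).2 ht⟩

end Trim

section

variable {C : Type u} [Category.{v} C]

/-- Joining towers end to end creates isomorphism steps, which `W` need not contain; keeping only
the essential indices removes them. -/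
lemma transfiniteCompositions_sup_isomorphisms_le (W : MorphismProperty C) [W.RespectsIso] :
    MorphismProperty.transfiniteCompositions.{v} (W ⊔ MorphismProperty.isomorphisms C) ≤
      MorphismProperty.transfiniteCompositions.{v} W := by
  intro X Y f hf
  rw [MorphismProperty.transfiniteCompositions_iff] at hf
  obtain ⟨J, _, _, _, _, ⟨h⟩⟩ := hf
  obtain ⟨ht⟩ := nonempty_isColimit_trim h.incl h.isColimit
  refine transfiniteCompositions_of_isColimit W (trim h.F)
    (fun j hj => trim_map_mem W (fun k hk => ?_) j hj) _ ht h.isoBot ?_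
  · have hk' : ¬ IsMax k := fun h' =>
      hk (isIso_map_homOfLE h.F _ (Order.succ_eq_iff_isMax.2 h').symm)
    exact (h.map_mem k hk').resolve_right hk
  · change h.isoBot.hom ≫ f = h.incl.app ⊥
    simp [← Iso.eq_inv_comp]

end

/-! ### Concatenation of towers in lexicographic order -/

section Cofinal

variable {C : Type*} [Category* C]

/-- A cocone on a functor out of a preorder is colimiting if its restriction along a cofinal
monotone map is, up to isomorphism. -/
noncomputable def isColimitOfCofinal {A P : Type*} [LinearOrder A] [Preorder P] {g : A → P}
    (hg : Monotone g) (hg' : ∀ p, ∃ a, p ≤ g a) {H : P ⥤ C} (c : Cocone H) {K : A ⥤ C}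
    {k : Cocone K} (hk : IsColimit k) (ε : K ≅ hg.functor ⋙ H) (e : k.pt ≅ c.pt)
    (w : ∀ a, k.ι.app a ≫ e.hom = ε.hom.app a ≫ c.ι.app (g a)) : IsColimit c :=
  have : hg.functor.Final := (Monotone.final_functor_iff hg).2 hg'
  Functor.Final.isColimitWhiskerEquiv hg.functor c
    (IsColimit.ofIsoColimit ((IsColimit.precomposeHomEquiv ε.symm k).symm hk)
      (Cocone.ext e (fun a => by
        change (ε.inv.app a ≫ k.ι.app a) ≫ e.hom = c.ι.app (g a)
        refine (Category.assoc _ _ _).trans ((congr_arg (ε.inv.app a ≫ ·) (w a)).trans ?_)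
        exact ε.inv_hom_id_app_assoc a _)))

end Cofinal

section Concat

variable {I : Type*} [LinearOrder I] {J : I → Type*}
  [∀ i, LinearOrder (J i)]

instance [WellFoundedLT I] [∀ i, WellFoundedLT (J i)] : WellFoundedLT (Σₗ i, J i) := by
  refine ⟨⟨?_⟩⟩
  have key : ∀ (i : I) (a : J i), Acc (· < ·) (toLex ⟨i, a⟩ : Σₗ i, J i) := by
    intro i
    induction i using WellFoundedLT.induction with
    | ind i hi =>
      intro a
      induction a using WellFoundedLT.induction with
      | ind a ha =>
        constructor
        rintro ⟨i', b⟩ (⟨_, _, h⟩ | ⟨_, _, h⟩)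
        · exact hi _ h _
        · exact ha _ h
  exact fun p => key p.1 p.2

lemma monotone_fiber (i : I) : Monotone (fun a : J i => (toLex ⟨i, a⟩ : Σₗ i, J i)) :=
  fun _ _ hab => Sigma.Lex.right _ _ hab

lemma monotone_start [∀ i, OrderBot (J i)] : Monotone (fun i : I => (toLex ⟨i, ⊥⟩ : Σₗ i, J i)) := fun i j hij => by
  obtain rfl | hij := hij.eq_or_lt
  · exact le_rfl
  · exact Sigma.Lex.left _ _ hij

lemma fst_lt_of_lt_start [∀ i, OrderBot (J i)] {p : Σₗ i, J i} {j : I} (hp : p < toLex ⟨j, ⊥⟩) : p.1 < j := by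
  obtain ⟨_, _, h⟩ | ⟨_, _, h⟩ := hp
  · exact h
  · exact (not_lt_bot h).elim

variable {C : Type*} [Category* C] [SuccOrder I] [∀ i, OrderBot (J i)]
  [∀ i, SuccOrder (J i)] [∀ i, WellFoundedLT (J i)] {G : I ⥤ C}
  (h : ∀ i, TransfiniteCompositionOfShape (J i) (G.map (homOfLE (Order.le_succ i))))

/-- The map from the bottom of the `i`-th tower to its stage `a`. -/
def concatEntry (i : I) (a : J i) : G.obj i ⟶ (h i).F.obj a :=
  (h i).isoBot.inv ≫ (h i).F.map (homOfLE bot_le)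

/-- A transition map between stages of the same tower. -/
def concatMapFiber : ∀ {i i' : I} (e : i = i') (a : J i) (b : J i') (_ : e.rec a ≤ b),
    (h i).F.obj a ⟶ (h i').F.obj b
  | i, _, rfl, _, _, hab => (h i).F.map (homOfLE hab)

/-- The transition maps of the concatenation of the towers `h i`. -/
def concatMap {p q : Σₗ i, J i} (hpq : p ≤ q) : (h p.1).F.obj p.2 ⟶ (h q.1).F.obj q.2 :=
  if hlt : p.1 < q.1 then (h p.1).incl.app p.2 ≫ G.map (homOfLE (Order.succ_le_of_lt hlt)) ≫
    concatEntry h q.1 q.2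
  else concatMapFiber h ((Sigma.Lex.le_def.1 hpq).resolve_left hlt).fst _ _
    ((Sigma.Lex.le_def.1 hpq).resolve_left hlt).snd

lemma concatMap_fiber {i : I} {a b : J i} (hab : a ≤ b)
    (hab' : (toLex ⟨i, a⟩ : Σₗ i, J i) ≤ toLex ⟨i, b⟩) :
    concatMap h hab' = (h i).F.map (homOfLE hab) :=
  dif_neg (lt_irrefl i)

lemma concatMap_lt {i j : I} (hij : i < j) {a : J i} {b : J j}
    (hab' : (toLex ⟨i, a⟩ : Σₗ i, J i) ≤ toLex ⟨j, b⟩) :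
    concatMap h hab' = (h i).incl.app a ≫ G.map (homOfLE (Order.succ_le_of_lt hij)) ≫
      concatEntry h j b :=
  dif_pos hij

@[simp]
lemma concatEntry_map (i : I) {a b : J i} (φ : a ⟶ b) :
    concatEntry h i a ≫ (h i).F.map φ = concatEntry h i b := by
  simp only [concatEntry, Category.assoc, ← Functor.map_comp]
  rfl

@[simp]
lemma concat_map_incl (i : I) {a b : J i} (φ : a ⟶ b) :
    (h i).F.map φ ≫ (h i).incl.app b = (h i).incl.app a := by
  simp

@[simp]
lemma concat_map_incl_assoc (i : I) {a b : J i} (φ : a ⟶ b) {T : C} (k : _ ⟶ T) :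
    (h i).F.map φ ≫ (h i).incl.app b ≫ k =
      (h i).incl.app a ≫ k := by
  simp only [← Category.assoc, concat_map_incl]

@[simp]
lemma concatEntry_incl (i : I) (a : J i) :
    concatEntry h i a ≫ (h i).incl.app a = G.map (homOfLE (Order.le_succ i)) := by
  simp [concatEntry]

@[simp]
lemma concatEntry_incl_assoc (i : I) (a : J i) {T : C} (k : _ ⟶ T) :
    concatEntry h i a ≫ (h i).incl.app a ≫ k =
      G.map (homOfLE (Order.le_succ i)) ≫ k := by
  simp only [← Category.assoc, concatEntry_incl]

/-- The concatenation of a family of towers. -/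
def concat : (Σₗ i, J i) ⥤ C where
  obj p := (h p.1).F.obj p.2
  map φ := concatMap h (leOfHom φ)
  map_id p := by
    obtain ⟨i, a⟩ := p
    exact (concatMap_fiber h le_rfl _).trans ((h i).F.map_id a)
  map_comp := by
    rintro ⟨i, a⟩ ⟨j, b⟩ ⟨k, c⟩ φ ψ
    obtain ⟨_, _, hij⟩ | ⟨_, _, hab⟩ := leOfHom φ
    · obtain ⟨_, _, hjk⟩ | ⟨_, _, hbc⟩ := leOfHom ψ
      · refine (concatMap_lt h (hij.trans hjk) _).trans
          (Eq.symm ((congr_arg₂ _ (concatMap_lt h hij _) (concatMap_lt h hjk _)).trans ?_))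
        simp only [Category.assoc, concatEntry_incl_assoc]
        simp only [← Functor.map_comp_assoc]
        rfl
      · refine (concatMap_lt h hij _).trans
          (Eq.symm ((congr_arg₂ _ (concatMap_lt h hij _) (concatMap_fiber h hbc _)).trans ?_))
        simp only [Category.assoc, concatEntry_map]
        rfl
    · obtain ⟨_, _, hjk⟩ | ⟨_, _, hbc⟩ := leOfHom ψ
      · refine (concatMap_lt h hjk _).trans
          (Eq.symm ((congr_arg₂ _ (concatMap_fiber h hab _) (concatMap_lt h hjk _)).trans ?_))
        simp only [concat_map_incl_assoc]
        rfl
      · refine (concatMap_fiber h (hab.trans hbc) _).trans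
          (Eq.symm ((congr_arg₂ _ (concatMap_fiber h hab _) (concatMap_fiber h hbc _)).trans ?_))
        rw [← Functor.map_comp]
        rfl

lemma concat_map_fiber {i : I} {a b : J i} (hab : a ≤ b)
    (φ : (toLex ⟨i, a⟩ : Σₗ i, J i) ⟶ toLex ⟨i, b⟩) :
    (concat h).map φ = (h i).F.map (homOfLE hab) := concatMap_fiber h hab (leOfHom φ)

lemma concat_map_lt {i j : I} (hij : i < j) {a : J i} {b : J j}
    (φ : (toLex ⟨i, a⟩ : Σₗ i, J i) ⟶ toLex ⟨j, b⟩) :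
    (concat h).map φ = (h i).incl.app a ≫ G.map (homOfLE (Order.succ_le_of_lt hij)) ≫
      concatEntry h j b :=
  concatMap_lt h hij (leOfHom φ)

lemma isIso_concatEntry_bot (i : I) : IsIso (concatEntry h i ⊥) := by
  have := isIso_map_homOfLE (h i).F (bot_le (a := (⊥ : J i))) rfl
  dsimp only [concatEntry]
  infer_instance

/-- The cocone over the concatenation induced by a cocone over the original tower. -/
def concatCocone {Y : C} (t : G ⟶ (Functor.const I).obj Y) :
    concat h ⟶ (Functor.const _).obj Y where
  app p := (h p.1).incl.app p.2 ≫ t.app (Order.succ p.1)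
  naturality := by
    rintro ⟨i, a⟩ ⟨j, b⟩ φ
    refine Eq.trans ?_ (Category.comp_id _).symm
    have ht {i j : I} (φ : i ⟶ j) : G.map φ ≫ t.app j = t.app i := by simp
    obtain ⟨_, _, hij⟩ | ⟨_, _, hab⟩ := leOfHom φ
    · refine (congr_arg (· ≫ _) (concat_map_lt h hij _)).trans ?_
      change _ ≫ (h j).incl.app b ≫ t.app (Order.succ j) =
        (h i).incl.app a ≫ t.app (Order.succ i)
      rw [Category.assoc, Category.assoc, concatEntry_incl_assoc, ht, ht]
    · refine (congr_arg (· ≫ _) (concat_map_fiber h hab _)).trans ?_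
      exact concat_map_incl_assoc h i _ _

/-- The stage `i` of the tower `G` is the beginning of the `i`-th tower. -/
noncomputable def concatStart (i : I) : G.obj i ≅ (concat h).obj (toLex ⟨i, ⊥⟩) :=
  have := isIso_concatEntry_bot h i
  (asIso (concatEntry h i ⊥) : G.obj i ≅ (h i).F.obj ⊥)

lemma concatStart_concatCocone {Y : C} (t : G ⟶ (Functor.const I).obj Y) (i : I) :
    (concatStart h i).hom ≫ (concatCocone h t).app (toLex ⟨i, ⊥⟩) = t.app i := by
  change concatEntry h i ⊥ ≫ (h i).incl.app ⊥ ≫ t.app (Order.succ i) = _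
  simp

lemma concatStart_map {i j : I} (φ : i ⟶ j)
    (ψ : (toLex ⟨i, ⊥⟩ : Σₗ i, J i) ⟶ toLex ⟨j, ⊥⟩) :
    G.map φ ≫ (concatStart h j).hom = (concatStart h i).hom ≫ (concat h).map ψ := by
  obtain rfl | hij := (leOfHom φ).eq_or_lt
  · rw [Subsingleton.elim φ (𝟙 _), Subsingleton.elim ψ (𝟙 _)]
    simp
  · rw [concat_map_lt h hij ψ]
    change G.map φ ≫ concatEntry h j ⊥ = concatEntry h i ⊥ ≫ (h i).incl.app ⊥ ≫
      G.map (homOfLE (Order.succ_le_of_lt hij)) ≫ concatEntry h j ⊥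
    rw [concatEntry_incl_assoc, ← Functor.map_comp_assoc]
    rfl

/-- If `I` has a last index `i`, the tower over it is cofinal and its colimit is `G (succ i) = G i ≅
Y`. Otherwise the starting points `(i, ⊥)` are cofinal and reproduce `G`. -/
lemma nonempty_isColimit_concatCocone {Y : C} (t : G ⟶ (Functor.const I).obj Y)
    (ht : IsColimit (Cocone.mk _ t)) : Nonempty (IsColimit (Cocone.mk _ (concatCocone h t))) := by
  by_cases hI : ∃ i : I, IsMax i
  · obtain ⟨i, hi⟩ := hI
    have : Nonempty I := ⟨i⟩
    have hc : G.IsEventuallyConstantFrom i := fun j φ =>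
      isIso_map_homOfLE G _ (le_antisymm (leOfHom φ) (hi (leOfHom φ)))
    have : IsIso (t.app i) := hc.isIso_ι_of_isColimit ht
    have h1 : IsIso (t.app (Order.succ i)) := by
      rw [Order.succ_eq_iff_isMax.2 hi]
      infer_instance
    refine ⟨isColimitOfCofinal (monotone_fiber i) ?_ _ (h i).isColimit
      (NatIso.ofComponents (fun a => Iso.refl _) (fun {a b} φ => ?_))
      (asIso (t.app (Order.succ i))) (fun a => ?_)⟩
    · rintro ⟨j, b⟩
      obtain rfl | hj := (show j ≤ i from not_lt.1 hi.not_lt).eq_or_lt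
      · exact ⟨b, le_rfl⟩
      · exact ⟨⊥, Sigma.Lex.left _ _ hj⟩
    · refine (Category.comp_id _).trans (Eq.trans ?_ (Category.id_comp _).symm)
      exact (concat_map_fiber h (leOfHom φ) (homOfLE (monotone_fiber _ (leOfHom φ)))).symm
    · exact (Category.id_comp _).symm
  · push Not at hI
    refine ⟨isColimitOfCofinal monotone_start ?_ _ ht
      (NatIso.ofComponents (concatStart h) (fun φ => concatStart_map h φ (homOfLE (monotone_start (leOfHom φ)))))
      (Iso.refl _) (fun i => ?_)⟩
    · rintro ⟨i, b⟩
      exact ⟨Order.succ i, Sigma.Lex.left _ _ (Order.lt_succ_of_not_isMax (hI i))⟩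
    · exact (Category.comp_id _).trans (concatStart_concatCocone h t i).symm

/-- A step inside a tower is a step of that tower. From the last stage of a tower one passes to the
start of the next tower, and this is invertible: a tower with a last stage reaches its colimit
there, which is where the next one begins. -/
lemma isIso_or_concat_map (W : MorphismProperty C) [SuccOrder (Σₗ i, J i)]
    (hW : ∀ i (a : J i), ¬ IsMax a → W ((h i).F.map (homOfLE (Order.le_succ a))))
    (p : Σₗ i, J i) (hp : ¬ IsMax p) :
    (W ⊔ MorphismProperty.isomorphisms C) ((concat h).map (homOfLE (Order.le_succ p))) := by
  rcases p with ⟨i, a⟩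
  by_cases ha : IsMax a
  · right
    have hi : ¬ IsMax i := fun hi => hp (by
      rintro ⟨j, b⟩ (⟨_, _, hj⟩ | ⟨_, _, hj⟩)
      · exact (hi.not_lt hj).elim
      · exact Sigma.Lex.right _ _ (ha hj))
    have hi' := Order.lt_succ_of_not_isMax hi
    have hs : Order.succ (toLex ⟨i, a⟩ : Σₗ i, J i) = toLex ⟨Order.succ i, ⊥⟩ := by
      refine CovBy.succ_eq ⟨Sigma.Lex.left _ _ hi', ?_⟩
      rintro ⟨k, c⟩ h₁ h₂
      have h₂ := (Order.lt_succ_iff_of_not_isMax hi).1 (fst_lt_of_lt_start h₂)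
      obtain ⟨_, _, h₁⟩ | ⟨_, _, h₁⟩ := h₁
      · exact h₂.not_gt h₁
      · exact ha.not_lt h₁
    have key : ∀ x (_ : x = (toLex ⟨Order.succ i, ⊥⟩ : Σₗ i, J i)) (hx : toLex ⟨i, a⟩ ≤ x),
        IsIso ((concat h).map (homOfLE hx)) := by
      rintro _ rfl hx
      have h₁ : IsIso ((h i).incl.app a) := by
        have hc : (h i).F.IsEventuallyConstantFrom a := fun j φ =>
          isIso_map_homOfLE (h i).F _ (le_antisymm (leOfHom φ) (ha (leOfHom φ)))
        exact hc.isIso_ι_of_isColimit (h i).isColimit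
      have h₂ := isIso_concatEntry_bot h (Order.succ i)
      have h₃ := isIso_map_homOfLE G (Order.succ_le_of_lt hi') rfl
      rw [concat_map_lt h hi']
      exact IsIso.comp_isIso' h₁ (IsIso.comp_isIso' h₃ h₂)
    exact key _ hs _
  · left
    have hs : Order.succ (toLex ⟨i, a⟩ : Σₗ i, J i) = toLex ⟨i, Order.succ a⟩ := by
      refine CovBy.succ_eq ⟨Sigma.Lex.right _ _ (Order.lt_succ_of_not_isMax ha), ?_⟩
      rintro ⟨k, c⟩ (⟨_, _, h₁⟩ | ⟨_, _, h₁⟩) (⟨_, _, h₂⟩ | ⟨_, _, h₂⟩)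
      · exact h₁.not_gt h₂
      · exact h₁.ne rfl
      · exact h₂.ne rfl
      · exact ((Order.lt_succ_iff_of_not_isMax ha).1 h₂).not_gt h₁
    have key : ∀ x (_ : x = (toLex ⟨i, Order.succ a⟩ : Σₗ i, J i)) (hx : toLex ⟨i, a⟩ ≤ x),
        W ((concat h).map (homOfLE hx)) := by
      rintro _ rfl hx
      rw [concat_map_fiber h (Order.le_succ a)]
      exact hW i a ha
    exact key _ hs _

/-- There are three kinds of limit index: the start of a tower over a limit of `I`, where the
earlier starts are cofinal; the start of a tower over a successor, where the preceding tower is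
cofinal; and a limit stage within one tower. -/
lemma isWellOrderContinuous_concat [G.IsWellOrderContinuous] :
    (concat h).IsWellOrderContinuous where
  nonempty_isColimit := by
    rintro ⟨i, b⟩ hm
    by_cases hb : b = ⊥
    · subst hb
      have hi : ¬ IsMin i := fun hi => by
        refine hm.1 ?_
        rintro ⟨j, b⟩ (⟨_, _, hj⟩ | ⟨_, _, hj⟩)
        · exact (hi.not_lt hj).elim
        · exact Sigma.Lex.right _ _ bot_le
      by_cases hi' : Order.IsSuccLimit i
      · have hg : Monotone (fun j : Set.Iio i =>
            (⟨toLex ⟨j.1, ⊥⟩, Sigma.Lex.left _ _ j.2⟩ : Set.Iio (toLex ⟨i, ⊥⟩ : Σₗ i, J i))) :=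
          fun j k hjk => monotone_start hjk
        refine ⟨isColimitOfCofinal hg ?_ _ (G.isColimitOfIsWellOrderContinuous i hi')
          (NatIso.ofComponents (fun j => concatStart h j.1) (fun φ => concatStart_map h _
            (homOfLE (monotone_start (leOfHom φ)))))
          (concatStart h i) (fun j => concatStart_map h _
            (homOfLE (monotone_start j.2.le)))⟩
        rintro ⟨⟨j, b⟩, ⟨_, _, hj⟩ | ⟨_, _, hj⟩⟩
        · exact ⟨⟨_, hi'.succ_lt hj⟩, Sigma.Lex.left _ _
            (Order.lt_succ_of_not_isMax hj.not_isMax)⟩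
        · exact (not_lt_bot hj).elim
      · obtain ⟨j, hj, rfl⟩ : ∃ j, ¬ IsMax j ∧ i = Order.succ j := by
          obtain ⟨j, hj⟩ := Order.not_isSuccPrelimit_iff.1 (fun h => hi' ⟨hi, h⟩)
          exact ⟨j, hj.lt.not_isMax, hj.succ_eq.symm⟩
        have hj := Order.lt_succ_of_not_isMax hj
        have hg : Monotone (fun a : J j =>
            (⟨toLex ⟨j, a⟩, Sigma.Lex.left _ _ hj⟩ :
              Set.Iio (toLex ⟨Order.succ j, ⊥⟩ : Σₗ i, J i))) :=
          fun a b hab => monotone_fiber j hab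
        refine ⟨isColimitOfCofinal hg ?_ _ (h j).isColimit
          (NatIso.ofComponents (fun a => Iso.refl _) (fun {a b} φ => ?_))
          (concatStart h (Order.succ j)) (fun a => ?_)⟩
        · rintro ⟨⟨k, b⟩, ⟨_, _, hk⟩ | ⟨_, _, hk⟩⟩
          · obtain rfl | hk := (Order.lt_succ_iff_of_not_isMax hj.not_isMax).1 hk |>.eq_or_lt
            · exact ⟨b, le_rfl⟩
            · exact ⟨⊥, Sigma.Lex.left _ _ hk⟩
          · exact (not_lt_bot hk).elim
        · refine (Category.comp_id _).trans (Eq.trans ?_ (Category.id_comp _).symm)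
          exact (concat_map_fiber h (leOfHom φ) (homOfLE (monotone_fiber _ (leOfHom φ)))).symm
        · refine Eq.trans ?_ (Category.id_comp _).symm
          refine Eq.trans ?_ (concat_map_lt h hj (a := a) (b := ⊥)
            (homOfLE (Sigma.Lex.left _ _ hj))).symm
          change _ = (h j).incl.app a ≫ G.map (𝟙 _) ≫ _
          rw [G.map_id]
          exact congr_arg ((h j).incl.app a ≫ ·) (Category.id_comp _).symm
    · have hb' : Order.IsSuccLimit b := by
        refine ⟨fun h' => hb (h'.eq_bot), fun a ha => hm.2 (toLex ⟨i, a⟩)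
          ⟨Sigma.Lex.right _ _ ha.1, ?_⟩⟩
        rintro ⟨k, c⟩ (⟨_, _, h₁⟩ | ⟨_, _, h₁⟩) (⟨_, _, h₂⟩ | ⟨_, _, h₂⟩)
        · exact h₁.not_gt h₂
        · exact h₁.ne rfl
        · exact h₂.ne rfl
        · exact ha.2 h₁ h₂
      have hg : Monotone (fun a : Set.Iio b =>
          (⟨toLex ⟨i, a.1⟩, Sigma.Lex.right _ _ a.2⟩ :
            Set.Iio (toLex ⟨i, b⟩ : Σₗ i, J i))) :=
        fun a b hab => monotone_fiber i hab
      refine ⟨isColimitOfCofinal hg ?_ _ ((h i).F.isColimitOfIsWellOrderContinuous b hb')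
        (NatIso.ofComponents (fun a => Iso.refl _) (fun {a b} φ => ?_))
        (Iso.refl _) (fun a => ?_)⟩
      · rintro ⟨⟨k, c⟩, ⟨_, _, hk⟩ | ⟨_, _, hk⟩⟩
        · exact ⟨⟨⊥, bot_lt_iff_ne_bot.2 hb⟩, Sigma.Lex.left _ _ hk⟩
        · exact ⟨⟨c, hk⟩, le_rfl⟩
      · refine (Category.comp_id _).trans (Eq.trans ?_ (Category.id_comp _).symm)
        exact (concat_map_fiber h (leOfHom φ) (homOfLE (monotone_fiber _ (leOfHom φ)))).symm
      · refine (Category.comp_id _).trans (Eq.trans ?_ (Category.id_comp _).symm)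
        exact (concat_map_fiber h (a := a.1) (b := b) a.2.le
          (homOfLE (monotone_fiber i a.2.le))).symm

end Concat

section

variable {C : Type u} [Category.{v} C]

lemma transfiniteCompositions_of_isIso (W : MorphismProperty C) {X Y : C} (f : X ⟶ Y) [IsIso f] :
    MorphismProperty.transfiniteCompositions.{v} W f :=
  let : SuccOrder PUnit.{v + 1} := SuccOrder.ofLinearWellFoundedLT _
  transfiniteCompositions_of_isColimit (J := PUnit) W ((Functor.const _).obj X)
    (fun _ hj => (hj (fun _ _ => le_rfl)).elim) ((Functor.const _).map f)
    (isColimitOfEventuallyIsIso _ PUnit.unit (fun _ _ => by dsimp; infer_instance))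
    (Iso.refl _) (by simp)

/-- Refine every successor map by its own tower, concatenate, and delete the isomorphism steps at
the seams. -/
lemma transfiniteCompositions_transfiniteCompositions_le (W : MorphismProperty C)
    [W.RespectsIso] :
    MorphismProperty.transfiniteCompositions.{v} (MorphismProperty.transfiniteCompositions.{v} W) ≤
      MorphismProperty.transfiniteCompositions.{v} W := by
  intro X Y f hf
  rw [MorphismProperty.transfiniteCompositions_iff] at hf
  obtain ⟨I, _, _, _, _, ⟨hf⟩⟩ := hf
  have h (i : I) : MorphismProperty.transfiniteCompositions.{v} W
      (hf.F.map (homOfLE (Order.le_succ i))) := by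
    -- The concatenation wants a tower at every index. At a last index the successor map is an
    -- isomorphism, and the one-point tower serves.
    by_cases hi : IsMax i
    · have := isIso_map_homOfLE hf.F (Order.le_succ i) (Order.succ_eq_iff_isMax.2 hi).symm
      exact transfiniteCompositions_of_isIso W _
    · exact hf.map_mem i hi
  simp only [MorphismProperty.transfiniteCompositions_iff] at h
  choose J _ _ _ _ h using h
  let h' (i : I) := (h i).some
  apply transfiniteCompositions_sup_isomorphisms_le
  let : SuccOrder (Σₗ i, J i) := SuccOrder.ofLinearWellFoundedLT _
  have := isWellOrderContinuous_concat (fun i => (h' i).toTransfiniteCompositionOfShape)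
  obtain ⟨ht⟩ := nonempty_isColimit_concatCocone
    (fun i => (h' i).toTransfiniteCompositionOfShape) hf.incl hf.isColimit
  refine transfiniteCompositions_of_isColimit _ _
    (isIso_or_concat_map (fun i => (h' i).toTransfiniteCompositionOfShape) W
      (fun i a ha => (h' i).map_mem a ha)) _ ht
    ((concatStart _ ⊥).symm ≪≫ hf.isoBot) ?_
  have := concatStart_concatCocone (fun i => (h' i).toTransfiniteCompositionOfShape) hf.incl ⊥
  refine (Category.assoc _ _ _).trans ((Iso.inv_comp_eq _).2 (Eq.trans ?_ this.symm))
  simp [← Iso.eq_inv_comp]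

end

/-! ### Retracts of transfinite compositions -/

section RetractUnder

variable {C : Type*} [Category* C]

/-- Data exhibiting `f : X ⟶ Y` as a retract of `i : X ⟶ Z` under `X`. -/
structure RetractUnder {X Y : C} (f : X ⟶ Y) {Z : C} (i : X ⟶ Z) where
  /-- the section -/
  sec : Y ⟶ Z
  /-- the retraction -/
  ret : Z ⟶ Y
  fac : f ≫ sec = i
  fac' : i ≫ ret = f
  sec_ret : sec ≫ ret = 𝟙 Y

attribute [simp] RetractUnder.fac RetractUnder.fac' RetractUnder.sec_ret

section

variable {C : Type*} [Category* C] {A B Z : C} {f : A ⟶ B} {i : A ⟶ Z} (h : RetractUnder f i)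
  {T : C}

@[simp]
lemma RetractUnder.fac_assoc (k : _ ⟶ T) : f ≫ h.sec ≫ k = i ≫ k := by
  rw [← Category.assoc, h.fac]

@[simp]
lemma RetractUnder.fac'_assoc (k : _ ⟶ T) : i ≫ h.ret ≫ k = f ≫ k := by
  rw [← Category.assoc, h.fac']

@[simp]
lemma RetractUnder.sec_ret_assoc (k : _ ⟶ T) : h.sec ≫ h.ret ≫ k = k := by
  rw [← Category.assoc, h.sec_ret, Category.id_comp]

end

lemma RetractUnder.retracts {P : MorphismProperty C} {X Y Z : C} {f : X ⟶ Y} {i : X ⟶ Z}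
    (h : RetractUnder f i) (hi : P i) : P.retracts f :=
  ⟨X, Z, i, { i := Arrow.homMk (𝟙 X) h.sec, r := Arrow.homMk (𝟙 X) h.ret }, hi⟩

/-- Push `g` out along the retraction `X' ⟶ X` of the sources: the result lies in `P`, starts at
`X`, and still retracts onto `f`. Retracts with fixed source can be assembled into coproducts,
pushouts and sequences. -/
lemma exists_retractUnder [HasPushouts C] {P : MorphismProperty C} [P.IsStableUnderCobaseChange]
    {X Y : C} {f : X ⟶ Y} (hf : P.retracts f) :
    ∃ (Z : C) (i : X ⟶ Z) (_ : RetractUnder f i), P i := by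
  obtain ⟨X', Y', g, h, hg⟩ := hf
  obtain ⟨a, b, c, d, h₁, h₂, h₃, h₄⟩ : ∃ (a : X ⟶ X') (b : Y ⟶ Y') (c : X' ⟶ X) (d : Y' ⟶ Y),
      a ≫ g = f ≫ b ∧ c ≫ f = g ≫ d ∧ a ≫ c = 𝟙 X ∧ b ≫ d = 𝟙 Y :=
    ⟨_, _, _, _, h.i_w, h.r_w, congr_arg CommaMorphism.left h.retract,
      congr_arg CommaMorphism.right h.retract⟩
  refine ⟨pushout g c, pushout.inr _ _, ⟨b ≫ pushout.inl _ _, pushout.desc d f h₂.symm, ?_,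
    pushout.inr_desc _ _ _, ?_⟩,
    MorphismProperty.of_isPushout (IsPushout.of_hasPushout g c).flip hg⟩
  · rw [← reassoc_of% h₁, pushout.condition, reassoc_of% h₃]
  · rw [Category.assoc, pushout.inl_desc, h₄]

instance isStableUnderCobaseChange_retracts [HasPushouts C] {P : MorphismProperty C}
    [P.IsStableUnderCobaseChange] : P.retracts.IsStableUnderCobaseChange where
  of_isPushout {A A' B B' f g f' g'} sq hf := by
    obtain ⟨Z, i, h, hi⟩ := exists_retractUnder hf
    refine RetractUnder.retracts
      (i := (pushout.inl g i)) ⟨sq.desc (pushout.inl g i) (h.sec ≫ pushout.inr g i) ?_,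
      pushout.desc f' (h.ret ≫ g') ?_, ?_, ?_, ?_⟩
      (MorphismProperty.of_isPushout (IsPushout.of_hasPushout g i) hi)
    · rw [RetractUnder.fac_assoc, pushout.condition]
    · rw [RetractUnder.fac'_assoc, sq.w]
    · exact sq.inl_desc _ _ _
    · exact pushout.inl_desc _ _ _
    · apply sq.hom_ext
      · rw [sq.inl_desc_assoc, pushout.inl_desc, Category.comp_id]
      · rw [sq.inr_desc_assoc, Category.assoc, pushout.inr_desc, RetractUnder.sec_ret_assoc,
          Category.comp_id]

end RetractUnder

section

variable {C : Type u} [Category.{v} C]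

lemma retracts_transfiniteCompositions_sigmaMap [HasCoproducts.{v} C] [HasPushouts C]
    (W : MorphismProperty C)
    [W.IsStableUnderCobaseChange] {S : Type v} {A B : S → C} (f : ∀ s, A s ⟶ B s)
    (hf : ∀ s, (MorphismProperty.transfiniteCompositions.{v} W).retracts (f s)) :
    (MorphismProperty.transfiniteCompositions.{v} W).retracts (Limits.Sigma.map f) := by
  choose Z i h hi using fun s => exists_retractUnder (hf s)
  refine RetractUnder.retracts (i := Limits.Sigma.map i)
    ⟨Limits.Sigma.map (fun s => (h s).sec), Limits.Sigma.map (fun s => (h s).ret), ?_, ?_, ?_⟩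
    (transfiniteCompositions_transfiniteCompositions_le _ _
      (transfiniteCompositions_sigmaMap _ i hi))
  all_goals exact Sigma.hom_ext _ _ (fun s => by simp)

/-- `ℕ` has no limit elements, and `ULift` only brings it to the universe of the indexing types. -/
lemma transfiniteCompositions_of_sequence (W : MorphismProperty C) (F : ℕ ⥤ C)
    (hF : ∀ n, W (F.map (homOfLE (Nat.le_add_right n 1)))) {c : Cocone F} (hc : IsColimit c) :
    MorphismProperty.transfiniteCompositions.{v} W (c.ι.app 0) := by
  have e : ℕ ≃o ULift.{v} ℕ := ⟨Equiv.ulift.symm, Iff.rfl⟩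
  let : OrderBot (ULift.{v} ℕ) := WellFoundedLT.toOrderBot _
  let : SuccOrder (ULift.{v} ℕ) := SuccOrder.ofLinearWellFoundedLT _
  refine MorphismProperty.transfiniteCompositionsOfShape_le_transfiniteCompositions W
    (ULift.{v} ℕ) _ ?_
  rw [← W.transfiniteCompositionsOfShape_eq_of_orderIso e]
  exact ⟨{ F := F, isoBot := Iso.refl _, incl := c.ι, isColimit := hc,
           map_mem := fun n _ => hF n }⟩

section Sequence

variable [HasPushouts C] {F : ℕ ⥤ C} {Y : ℕ → C} {j : ∀ n, F.obj n ⟶ Y n}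
  (h : ∀ n, RetractUnder (F.map (homOfLE (Nat.le_add_right n 1))) (j n))

/-- The sequence obtained by successively pushing out the maps `j n`, together with its
retractions onto `F`. -/
noncomputable def retractSequence : ∀ n, Σ Z : C, Retract (F.obj n) Z
  | 0 => ⟨F.obj 0, Retract.refl _⟩
  | n + 1 => ⟨pushout (j n) (retractSequence n).2.i,
      { i := (h n).sec ≫ pushout.inl _ _
        r := pushout.desc (h n).ret
          ((retractSequence n).2.r ≫ F.map (homOfLE (Nat.le_add_right n 1))) (by simp)
        retract := by
          rw [Category.assoc, pushout.inl_desc, RetractUnder.sec_ret] }⟩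

/-- The transition maps of `retractSequence`. -/
noncomputable def retractSequenceMap (n : ℕ) :
    (retractSequence h n).1 ⟶ (retractSequence h (n + 1)).1 :=
  pushout.inr (j n) (retractSequence h n).2.i

lemma map_retractSequence (n : ℕ) :
    F.map (homOfLE (Nat.le_add_right n 1)) ≫ (retractSequence h (n + 1)).2.i =
      (retractSequence h n).2.i ≫ retractSequenceMap h n := by
  change F.map (homOfLE (Nat.le_add_right n 1)) ≫ (h n).sec ≫ pushout.inl _ _ = _
  rw [RetractUnder.fac_assoc, pushout.condition]
  rfl

lemma retractSequence_map (n : ℕ) :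
    retractSequenceMap h n ≫ (retractSequence h (n + 1)).2.r =
      (retractSequence h n).2.r ≫ F.map (homOfLE (Nat.le_add_right n 1)) :=
  pushout.inr_desc _ _ _

end Sequence

/-- The transfinite compositions `j n` are not composable: `j n` ends at `Y n`, not at the source of
`j (n + 1)`. Pushing each out along the section built so far gives a genuine sequence `Z` of which
`F` is a retract, and `Z` can be concatenated. -/
lemma retracts_transfiniteCompositions_of_sequence [HasPushouts C] [HasColimitsOfShape ℕ C]
    (W : MorphismProperty C) [W.IsStableUnderCobaseChange] (F : ℕ ⥤ C)
    (hF : ∀ n, (MorphismProperty.transfiniteCompositions.{v} W).retracts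
      (F.map (homOfLE (Nat.le_add_right n 1)))) {c : Cocone F} (hc : IsColimit c) :
    (MorphismProperty.transfiniteCompositions.{v} W).retracts (c.ι.app 0) := by
  choose Y j h hj using fun n => exists_retractUnder (hF n)
  let Z : ℕ ⥤ C := Functor.ofSequence (retractSequenceMap h)
  let s : F ⟶ Z := NatTrans.ofSequence (fun n => (retractSequence h n).2.i) (fun n => by
    rw [Functor.ofSequence_map_homOfLE_succ]
    exact map_retractSequence h n)
  let r : Z ⟶ F := NatTrans.ofSequence (fun n => (retractSequence h n).2.r) (fun n => by
    rw [Functor.ofSequence_map_homOfLE_succ]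
    exact retractSequence_map h n)
  have hsr (n : ℕ) : s.app n ≫ r.app n = 𝟙 _ := (retractSequence h n).2.retract
  have hZ : MorphismProperty.transfiniteCompositions.{v} W (colimit.ι Z 0) := by
    refine transfiniteCompositions_transfiniteCompositions_le _ _
      (transfiniteCompositions_of_sequence _ Z (fun n => ?_) (colimit.isColimit Z))
    rw [Functor.ofSequence_map_homOfLE_succ]
    exact MorphismProperty.of_isPushout (IsPushout.of_hasPushout _ _).flip (hj n)
  refine RetractUnder.retracts (i := (colimit.ι Z 0 : F.obj 0 ⟶ colimit Z))
    ⟨hc.desc ((Cocone.precompose s).obj (colimit.cocone Z)),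
      colimit.desc Z ((Cocone.precompose r).obj c), ?_, ?_, ?_⟩ hZ
  · refine (hc.fac _ _).trans ?_
    exact Category.id_comp _
  · refine (colimit.ι_desc _ _).trans ?_
    exact Category.id_comp _
  · refine hc.hom_ext (fun n => ?_)
    rw [hc.fac_assoc]
    dsimp
    rw [Category.assoc, colimit.ι_desc]
    dsimp
    rw [reassoc_of% hsr n, Category.comp_id]

end

/-! ### Classes closed under base change, products and sequential limits -/

/-- A class of morphisms is closed under small towers of countable length built from products. -/
structure IsTowerClosed {C : Type u} [Category.{v} C] (Q : MorphismProperty C) : Prop where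
  isStableUnderBaseChange : Q.IsStableUnderBaseChange
  isStableUnderProducts (S : Type v) : Q.IsStableUnderProductsOfShape S
  sequential (F : ℕᵒᵖ ⥤ C) (hF : ∀ n, Q (F.map (homOfLE (Nat.le_add_right n 1)).op)) {c : Cone F}
    (hc : IsLimit c) : Q (c.π.app (op 0))

namespace IsTowerClosed

variable {C : Type u} [Category.{v} C] {Q : MorphismProperty C}

lemma piMap (hQ : IsTowerClosed Q) {S : Type v} {A B : S → C} [HasProduct A] [HasProduct B]
    (f : ∀ s, A s ⟶ B s) (hf : ∀ s, Q (f s)) : Q (Limits.Pi.map f) := by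
  have := hQ.isStableUnderProducts S
  exact Q.limMap (J := Discrete S) (X := Discrete.functor A) (Y := Discrete.functor B)
    (Discrete.natTrans (fun s => f s.as)) (fun s => hf s.as)

/-- Only the sequential limits need an argument: in the opposite category they are transfinite
compositions, under which left lifting classes are closed. -/
protected lemma rlp (T : MorphismProperty C) : IsTowerClosed T.rlp where
  isStableUnderBaseChange := inferInstance
  isStableUnderProducts _ := inferInstance
  sequential F hF c hc := by
    intro A B j hj
    have h := transfiniteCompositions_of_sequence T.op.llp F.rightOp
      (fun n X Y g hg => (HasLiftingProperty.iff_unop _ _).2 (hF n g.unop hg))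
      (isColimitCoconeRightOpOfCone F hc)
    exact HasLiftingProperty.iff_op.2
      (MorphismProperty.transfiniteCompositions_le _ _ h j.op hj)

lemma inverseImage {D : Type*} [Category.{v} D] (hQ : IsTowerClosed Q) (G : D ⥤ C)
    [PreservesLimitsOfSize.{v, v} G] [PreservesLimitsOfSize.{0, 0} G] :
    IsTowerClosed (Q.inverseImage G) where
  isStableUnderBaseChange := by
    have := hQ.isStableUnderBaseChange
    exact ⟨fun sq hf => Q.of_isPullback (sq.map G) hf⟩
  isStableUnderProducts S := by
    have := hQ.isStableUnderProducts S
    refine ⟨fun X₁ X₂ c₁ c₂ h₁ h₂ f hf φ hφ => ?_⟩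
    exact this.condition _ _ _ _ (isLimitOfPreserves G h₁) (isLimitOfPreserves G h₂)
      (Functor.whiskerRight f G) hf (G.map φ) (fun j => by
        simpa using congr_arg G.map (hφ j))
  sequential F hF c hc :=
    hQ.sequential (F ⋙ G) hF (isLimitOfPreserves G hc)

lemma iInf {ι : Type*} {Q : ι → MorphismProperty C} (hQ : ∀ i, IsTowerClosed (Q i)) :
    IsTowerClosed (fun _ _ f => ∀ i, Q i f : MorphismProperty C) where
  isStableUnderBaseChange := ⟨fun sq hf i => by
    have := (hQ i).isStableUnderBaseChange
    exact MorphismProperty.of_isPullback sq (hf i)⟩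
  isStableUnderProducts S := ⟨fun X₁ X₂ c₁ c₂ h₁ h₂ f hf φ hφ i =>
    ((hQ i).isStableUnderProducts S).condition _ _ _ _ h₁ h₂ f (fun j => hf j i) φ hφ⟩
  sequential F hF c hc i := (hQ i).sequential F (fun n => hF n i) hc

/-- A map that lifts against every map lifts against itself, and so is invertible. -/
lemma isomorphisms : IsTowerClosed (MorphismProperty.isomorphisms C) := by
  have : MorphismProperty.isomorphisms C = MorphismProperty.rlp ⊤ := by
    ext X Y f
    refine ⟨fun hf => ?_, fun hf => ?_⟩
    · rw [MorphismProperty.isomorphisms.iff] at hf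
      exact MorphismProperty.rlp_of_isIso _ _
    · have := hf f trivial
      have sq : CommSq (𝟙 X) f f (𝟙 Y) := ⟨by simp⟩
      exact ⟨sq.lift, sq.fac_left, sq.fac_right⟩
  rw [this]
  exact .rlp _

end IsTowerClosed

variable {C : Type u} [Category.{v} C]

lemma post_retracts_iff (X : MorphismProperty C) {A B : C} (f : A ⟶ B) :
    (post X).retracts f ↔
      (MorphismProperty.transfiniteCompositions.{v} X.pullbacks.op).retracts f.op := by
  constructor
  · rintro ⟨A', B', g, h, hg⟩
    exact ⟨_, _, g.op, h.op, hg⟩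
  · rintro ⟨A', B', g, h, hg⟩
    exact ⟨_, _, g.unop, h.unop, hg⟩

/-- In `Cᵒᵖ` these are the retracts of transfinite compositions of a class stable under cobase
change, so the closure properties are those already shown for pushouts, coproducts and sequences. -/
lemma isTowerClosed_retracts_post [HasLimits C] (X : MorphismProperty C) :
    IsTowerClosed (post X).retracts := by
  have h₀ : X.pullbacks.op.IsStableUnderCobaseChange := inferInstance
  let Q := (MorphismProperty.transfiniteCompositions.{v} X.pullbacks.op).retracts
  have h₁ : Q.IsStableUnderCobaseChange := isStableUnderCobaseChange_retracts
  have e : (post X).retracts = Q.unop := by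
    ext A B f
    exact post_retracts_iff X f
  rw [e]
  refine ⟨inferInstance, fun S => ?_, fun F hF c hc => ?_⟩
  · refine MorphismProperty.IsStableUnderProductsOfShape.mk _ _ (fun A B _ _ f hf => ?_)
    have := retracts_transfiniteCompositions_sigmaMap _ (fun s => (f s).op) hf
    refine (Q.arrow_mk_iso_iff ?_).1 this
    refine Arrow.isoMk (opProductIsoCoproduct B).symm (opProductIsoCoproduct A).symm
      (Sigma.hom_ext _ _ (fun s => ?_))
    have h {A : S → C} [HasProduct A] (s : S) :
        Sigma.ι (fun s => op (A s)) s ≫ (opProductIsoCoproduct A).inv = (Limits.Pi.π A s).op := by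
      rw [Iso.comp_inv_eq, π_comp_opProductIsoCoproduct_hom]
    change Sigma.ι (fun s => op (B s)) s ≫ (opProductIsoCoproduct B).inv ≫ (Limits.Pi.map f).op =
      Sigma.ι (fun s => op (B s)) s ≫
        Limits.Sigma.map (fun s => (f s).op) ≫ (opProductIsoCoproduct A).inv
    rw [reassoc_of% h, Sigma.ι_map_assoc, h]
    exact Quiver.Hom.unop_inj (Limits.Pi.map_π _ _)
  · exact retracts_transfiniteCompositions_of_sequence _ F.rightOp hF
      (isColimitCoconeRightOpOfCone F hc)

/-! ### The boundary of a representable and Reedy factorizations -/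

section ReedyCombinatorics

variable {R : Type v} [SmallCategory R] {Rm Rp : MorphismProperty R}
  [Rm.IsMultiplicative] [Rp.IsMultiplicative] (ρ : ReedyStructure Rm Rp ℕ)

include ρ in
lemma reedyFactorization_unique {X Y Z Z' : R} {a : X ⟶ Z} {b : Z ⟶ Y} {a' : X ⟶ Z'} {b' : Z' ⟶ Y}
    (ha : Rm a) (hb : Rp b) (ha' : Rm a') (hb' : Rp b') (h : a ≫ b = a' ≫ b') :
    ∃ e : Z = Z', a = a' ≫ eqToHom e.symm ∧ b = eqToHom e ≫ b' :=
  ρ.unique (f := a ≫ b) ⟨Z, a, b, rfl, ha, hb⟩ ⟨Z', a', b', h.symm, ha', hb'⟩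

variable {ρ}

/-- The Reedy factorization passes through the least possible degree, so it alone decides membership
in the boundary. -/
lemma mem_boundary_iff {d r : R} (x : d ⟶ r) :
    x ∈ (boundary ρ r).obj (op d) ↔ ρ.degHom x < ρ.deg r := by
  constructor
  · rintro ⟨s, a, b, hs, rfl⟩
    exact (ρ.degHom_le a b).trans_lt hs
  · intro h
    obtain ⟨s, a, b, _, _, rfl, hs⟩ := ρ.exists_fac x
    exact ⟨s, a, b, by rwa [← hs], rfl⟩

lemma comp_mem_boundary {d d' r : R} (a : d ⟶ d') {x : d' ⟶ r}
    (hx : x ∈ (boundary ρ r).obj (op d')) : a ≫ x ∈ (boundary ρ r).obj (op d) :=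
  (boundary ρ r).map a.op hx

lemma Rm_of_notMem_boundary {d r : R} {x : d ⟶ r} (hx : x ∉ (boundary ρ r).obj (op d)) : Rm x := by
  rw [mem_boundary_iff, not_lt] at hx
  exact ρ.prop₁_of_degHom_eq_deg_right (le_antisymm (ρ.degHom_le_deg_right x) hx)

lemma notMem_boundary_of_Rm {d r : R} {x : d ⟶ r} (hx : Rm x) :
    x ∉ (boundary ρ r).obj (op d) := by
  rw [mem_boundary_iff, ρ.degHom_eq ⟨r, x, 𝟙 r, by simp, hx, Rp.id_mem r⟩]
  exact lt_irrefl _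

lemma identities_of_notMem_boundary {d r : R} {x : d ⟶ r} (hx : x ∉ (boundary ρ r).obj (op d))
    (h : ρ.deg d ≤ ρ.deg r) : MorphismProperty.identities R x :=
  ρ.identities_of_prop₁_of_eq (Rm_of_notMem_boundary hx)
    (le_antisymm h (ρ.le₁ _ (Rm_of_notMem_boundary hx)))

lemma LatchingCategory.hom_mem_boundary {r : R} (g : LatchingCategory ρ r) :
    g.hom ∈ (boundary ρ r).obj (op g.src) :=
  ⟨g.src, 𝟙 _, g.hom, g.deg_lt, by simp⟩

/-- The `R⁺` part of the Reedy factorization of `x` is an object of the latching category. This is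
the link between `∂R(-, r)` and latching objects. -/
lemma exists_latching_fac {d r : R} {x : d ⟶ r} (hx : x ∈ (boundary ρ r).obj (op d)) :
    ∃ (g : LatchingCategory ρ r) (a : d ⟶ g.src), Rm a ∧ a ≫ g.hom = x := by
  rw [mem_boundary_iff] at hx
  obtain ⟨s, a, b, ha, hb, rfl, hs⟩ := ρ.exists_fac x
  exact ⟨⟨s, b, hb, hs.symm.trans_lt hx⟩, a, ha, rfl⟩

section Extend

variable {M : Type u} [Category.{v} M] {Ψ : R ⥤ M} {E : M} {r : R}
  (b : ∀ g : LatchingCategory ρ r, Ψ.obj g.src ⟶ E)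

/-- The extension of a cocone on the latching category to all morphisms of the boundary. -/
noncomputable def latchingExtend {d : R} (x : d ⟶ r) (hx : x ∈ (boundary ρ r).obj (op d)) :
    Ψ.obj d ⟶ E :=
  Ψ.map (exists_latching_fac hx).choose_spec.choose ≫ b (exists_latching_fac hx).choose

variable (hb : ∀ {g g' : LatchingCategory ρ r} (α : g ⟶ g'), Ψ.map α.val ≫ b g' = b g)

include hb

/-- Here `a` is arbitrary. Its `R⁺` part is absorbed by the compatibility of `b`; what remains is a
Reedy factorization of `x`, which is unique and hence the chosen one. -/
lemma latchingExtend_eq {d : R} (x : d ⟶ r) (hx : x ∈ (boundary ρ r).obj (op d))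
    (g : LatchingCategory ρ r) (a : d ⟶ g.src) (h : a ≫ g.hom = x) :
    latchingExtend b x hx = Ψ.map a ≫ b g := by
  obtain ⟨s, a₁, a₂, ha₁, ha₂, rfl, -⟩ := ρ.exists_fac a
  let g' : LatchingCategory ρ r := ⟨s, a₂ ≫ g.hom, Rp.comp_mem _ _ ha₂ g.mem,
    (ρ.le₂ _ ha₂).trans_lt g.deg_lt⟩
  have h₁ : Ψ.map a₂ ≫ b g = b g' := hb (g := g') (g' := g) ⟨a₂, ha₂, rfl⟩
  rw [Ψ.map_comp, Category.assoc, h₁]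
  dsimp only [latchingExtend]
  obtain ⟨h₂, h₃⟩ := (exists_latching_fac hx).choose_spec.choose_spec
  generalize (exists_latching_fac hx).choose_spec.choose = a' at *
  generalize (exists_latching_fac hx).choose = k at *
  obtain ⟨e, h₄, h₅⟩ := reedyFactorization_unique ρ h₂ k.mem ha₁ g'.mem
    (by rw [h₃, ← h, Category.assoc])
  obtain ⟨s', f, hf, hf'⟩ := k
  obtain rfl : s' = s := e
  obtain rfl : a' = a₁ := by simpa using h₄
  obtain rfl : f = a₂ ≫ g.hom := by simpa using h₅
  rfl

lemma latchingExtend_hom (g : LatchingCategory ρ r) :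
    latchingExtend b g.hom g.hom_mem_boundary = b g := by
  rw [latchingExtend_eq b hb _ _ g (𝟙 _) (by simp), Ψ.map_id, Category.id_comp]

lemma map_latchingExtend {d d' : R} (a : d ⟶ d') (x : d' ⟶ r)
    (hx : x ∈ (boundary ρ r).obj (op d')) :
    Ψ.map a ≫ latchingExtend b x hx = latchingExtend b (a ≫ x) (comp_mem_boundary a hx) := by
  obtain ⟨g, a', _, rfl⟩ := exists_latching_fac hx
  rw [latchingExtend_eq b hb _ hx g a' rfl, latchingExtend_eq b hb _ _ g (a ≫ a') (by simp),
    Ψ.map_comp, Category.assoc]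

end Extend

end ReedyCombinatorics

/-! ### Powers and pullback-cotensors in components -/

section Power

variable {R : Type v} [SmallCategory R] {M : Type u} [Category.{v} M] [HasLimits M]

/-- The power `E ⋔ S`. -/
noncomputable abbrev pow (S : Rᵒᵖ ⥤ Type v) (E : M) : R ⥤ M := ((power R M).obj (op S)).obj E

/-- The projection of `E ⋔ S` corresponding to an element of `S`. -/
noncomputable def powπ {S : Rᵒᵖ ⥤ Type v} (E : M) {d : R} (x : S.obj (op d)) :
    (pow S E).obj d ⟶ E :=
  Limits.Pi.π (fun _ : S.obj (op d) => E) x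

/-- The morphism to `E ⋔ S` evaluated at an object given by a family of morphisms to `E`. -/
noncomputable def powLift {S : Rᵒᵖ ⥤ Type v} {E : M} {d : R} {Z : M}
    (b : S.obj (op d) → (Z ⟶ E)) : Z ⟶ (pow S E).obj d :=
  Limits.Pi.lift b

variable {S : Rᵒᵖ ⥤ Type v} {E B : M}

@[simp]
lemma powLift_π {d : R} {Z : M} (b : S.obj (op d) → (Z ⟶ E)) (x : S.obj (op d)) :
    powLift b ≫ powπ E x = b x :=
  Limits.Pi.lift_π b x

lemma pow_hom_ext {d : R} {Z : M} {f g : Z ⟶ (pow S E).obj d}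
    (h : ∀ x : S.obj (op d), f ≫ powπ E x = g ≫ powπ E x) : f = g :=
  Limits.Pi.hom_ext _ _ h

@[simp]
lemma pow_map_π {d d' : R} (a : d ⟶ d') (x : S.obj (op d')) :
    (pow S E).map a ≫ powπ E x = powπ E (S.map a.op x) := by
  change Limits.Pi.map' _ _ ≫ Limits.Pi.π _ _ = _
  exact (Limits.Pi.map'_comp_π _ _ _).trans (Category.comp_id _)

@[simp]
lemma powerMap_app_π (p : E ⟶ B) {d : R} (x : S.obj (op d)) :
    (((power R M).obj (op S)).map p).app d ≫ powπ B x = powπ E x ≫ p := by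
  exact Limits.Pi.map_π (f := fun _ : S.obj (op d) => E) (g := fun _ => B) (fun _ => p) x

@[simp]
lemma power_map_app_π {S' : Rᵒᵖ ⥤ Type v} (α : S' ⟶ S) {d : R} (x : S'.obj (op d)) :
    (((power R M).map α.op).app E).app d ≫ powπ E x = powπ E (α.app (op d) x) := by
  change Limits.Pi.map' _ _ ≫ Limits.Pi.π _ _ = _
  exact (Limits.Pi.map'_comp_π _ _ _).trans (Category.comp_id _)

end Power

section Corner

variable {R : Type v} [SmallCategory R] {Rm Rp : MorphismProperty R}
  [Rm.IsMultiplicative] [Rp.IsMultiplicative] (ρ : ReedyStructure Rm Rp ℕ)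
  {M : Type u} [Category.{v} M] [HasLimits M] {E B : M} (p : E ⟶ B) (r : R)

/-- The target of the pullback-cotensor of `p`. -/
noncomputable abbrev cornerObj : R ⥤ M :=
  (Functor.PullbackObjObj.ofHasPullback (power R M) (boundaryInclusion ρ r) p).pt

lemma isPullback_cornerObj : IsPullback
    (Functor.PullbackObjObj.ofHasPullback (power R M) (boundaryInclusion ρ r) p).fst
    (Functor.PullbackObjObj.ofHasPullback (power R M) (boundaryInclusion ρ r) p).snd
    (((power R M).obj (op (boundary ρ r).toFunctor)).map p)
    (((power R M).map (boundaryInclusion ρ r).op).app B) :=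
  (Functor.PullbackObjObj.ofHasPullback (power R M) (boundaryInclusion ρ r) p).isPullback

variable {r}

/-- An element of the boundary. -/
def bdElt {d : R} (x : d ⟶ r) (hx : x ∈ (boundary ρ r).obj (op d)) :
    (boundary ρ r).toFunctor.obj (op d) := ⟨x, hx⟩

/-- An element of the presheaf represented by `r`. -/
def homElt {d : R} (x : d ⟶ r) : (yoneda.obj r).obj (op d) := x

/-- The projection of `E ⋔ R(-, r)` corresponding to a morphism to `r`. -/
noncomputable def homπ (E : M) {d : R} (x : d ⟶ r) : (pow (yoneda.obj r) E).obj d ⟶ E :=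
  powπ E (homElt x)

@[simp]
lemma pow_map_homπ {d d' : R} (a : d ⟶ d') (x : d' ⟶ r) :
    (pow (yoneda.obj r) E).map a ≫ homπ E x = homπ E (a ≫ x) :=
  pow_map_π _ _

@[simp]
lemma powerMap_app_homπ {d : R} (x : d ⟶ r) :
    (((power R M).obj (op (yoneda.obj r))).map p).app d ≫ homπ B x = homπ E x ≫ p :=
  powerMap_app_π _ _

lemma hom_hom_ext {d : R} {Z : M} {f g : Z ⟶ (pow (yoneda.obj r) E).obj d}
    (h : ∀ x : d ⟶ r, f ≫ homπ E x = g ≫ homπ E x) : f = g :=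
  pow_hom_ext h

/-- The morphism to `E ⋔ R(-, r)` evaluated at an object with given components. -/
noncomputable def homLift {E : M} {d : R} {Z : M} (b : (d ⟶ r) → (Z ⟶ E)) :
    Z ⟶ (pow (yoneda.obj r) E).obj d :=
  powLift (S := yoneda.obj r) b

@[simp]
lemma homLift_π {d : R} {Z : M} (b : (d ⟶ r) → (Z ⟶ E)) (x : d ⟶ r) :
    homLift b ≫ homπ E x = b x :=
  powLift_π (S := yoneda.obj r) _ _

@[simp]
lemma homLift_π_assoc {d : R} {Z : M} (b : (d ⟶ r) → (Z ⟶ E)) (x : d ⟶ r) {T : M} (k : _ ⟶ T) :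
    homLift b ≫ homπ E x ≫ k = b x ≫ k := by
  simp only [← Category.assoc, homLift_π]

/-- The projection of the target of the pullback-cotensor to `E` given by an element of the
boundary. -/
noncomputable def cornerFst {d : R} (x : d ⟶ r) (hx : x ∈ (boundary ρ r).obj (op d)) :
    (cornerObj ρ p r).obj d ⟶ E :=
  (Functor.PullbackObjObj.ofHasPullback (power R M) (boundaryInclusion ρ r) p).fst.app d ≫
    powπ E (bdElt ρ x hx)

/-- The projection of the target of the pullback-cotensor to `B` given by a morphism to `r`. -/
noncomputable def cornerSnd {d : R} (x : d ⟶ r) : (cornerObj ρ p r).obj d ⟶ B :=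
  (Functor.PullbackObjObj.ofHasPullback (power R M) (boundaryInclusion ρ r) p).snd.app d ≫
    homπ B x

lemma boundaryInclusion_app_π {d : R} (x : d ⟶ r) (hx : x ∈ (boundary ρ r).obj (op d)) :
    (((power R M).map (boundaryInclusion ρ r).op).app B).app d ≫ powπ B (bdElt ρ x hx) =
      homπ B x :=
  power_map_app_π _ _

@[simp]
lemma cornerFst_comp {d : R} (x : d ⟶ r) (hx : x ∈ (boundary ρ r).obj (op d)) :
    cornerFst ρ p x hx ≫ p = cornerSnd ρ p x := by
  have := congr_app (isPullback_cornerObj ρ p r).w d =≫ powπ B (bdElt ρ x hx)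
  rw [NatTrans.comp_app, NatTrans.comp_app, Category.assoc, Category.assoc, powerMap_app_π,
    boundaryInclusion_app_π] at this
  exact (Category.assoc _ _ _).trans this

@[simp]
lemma cornerObj_map_fst {d d' : R} (a : d ⟶ d') (x : d' ⟶ r)
    (hx : x ∈ (boundary ρ r).obj (op d')) :
    (cornerObj ρ p r).map a ≫ cornerFst ρ p x hx =
      cornerFst ρ p (a ≫ x) (comp_mem_boundary a hx) := by
  dsimp only [cornerFst]
  rw [NatTrans.naturality_assoc, pow_map_π]
  rfl

@[simp]
lemma cornerObj_map_snd {d d' : R} (a : d ⟶ d') (x : d' ⟶ r) :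
    (cornerObj ρ p r).map a ≫ cornerSnd ρ p x = cornerSnd ρ p (a ≫ x) := by
  dsimp only [cornerSnd]
  rw [NatTrans.naturality_assoc, pow_map_homπ]

lemma corner_hom_ext {d : R} {Z : M} {f g : Z ⟶ (cornerObj ρ p r).obj d}
    (h₁ : ∀ x hx, f ≫ cornerFst ρ p x hx = g ≫ cornerFst ρ p x hx)
    (h₂ : ∀ x : d ⟶ r, f ≫ cornerSnd ρ p x = g ≫ cornerSnd ρ p x) : f = g := by
  refine ((isPullback_cornerObj ρ p r).map ((evaluation R M).obj d)).hom_ext ?_ ?_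
  · refine pow_hom_ext (fun x => ?_)
    exact (Category.assoc _ _ _).trans ((h₁ x.1 x.2).trans (Category.assoc _ _ _).symm)
  · refine hom_hom_ext (fun x => ?_)
    exact (Category.assoc _ _ _).trans ((h₂ x).trans (Category.assoc _ _ _).symm)

lemma exists_corner_lift {d : R} {Z : M} (a : ∀ x : d ⟶ r, x ∈ (boundary ρ r).obj (op d) → (Z ⟶ E))
    (b : ∀ _ : d ⟶ r, Z ⟶ B) (h : ∀ x hx, a x hx ≫ p = b x) :
    ∃ l : Z ⟶ (cornerObj ρ p r).obj d, (∀ x hx, l ≫ cornerFst ρ p x hx = a x hx) ∧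
      ∀ x, l ≫ cornerSnd ρ p x = b x := by
  have sq := (isPullback_cornerObj ρ p r).map ((evaluation R M).obj d)
  let l : Z ⟶ (pow (boundary ρ r).toFunctor E).obj d := powLift (fun x => a x.1 x.2)
  have hl (x : d ⟶ r) (hx : x ∈ (boundary ρ r).obj (op d)) :
      l ≫ powπ E (bdElt ρ x hx) = a x hx := powLift_π _ _
  have h' : l ≫
      ((evaluation R M).obj d).map (((power R M).obj (op (boundary ρ r).toFunctor)).map p) =
      homLift b ≫
      ((evaluation R M).obj d).map (((power R M).map (boundaryInclusion ρ r).op).app B) := by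
    refine pow_hom_ext (fun x => ?_)
    change _ ≫ powπ B (bdElt ρ x.1 x.2) = _ ≫ powπ B (bdElt ρ x.1 x.2)
    dsimp only [evaluation_obj_map]
    rw [Category.assoc, Category.assoc, powerMap_app_π, boundaryInclusion_app_π, homLift_π,
      reassoc_of% hl]
    exact h x.1 x.2
  exact ⟨sq.lift _ _ h', fun x hx => (sq.lift_fst_assoc _ _ h' _).trans (hl x hx),
    fun x => (sq.lift_snd_assoc _ _ h' _).trans (homLift_π _ _)⟩

/-- The morphism to the target of the pullback-cotensor with given components. -/
noncomputable def cornerLift {d : R} {Z : M}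
    (a : ∀ x : d ⟶ r, x ∈ (boundary ρ r).obj (op d) → (Z ⟶ E))
    (b : ∀ _ : d ⟶ r, Z ⟶ B) (h : ∀ x hx, a x hx ≫ p = b x) : Z ⟶ (cornerObj ρ p r).obj d :=
  (exists_corner_lift ρ p a b h).choose

section

variable {d : R} {Z : M}
    (a : ∀ x : d ⟶ r, x ∈ (boundary ρ r).obj (op d) → (Z ⟶ E))
    (b : ∀ _ : d ⟶ r, Z ⟶ B) (h : ∀ x hx, a x hx ≫ p = b x)

@[simp]
lemma cornerLift_fst (x : d ⟶ r) (hx : x ∈ (boundary ρ r).obj (op d)) :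
    cornerLift ρ p a b h ≫ cornerFst ρ p x hx = a x hx :=
  (exists_corner_lift ρ p a b h).choose_spec.1 x hx

@[simp]
lemma cornerLift_snd (x : d ⟶ r) : cornerLift ρ p a b h ≫ cornerSnd ρ p x = b x :=
  (exists_corner_lift ρ p a b h).choose_spec.2 x

end

@[simp]
lemma pullbackCotensor_app_fst {d : R} (x : d ⟶ r) (hx : x ∈ (boundary ρ r).obj (op d)) :
    (pullbackCotensor ρ p r).app d ≫ cornerFst ρ p x hx = homπ E x := by
  have := congr_app (Functor.PullbackObjObj.ofHasPullback (power R M)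
    (boundaryInclusion ρ r) p).π_fst d =≫ powπ E (bdElt ρ x hx)
  rw [NatTrans.comp_app, boundaryInclusion_app_π, Category.assoc] at this
  exact this

@[simp]
lemma pullbackCotensor_app_snd {d : R} (x : d ⟶ r) :
    (pullbackCotensor ρ p r).app d ≫ cornerSnd ρ p x = homπ E x ≫ p := by
  have := congr_app (Functor.PullbackObjObj.ofHasPullback (power R M)
    (boundaryInclusion ρ r) p).π_snd d =≫ homπ B x
  rw [NatTrans.comp_app, powerMap_app_homπ, Category.assoc] at this
  exact this

end Corner

/-! ### Lifting problems for relative latching and matching maps -/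

section LatchingSquares

variable {R : Type v} [SmallCategory R] {Rm Rp : MorphismProperty R}
  [Rm.IsMultiplicative] [Rp.IsMultiplicative] (ρ : ReedyStructure Rm Rp ℕ)
  {M : Type u} [Category.{v} M]

/-- A lifting problem between the relative latching map of `f` and `p`, in terms of components. -/
structure LatchingSquare {Φ Ψ : R ⥤ M} (f : Φ ⟶ Ψ) {E B : M} (p : E ⟶ B) (r : R) where
  /-- the top map, restricted to `Φ r` -/
  top : Φ.obj r ⟶ E
  /-- the top map, restricted to the latching object -/
  latch (g : LatchingCategory ρ r) : Ψ.obj g.src ⟶ E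
  /-- the bottom map -/
  bot : Ψ.obj r ⟶ B
  latch_w {g g' : LatchingCategory ρ r} (α : g ⟶ g') : Ψ.map α.val ≫ latch g' = latch g
  top_w (g : LatchingCategory ρ r) : f.app g.src ≫ latch g = Φ.map g.hom ≫ top
  bot_w (g : LatchingCategory ρ r) : latch g ≫ p = Ψ.map g.hom ≫ bot
  w : top ≫ p = f.app r ≫ bot

attribute [simp] LatchingSquare.bot_w LatchingSquare.w LatchingSquare.top_w

/-- The existence of a solution of a lifting problem. -/
def LatchingSquare.HasLift {ρ : ReedyStructure Rm Rp ℕ} {Φ Ψ : R ⥤ M} {f : Φ ⟶ Ψ} {E B : M}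
    {p : E ⟶ B} {r : R} (s : LatchingSquare ρ f p r) : Prop :=
  ∃ l : Ψ.obj r ⟶ E, f.app r ≫ l = s.top ∧ l ≫ p = s.bot ∧ ∀ g, Ψ.map g.hom ≫ l = s.latch g

/-- A lifting problem between `j` and the relative matching map of `τ`, in terms of components. -/
structure MatchingSquare {A B : M} (j : A ⟶ B) {Φ Ψ : R ⥤ M} (τ : Φ ⟶ Ψ) (r : R) where
  /-- the top map -/
  top : A ⟶ Φ.obj r
  /-- the bottom map, projected to the matching object -/
  mat (g : MatchingCategory ρ r) : B ⟶ Φ.obj g.tgt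
  /-- the bottom map, projected to `Ψ r` -/
  bot : B ⟶ Ψ.obj r
  mat_w {g g' : MatchingCategory ρ r} (α : g ⟶ g') : mat g ≫ Φ.map α.val = mat g'
  top_w (g : MatchingCategory ρ r) : j ≫ mat g = top ≫ Φ.map g.hom
  bot_w (g : MatchingCategory ρ r) : mat g ≫ τ.app g.tgt = bot ≫ Ψ.map g.hom
  w : top ≫ τ.app r = j ≫ bot

attribute [simp] MatchingSquare.bot_w MatchingSquare.w MatchingSquare.top_w

/-- The existence of a solution of a lifting problem. -/
def MatchingSquare.HasLift {ρ : ReedyStructure Rm Rp ℕ} {A B : M} {j : A ⟶ B} {Φ Ψ : R ⥤ M}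
    {τ : Φ ⟶ Ψ} {r : R} (s : MatchingSquare ρ j τ r) : Prop :=
  ∃ l : B ⟶ Φ.obj r, j ≫ l = s.top ∧ l ≫ τ.app r = s.bot ∧ ∀ g, l ≫ Φ.map g.hom = s.mat g

variable {Φ Ψ : R ⥤ M} (f : Φ ⟶ Ψ) {E B : M} (p : E ⟶ B) (r : R)

variable {ρ f p r} in
lemma LatchingSquare.latchingExtend_comp (s : LatchingSquare ρ f p r) {d : R} (x : d ⟶ r)
    (hx : x ∈ (boundary ρ r).obj (op d)) :
    latchingExtend s.latch x hx ≫ p = Ψ.map x ≫ s.bot := by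
  obtain ⟨g, a, _, rfl⟩ := exists_latching_fac hx
  rw [latchingExtend_eq s.latch s.latch_w _ _ g a rfl]
  simp

section

variable [HasColimits M]

@[simp]
lemma ι_latchingMap (g : LatchingCategory ρ r) :
    colimit.ι (latchingForget ρ r ⋙ Φ) g ≫ latchingMap ρ r Φ = Φ.map g.hom :=
  colimit.ι_desc _ _

@[simp]
lemma ι_latchingMap_assoc (g : LatchingCategory ρ r) {T : M} (k : _ ⟶ T) :
    colimit.ι (latchingForget ρ r ⋙ Φ) g ≫ latchingMap ρ r Φ ≫ k =
      Φ.map g.hom ≫ k := by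
  simp only [← Category.assoc, ι_latchingMap]

@[simp]
lemma ι_latchingObjMap (g : LatchingCategory ρ r) :
    colimit.ι (latchingForget ρ r ⋙ Φ) g ≫ latchingObjMap ρ r f =
      f.app g.src ≫ colimit.ι (latchingForget ρ r ⋙ Ψ) g :=
  ι_colimMap _ _

@[simp]
lemma ι_latchingObjMap_assoc (g : LatchingCategory ρ r) {T : M} (k : _ ⟶ T) :
    colimit.ι (latchingForget ρ r ⋙ Φ) g ≫ latchingObjMap ρ r f ≫ k =
      f.app g.src ≫ colimit.ι (latchingForget ρ r ⋙ Ψ) g ≫ k := by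
  simp only [← Category.assoc, ι_latchingObjMap]

@[simp]
lemma inl_relativeLatchingMap :
    pushout.inl (latchingMap ρ r Φ) (latchingObjMap ρ r f) ≫ relativeLatchingMap ρ r f =
      f.app r :=
  pushout.inl_desc _ _ _

@[simp]
lemma inl_relativeLatchingMap_assoc {T : M} (k : _ ⟶ T) :
    pushout.inl (latchingMap ρ r Φ) (latchingObjMap ρ r f) ≫ relativeLatchingMap ρ r f ≫ k =
      f.app r ≫ k := by
  simp only [← Category.assoc, inl_relativeLatchingMap]

@[simp]
lemma inr_relativeLatchingMap :
    pushout.inr (latchingMap ρ r Φ) (latchingObjMap ρ r f) ≫ relativeLatchingMap ρ r f =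
      latchingMap ρ r Ψ :=
  pushout.inr_desc _ _ _

@[simp]
lemma inr_relativeLatchingMap_assoc {T : M} (k : _ ⟶ T) :
    pushout.inr (latchingMap ρ r Φ) (latchingObjMap ρ r f) ≫ relativeLatchingMap ρ r f ≫ k =
      latchingMap ρ r Ψ ≫ k := by
  simp only [← Category.assoc, inr_relativeLatchingMap]

/-- The universal properties of the pushout and of `L_r Ψ` split a square into components. In this
form it mentions no colimit, so it can be dualized and compared with squares of diagrams. -/
lemma hasLiftingProperty_relativeLatchingMap_iff :
    HasLiftingProperty (relativeLatchingMap ρ r f) p ↔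
      ∀ s : LatchingSquare ρ f p r, s.HasLift := by
  constructor
  · intro h s
    let c : Cocone (latchingForget ρ r ⋙ Ψ) :=
      { pt := E
        ι :=
          { app := s.latch
            naturality := fun g g' α => (s.latch_w α).trans (Category.comp_id _).symm } }
    have hc : latchingMap ρ r Φ ≫ s.top = latchingObjMap ρ r f ≫ colimit.desc _ c :=
      colimit.hom_ext (fun g => by
        rw [ι_latchingMap_assoc, ι_latchingObjMap_assoc, colimit.ι_desc]
        exact (s.top_w g).symm)
    have sq : CommSq (pushout.desc s.top (colimit.desc _ c) hc) (relativeLatchingMap ρ r f) p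
        s.bot := ⟨by
      apply pushout.hom_ext
      · rw [pushout.inl_desc_assoc, inl_relativeLatchingMap_assoc, s.w]
      · refine colimit.hom_ext (fun g => ?_)
        rw [pushout.inr_desc_assoc, inr_relativeLatchingMap_assoc, ι_latchingMap_assoc,
          colimit.ι_desc_assoc]
        exact s.bot_w g⟩
    refine ⟨sq.lift, ?_, sq.fac_right, fun g => ?_⟩
    · have := pushout.inl _ _ ≫= sq.fac_left
      rwa [pushout.inl_desc, inl_relativeLatchingMap_assoc] at this
    · have := colimit.ι (latchingForget ρ r ⋙ Ψ) g ≫= pushout.inr _ _ ≫= sq.fac_left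
      rwa [pushout.inr_desc, inr_relativeLatchingMap_assoc, ι_latchingMap_assoc,
        colimit.ι_desc] at this
  · intro h
    refine ⟨fun {t b} sq => ?_⟩
    let s : LatchingSquare ρ f p r :=
      { top := pushout.inl _ _ ≫ t
        latch := fun g => colimit.ι (latchingForget ρ r ⋙ Ψ) g ≫ pushout.inr _ _ ≫ t
        bot := b
        latch_w := fun {g g'} α => colimit.w_assoc (latchingForget ρ r ⋙ Ψ) α _
        top_w := fun g => by
          have := colimit.ι (latchingForget ρ r ⋙ Φ) g ≫=
            pushout.condition_assoc (f := latchingMap ρ r Φ) (g := latchingObjMap ρ r f) t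
          rw [ι_latchingMap_assoc, ι_latchingObjMap_assoc] at this
          exact this.symm
        bot_w := fun g => by
          rw [Category.assoc, Category.assoc, sq.w, inr_relativeLatchingMap_assoc,
            ι_latchingMap_assoc]
        w := by rw [Category.assoc, sq.w, inl_relativeLatchingMap_assoc] }
    obtain ⟨l, h₁, h₂, h₃⟩ := h s
    refine ⟨⟨⟨l, ?_, h₂⟩⟩⟩
    apply pushout.hom_ext
    · rwa [inl_relativeLatchingMap_assoc]
    · refine colimit.hom_ext (fun g => ?_)
      rw [inr_relativeLatchingMap_assoc, ι_latchingMap_assoc, h₃]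

end

section

variable [HasLimits M]

variable {ρ f p r} in
/-- The lifting problem against the pullback-cotensor attached to a lifting problem of the relative
latching map. -/
noncomputable def LatchingSquare.cornerTop (s : LatchingSquare ρ f p r) :
    Φ ⟶ pow (yoneda.obj r) E where
  app d := homLift (fun x => Φ.map x ≫ s.top)
  naturality d d' a := hom_hom_ext (fun x => by simp)

variable {ρ f p r} in
/-- The lifting problem against the pullback-cotensor attached to a lifting problem of the relative
latching map. -/
noncomputable def LatchingSquare.cornerBot (s : LatchingSquare ρ f p r) :
    Ψ ⟶ cornerObj ρ p r where
  app d := cornerLift ρ p (fun x hx => latchingExtend s.latch x hx) (fun x => Ψ.map x ≫ s.bot)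
    s.latchingExtend_comp
  naturality d d' a := corner_hom_ext ρ p
    (fun x hx => by simp [map_latchingExtend s.latch s.latch_w]) (fun x => by simp)

@[simp]
lemma LatchingSquare.cornerTop_app_π (s : LatchingSquare ρ f p r) {d : R} (x : d ⟶ r) :
    s.cornerTop.app d ≫ homπ E x = Φ.map x ≫ s.top := homLift_π _ _

@[simp]
lemma LatchingSquare.cornerTop_app_π_assoc (s : LatchingSquare ρ f p r) {d : R} (x : d ⟶ r)
    {T : M} (k : _ ⟶ T) :
    s.cornerTop.app d ≫ homπ E x ≫ k =
      Φ.map x ≫ s.top ≫ k := by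
  simp only [← Category.assoc, LatchingSquare.cornerTop_app_π]

@[simp]
lemma LatchingSquare.cornerBot_app_fst (s : LatchingSquare ρ f p r) {d : R} (x : d ⟶ r)
    (hx : x ∈ (boundary ρ r).obj (op d)) :
    s.cornerBot.app d ≫ cornerFst ρ p x hx = latchingExtend s.latch x hx :=
  cornerLift_fst _ _ _ _ s.latchingExtend_comp _ _

@[simp]
lemma LatchingSquare.cornerBot_app_snd (s : LatchingSquare ρ f p r) {d : R} (x : d ⟶ r) :
    s.cornerBot.app d ≫ cornerSnd ρ p x = Ψ.map x ≫ s.bot :=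
  cornerLift_snd _ _ _ _ s.latchingExtend_comp _

lemma LatchingSquare.commSq (s : LatchingSquare ρ f p r) :
    CommSq s.cornerTop f (pullbackCotensor ρ p r) s.cornerBot where
  w := by
    ext d
    refine corner_hom_ext ρ p (fun x hx => ?_) (fun x => ?_)
    · rw [NatTrans.comp_app, NatTrans.comp_app, Category.assoc, Category.assoc,
        pullbackCotensor_app_fst, cornerTop_app_π, cornerBot_app_fst]
      obtain ⟨g, a, _, rfl⟩ := exists_latching_fac hx
      rw [latchingExtend_eq s.latch s.latch_w _ _ g a rfl, ← NatTrans.naturality_assoc, s.top_w,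
        Φ.map_comp, Category.assoc]
    · rw [NatTrans.comp_app, NatTrans.comp_app, Category.assoc, Category.assoc,
        pullbackCotensor_app_snd, cornerTop_app_π_assoc, cornerBot_app_snd, s.w]
      simp

/-- By Yoneda a map from `Φ` to `E ⋔ R(-, r)` is a map `Φ r ⟶ E`. A map from `Ψ` to the corner
object is a map `Ψ r ⟶ B` with a compatible family to `E` over the boundary, equivalently over the
latching category. So the two lifting problems have the same data and the same solutions. -/
lemma hasLiftingProperty_pullbackCotensor_iff :
    HasLiftingProperty f (pullbackCotensor ρ p r) ↔
      ∀ s : LatchingSquare ρ f p r, s.HasLift := by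
  constructor
  · intro h s
    have sq := s.commSq
    refine ⟨sq.lift.app r ≫ homπ E (𝟙 r), ?_, ?_, fun g => ?_⟩
    · have := congr_app sq.fac_left r =≫ homπ E (𝟙 r)
      simpa using this
    · have := congr_app sq.fac_right r =≫ cornerSnd ρ p (𝟙 r)
      rw [NatTrans.comp_app, Category.assoc, pullbackCotensor_app_snd,
        LatchingSquare.cornerBot_app_snd] at this
      simpa using this
    · have := congr_app sq.fac_right g.src =≫ cornerFst ρ p g.hom g.hom_mem_boundary
      rw [NatTrans.comp_app, Category.assoc, pullbackCotensor_app_fst,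
        LatchingSquare.cornerBot_app_fst, latchingExtend_hom s.latch s.latch_w] at this
      rw [← this, NatTrans.naturality_assoc, pow_map_homπ, Category.comp_id]
  · intro h
    refine ⟨fun {t b} sq => ?_⟩
    have hw {d : R} (x : d ⟶ r) : t.app d ≫ homπ E x ≫ p = f.app d ≫ b.app d ≫ cornerSnd ρ p x := by
      have := congr_app sq.w d =≫ cornerSnd ρ p x
      rw [NatTrans.comp_app, NatTrans.comp_app, Category.assoc, Category.assoc,
        pullbackCotensor_app_snd] at this
      exact this
    have hw' {d : R} (x : d ⟶ r) (hx) :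
        t.app d ≫ homπ E x = f.app d ≫ b.app d ≫ cornerFst ρ p x hx := by
      have := congr_app sq.w d =≫ cornerFst ρ p x hx
      rw [NatTrans.comp_app, NatTrans.comp_app, Category.assoc, Category.assoc,
        pullbackCotensor_app_fst] at this
      exact this
    have ht {d : R} (x : d ⟶ r) : Φ.map x ≫ t.app r ≫ homπ E (𝟙 r) = t.app d ≫ homπ E x := by
      rw [NatTrans.naturality_assoc, pow_map_homπ, Category.comp_id]
    let s : LatchingSquare ρ f p r :=
      { top := t.app r ≫ homπ E (𝟙 r)
        latch := fun g => b.app g.src ≫ cornerFst ρ p g.hom g.hom_mem_boundary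
        bot := b.app r ≫ cornerSnd ρ p (𝟙 r)
        latch_w := fun {g g'} α => by
          rw [NatTrans.naturality_assoc, cornerObj_map_fst]
          simp only [α.w]
        top_w := fun g => by rw [ht, hw']
        bot_w := fun g => by
          rw [NatTrans.naturality_assoc, cornerObj_map_snd, Category.assoc, cornerFst_comp,
            Category.comp_id]
        w := by rw [Category.assoc, hw] }
    obtain ⟨l, h₁, h₂, h₃⟩ := h s
    let L : Ψ ⟶ pow (yoneda.obj r) E :=
      { app := fun d => homLift (fun x => Ψ.map x ≫ l)
        naturality := fun d d' a => hom_hom_ext (fun x => by simp) }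
    have hL {d : R} (x : d ⟶ r) : L.app d ≫ homπ E x = Ψ.map x ≫ l := homLift_π _ _
    refine ⟨⟨⟨L, ?_, ?_⟩⟩⟩
    · ext d
      refine hom_hom_ext (fun x => ?_)
      rw [NatTrans.comp_app, Category.assoc, hL, ← NatTrans.naturality_assoc, h₁, ht]
    · ext d
      refine corner_hom_ext ρ p (fun x hx => ?_) (fun x => ?_)
      · rw [NatTrans.comp_app, Category.assoc, pullbackCotensor_app_fst, hL]
        obtain ⟨g, a, _, rfl⟩ := exists_latching_fac hx
        rw [Ψ.map_comp, Category.assoc, h₃ g]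
        dsimp only [s]
        rw [NatTrans.naturality_assoc, cornerObj_map_fst]
      · rw [NatTrans.comp_app, Category.assoc, pullbackCotensor_app_snd, reassoc_of% hL, h₂]
        dsimp only [s]
        rw [NatTrans.naturality_assoc, cornerObj_map_snd, Category.comp_id]

lemma hasLiftingProperty_pullbackCotensor_iff_relativeLatchingMap [HasColimits M] :
    HasLiftingProperty f (pullbackCotensor ρ p r) ↔
      HasLiftingProperty (relativeLatchingMap ρ r f) p := by
  rw [hasLiftingProperty_pullbackCotensor_iff, hasLiftingProperty_relativeLatchingMap_iff]

@[simp]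
lemma matchingMap_π (g : MatchingCategory ρ r) :
    matchingMap ρ r Φ ≫ limit.π (matchingForget ρ r ⋙ Φ) g = Φ.map g.hom :=
  limit.lift_π _ _

@[simp]
lemma matchingObjMap_π (g : MatchingCategory ρ r) :
    matchingObjMap ρ r f ≫ limit.π (matchingForget ρ r ⋙ Ψ) g =
      limit.π (matchingForget ρ r ⋙ Φ) g ≫ f.app g.tgt :=
  limMap_π _ _

@[simp]
lemma matchingObjMap_π_assoc (g : MatchingCategory ρ r) {T : M} (k : _ ⟶ T) :
    matchingObjMap ρ r f ≫ limit.π (matchingForget ρ r ⋙ Ψ) g ≫ k =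
      limit.π (matchingForget ρ r ⋙ Φ) g ≫ f.app g.tgt ≫ k := by
  simp only [← Category.assoc, matchingObjMap_π]

@[simp]
lemma relativeMatchingMap_fst :
    relativeMatchingMap ρ r f ≫ pullback.fst (matchingObjMap ρ r f) (matchingMap ρ r Ψ) =
      matchingMap ρ r Φ :=
  pullback.lift_fst _ _ _

@[simp]
lemma relativeMatchingMap_fst_assoc {T : M} (k : _ ⟶ T) :
    relativeMatchingMap ρ r f ≫ pullback.fst (matchingObjMap ρ r f) (matchingMap ρ r Ψ) ≫ k =
      matchingMap ρ r Φ ≫ k := by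
  simp only [← Category.assoc, relativeMatchingMap_fst]

@[simp]
lemma relativeMatchingMap_snd :
    relativeMatchingMap ρ r f ≫ pullback.snd (matchingObjMap ρ r f) (matchingMap ρ r Ψ) =
      f.app r :=
  pullback.lift_snd _ _ _

@[simp]
lemma relativeMatchingMap_snd_assoc {T : M} (k : _ ⟶ T) :
    relativeMatchingMap ρ r f ≫ pullback.snd (matchingObjMap ρ r f) (matchingMap ρ r Ψ) ≫ k =
      f.app r ≫ k := by
  simp only [← Category.assoc, relativeMatchingMap_snd]

variable {A' B' : M} (j : A' ⟶ B')

lemma hasLiftingProperty_relativeMatchingMap_iff :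
    HasLiftingProperty j (relativeMatchingMap ρ r f) ↔
      ∀ s : MatchingSquare ρ j f r, s.HasLift := by
  constructor
  · intro h s
    let c : Cone (matchingForget ρ r ⋙ Φ) :=
      { pt := B'
        π :=
          { app := s.mat
            naturality := fun g g' α => (Category.id_comp _).trans (s.mat_w α).symm } }
    have hc : limit.lift _ c ≫ matchingObjMap ρ r f = s.bot ≫ matchingMap ρ r Ψ :=
      limit.hom_ext (fun g => by
        rw [Category.assoc, Category.assoc, matchingMap_π, matchingObjMap_π, limit.lift_π_assoc]
        exact s.bot_w g)
    have sq : CommSq s.top j (relativeMatchingMap ρ r f)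
        (pullback.lift (limit.lift _ c) s.bot hc) := ⟨by
      apply pullback.hom_ext
      · refine limit.hom_ext (fun g => ?_)
        simp only [Category.assoc]
        rw [relativeMatchingMap_fst_assoc, matchingMap_π, pullback.lift_fst_assoc, limit.lift_π]
        exact (s.top_w g).symm
      · simp only [Category.assoc]
        rw [relativeMatchingMap_snd, pullback.lift_snd, s.w]⟩
    refine ⟨sq.lift, sq.fac_left, ?_, fun g => ?_⟩
    · have := sq.fac_right =≫ pullback.snd _ _
      rwa [Category.assoc, relativeMatchingMap_snd, pullback.lift_snd] at this
    · have := (sq.fac_right =≫ pullback.fst _ _) =≫ limit.π (matchingForget ρ r ⋙ Φ) g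
      simp only [Category.assoc] at this
      rwa [relativeMatchingMap_fst_assoc, matchingMap_π, pullback.lift_fst_assoc,
        limit.lift_π] at this
  · intro h
    refine ⟨fun {t b} sq => ?_⟩
    let s : MatchingSquare ρ j f r :=
      { top := t
        mat := fun g => b ≫ pullback.fst _ _ ≫ limit.π (matchingForget ρ r ⋙ Φ) g
        bot := b ≫ pullback.snd _ _
        mat_w := fun {g g'} α => by
          rw [Category.assoc, Category.assoc]
          exact b ≫= pullback.fst _ _ ≫= limit.w (matchingForget ρ r ⋙ Φ) α
        top_w := fun g => by
          rw [← sq.w_assoc, relativeMatchingMap_fst_assoc, matchingMap_π]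
        bot_w := fun g => by
          have := b ≫= (pullback.condition (f := matchingObjMap ρ r f)
            (g := matchingMap ρ r Ψ) =≫ limit.π (matchingForget ρ r ⋙ Ψ) g)
          rw [Category.assoc, Category.assoc, matchingMap_π, matchingObjMap_π] at this
          rw [Category.assoc, Category.assoc, Category.assoc, this]
        w := by rw [← sq.w_assoc, relativeMatchingMap_snd] }
    obtain ⟨l, h₁, h₂, h₃⟩ := h s
    refine ⟨⟨⟨l, h₁, ?_⟩⟩⟩
    apply pullback.hom_ext
    · refine limit.hom_ext (fun g => ?_)
      rw [Category.assoc, Category.assoc, Category.assoc, relativeMatchingMap_fst_assoc,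
        matchingMap_π, h₃]
    · rwa [Category.assoc, relativeMatchingMap_snd]

end

section Op

variable {A' B' : M} (j : A' ⟶ B')

/-- Passing to opposites exchanges `R⁺` and `R⁻`, hence matching data for `ρ` and latching data for
`ρ.op`, as well as the top and bottom of a square. -/
lemma forall_matchingSquare_hasLift_iff :
    (∀ s : MatchingSquare ρ j f r, s.HasLift) ↔
      ∀ s : LatchingSquare ρ.op (NatTrans.op f) j.op (op r), s.HasLift := by
  let e (g : MatchingCategory ρ r) : LatchingCategory ρ.op (op r) :=
    ⟨op g.tgt, g.hom.op, g.mem, g.deg_lt⟩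
  let e' (g : LatchingCategory ρ.op (op r)) : MatchingCategory ρ r :=
    ⟨g.src.unop, g.hom.unop, g.mem, g.deg_lt⟩
  constructor
  · intro h s
    let s' : MatchingSquare ρ j f r :=
      { top := s.bot.unop
        mat := fun g => (s.latch (e g)).unop
        bot := s.top.unop
        mat_w := fun {g g'} α => Quiver.Hom.op_inj
          (s.latch_w (g := e g') (g' := e g) ⟨α.val.op, α.mem, Quiver.Hom.unop_inj α.w⟩)
        top_w := fun g => Quiver.Hom.op_inj (s.bot_w (e g))
        bot_w := fun g => Quiver.Hom.op_inj (s.top_w (e g))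
        w := Quiver.Hom.op_inj s.w.symm }
    obtain ⟨l, h₁, h₂, h₃⟩ := h s'
    exact ⟨l.op, Quiver.Hom.unop_inj h₂, Quiver.Hom.unop_inj h₁,
      fun g => Quiver.Hom.unop_inj (h₃ (e' g))⟩
  · intro h s
    let s' : LatchingSquare ρ.op (NatTrans.op f) j.op (op r) :=
      { top := s.bot.op
        latch := fun g => (s.mat (e' g)).op
        bot := s.top.op
        latch_w := fun {g g'} α => Quiver.Hom.unop_inj
          (s.mat_w (g := e' g') (g' := e' g) ⟨α.val.unop, α.mem, Quiver.Hom.op_inj α.w⟩)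
        top_w := fun g => Quiver.Hom.unop_inj (s.bot_w (e' g))
        bot_w := fun g => Quiver.Hom.unop_inj (s.top_w (e' g))
        w := Quiver.Hom.unop_inj s.w.symm }
    obtain ⟨l, h₁, h₂, h₃⟩ := h s'
    exact ⟨l.unop, Quiver.Hom.op_inj h₂, Quiver.Hom.op_inj h₁,
      fun g => Quiver.Hom.op_inj (h₃ (e g))⟩

lemma forall_latchingSquare_hasLift_iff :
    (∀ s : LatchingSquare ρ f p r, s.HasLift) ↔
      ∀ s : MatchingSquare ρ.op p.op (NatTrans.op f) (op r), s.HasLift := by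
  let e (g : LatchingCategory ρ r) : MatchingCategory ρ.op (op r) :=
    ⟨op g.src, g.hom.op, g.mem, g.deg_lt⟩
  let e' (g : MatchingCategory ρ.op (op r)) : LatchingCategory ρ r :=
    ⟨g.tgt.unop, g.hom.unop, g.mem, g.deg_lt⟩
  constructor
  · intro h s
    let s' : LatchingSquare ρ f p r :=
      { top := s.bot.unop
        latch := fun g => (s.mat (e g)).unop
        bot := s.top.unop
        latch_w := fun {g g'} α => Quiver.Hom.op_inj
          (s.mat_w (g := e g') (g' := e g) ⟨α.val.op, α.mem, Quiver.Hom.unop_inj α.w⟩)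
        top_w := fun g => Quiver.Hom.op_inj (s.bot_w (e g))
        bot_w := fun g => Quiver.Hom.op_inj (s.top_w (e g))
        w := Quiver.Hom.op_inj s.w.symm }
    obtain ⟨l, h₁, h₂, h₃⟩ := h s'
    exact ⟨l.op, Quiver.Hom.unop_inj h₂, Quiver.Hom.unop_inj h₁,
      fun g => Quiver.Hom.unop_inj (h₃ (e' g))⟩
  · intro h s
    let s' : MatchingSquare ρ.op p.op (NatTrans.op f) (op r) :=
      { top := s.bot.op
        mat := fun g => (s.latch (e' g)).op
        bot := s.top.op
        mat_w := fun {g g'} α => Quiver.Hom.unop_inj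
          (s.latch_w (g := e' g') (g' := e' g) ⟨α.val.unop, α.mem, Quiver.Hom.op_inj α.w⟩)
        top_w := fun g => Quiver.Hom.unop_inj (s.bot_w (e' g))
        bot_w := fun g => Quiver.Hom.unop_inj (s.top_w (e' g))
        w := Quiver.Hom.unop_inj s.w.symm }
    obtain ⟨l, h₁, h₂, h₃⟩ := h s'
    exact ⟨l.unop, Quiver.Hom.op_inj h₂, Quiver.Hom.op_inj h₁,
      fun g => Quiver.Hom.op_inj (h₃ (e g))⟩

/-- The morphism which detects the left lifting property of `j` with respect to relative matching
maps. -/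
noncomputable def tensorCorner [HasColimits M] :=
  NatTrans.unop (pullbackCotensor ρ.op j.op (op r))

lemma hasLiftingProperty_op_iff {Φ' Ψ' : Rᵒᵖ ⥤ Mᵒᵖ} (q : Φ' ⟶ Ψ') :
    HasLiftingProperty (NatTrans.op f) q ↔ HasLiftingProperty (NatTrans.unop q) f := by
  constructor
  · intro h
    refine ⟨fun {t b} sq => ?_⟩
    have sq' : CommSq (show Ψ.op ⟶ Φ' from NatTrans.op b) (NatTrans.op f) q
        (show Φ.op ⟶ Ψ' from NatTrans.op t) := ⟨by
      ext d
      exact Quiver.Hom.unop_inj (congr_app sq.w d.unop).symm⟩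
    refine ⟨⟨⟨show _ from NatTrans.unop sq'.lift, ?_, ?_⟩⟩⟩
    · ext d
      exact Quiver.Hom.op_inj (congr_app sq'.fac_right (op d))
    · ext d
      exact Quiver.Hom.op_inj (congr_app sq'.fac_left (op d))
  · intro h
    refine ⟨fun {t b} sq => ?_⟩
    have sq' : CommSq (show Ψ'.unop ⟶ Φ from NatTrans.unop b) (NatTrans.unop q) f
        (show Φ'.unop ⟶ Ψ from NatTrans.unop t) := ⟨by
      ext d
      exact Quiver.Hom.op_inj (congr_app sq.w (op d)).symm⟩
    refine ⟨⟨⟨NatTrans.op sq'.lift, ?_, ?_⟩⟩⟩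
    · ext d
      exact Quiver.Hom.unop_inj (congr_app sq'.fac_right d.unop)
    · ext d
      exact Quiver.Hom.unop_inj (congr_app sq'.fac_left d.unop)

/-- Dual of the adjunction for latching maps. It turns conditions on relative matching maps into
right lifting properties in the diagram category. -/
lemma hasLiftingProperty_tensorCorner_iff [HasColimits M] :
    HasLiftingProperty (tensorCorner ρ r j) f ↔
      ∀ s : MatchingSquare ρ j f r, s.HasLift := by
  rw [forall_matchingSquare_hasLift_iff, ← hasLiftingProperty_pullbackCotensor_iff,
    hasLiftingProperty_op_iff]
  rfl

end Op

end LatchingSquares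

/-! ### Components and relative matching maps of a pullback-cotensor -/

section Lifting

variable {R : Type v} [SmallCategory R] {Rm Rp : MorphismProperty R}
  [Rm.IsMultiplicative] [Rp.IsMultiplicative] (ρ : ReedyStructure Rm Rp ℕ)
  {M : Type u} [Category.{v} M]

section

variable [HasLimits M] {A A' E B : M} (j : A ⟶ A') (p : E ⟶ B) (r : R)

/-- The lift is built one morphism `x : d ⟶ r` at a time. On the boundary it is dictated by the
bottom map; each other `x` asks for one lift against `p`. -/
lemma hasLiftingProperty_pullbackCotensor_app (d : R)
    (h : ∀ x : d ⟶ r, x ∉ (boundary ρ r).obj (op d) → HasLiftingProperty j p) :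
    HasLiftingProperty j ((pullbackCotensor ρ p r).app d) where
  sq_hasLift {t b} sq := by
    have hf (x : d ⟶ r) (hx) : j ≫ b ≫ cornerFst ρ p x hx = t ≫ homπ E x := by
      rw [← sq.w_assoc, pullbackCotensor_app_fst]
    have hs (x : d ⟶ r) : j ≫ b ≫ cornerSnd ρ p x = t ≫ homπ E x ≫ p := by
      rw [← sq.w_assoc, pullbackCotensor_app_snd]
    have key (x : d ⟶ r) : ∃ l : A' ⟶ E, j ≫ l = t ≫ homπ E x ∧ l ≫ p = b ≫ cornerSnd ρ p x ∧
        ∀ hx, l = b ≫ cornerFst ρ p x hx := by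
      by_cases hx : x ∈ (boundary ρ r).obj (op d)
      · exact ⟨b ≫ cornerFst ρ p x hx, hf x hx, by simp, fun _ => rfl⟩
      · have := h x hx
        have sq' : CommSq (t ≫ homπ E x) j p (b ≫ cornerSnd ρ p x) := ⟨by simp [hs]⟩
        exact ⟨sq'.lift, sq'.fac_left, sq'.fac_right, fun hx' => absurd hx' hx⟩
    choose l h₁ h₂ h₃ using key
    refine ⟨⟨⟨homLift l, ?_, ?_⟩⟩⟩
    · exact hom_hom_ext (fun x => by rw [Category.assoc, homLift_π, h₁])
    · refine corner_hom_ext ρ p (fun x hx => ?_) (fun x => ?_)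
      · rw [Category.assoc, pullbackCotensor_app_fst, homLift_π, h₃ x hx]
      · rw [Category.assoc, pullbackCotensor_app_snd, homLift_π_assoc, h₂]

variable {r}

/-- The component of the lift at a boundary morphism `x : r' ⟶ r` is dictated by the bottom map. Any
other `x` lies in `R⁻`: if `deg r < deg r'` the matching data dictate the component, and if not, `x`
is an identity and a lift against `p` is needed. So `p` intervenes only for `r' = r`. -/
lemma matchingSquare_pullbackCotensor_hasLift {r' : R} (h : r' = r → HasLiftingProperty j p)
    (s : MatchingSquare ρ j (pullbackCotensor ρ p r) r') : s.HasLift := by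
  have hf (x : r' ⟶ r) (hx) : j ≫ s.bot ≫ cornerFst ρ p x hx = s.top ≫ homπ E x := by
    rw [← reassoc_of% s.w, pullbackCotensor_app_fst]
  have hs (x : r' ⟶ r) : j ≫ s.bot ≫ cornerSnd ρ p x = s.top ≫ homπ E x ≫ p := by
    rw [← reassoc_of% s.w, pullbackCotensor_app_snd]
  have key (x : r' ⟶ r) : ∃ l : A' ⟶ E, j ≫ l = s.top ≫ homπ E x ∧
      l ≫ p = s.bot ≫ cornerSnd ρ p x ∧ (∀ hx, l = s.bot ≫ cornerFst ρ p x hx) ∧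
      ∀ (hx : Rm x) (hd : ρ.deg r < ρ.deg r'), l = s.mat ⟨r, x, hx, hd⟩ ≫ homπ E (𝟙 r) := by
    by_cases hx : x ∈ (boundary ρ r).obj (op r')
    · exact ⟨s.bot ≫ cornerFst ρ p x hx, hf x hx, by simp, fun _ => rfl,
        fun hx' _ => absurd hx (notMem_boundary_of_Rm (ρ := ρ) hx')⟩
    · by_cases hd : ρ.deg r < ρ.deg r'
      · refine ⟨s.mat ⟨r, x, Rm_of_notMem_boundary hx, hd⟩ ≫ homπ E (𝟙 r), ?_, ?_,
          fun hx' => absurd hx' hx, fun _ _ => rfl⟩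
        · rw [reassoc_of% s.top_w]
          exact s.top ≫= (pow_map_homπ x (𝟙 r)).trans (by rw [Category.comp_id])
        · rw [Category.assoc, ← pullbackCotensor_app_snd ρ p (𝟙 r), reassoc_of% s.bot_w]
          exact s.bot ≫= (cornerObj_map_snd ρ p x (𝟙 r)).trans (by rw [Category.comp_id])
      · have hr : r' = r := by
          obtain ⟨⟩ := identities_of_notMem_boundary hx (not_lt.1 hd)
          rfl
        have := h hr
        have sq' : CommSq (s.top ≫ homπ E x) j p (s.bot ≫ cornerSnd ρ p x) := ⟨by simp [hs]⟩
        exact ⟨sq'.lift, sq'.fac_left, sq'.fac_right, fun hx' => absurd hx' hx,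
          fun _ hd' => absurd hd' hd⟩
  choose l h₁ h₂ h₃ h₄ using key
  refine ⟨homLift l, hom_hom_ext (fun x => by rw [Category.assoc, homLift_π, h₁]),
    corner_hom_ext ρ p (fun x hx => ?_) (fun x => ?_), fun g => hom_hom_ext (fun y => ?_)⟩
  · rw [Category.assoc, pullbackCotensor_app_fst, homLift_π, h₃ x hx]
  · rw [Category.assoc, pullbackCotensor_app_snd, homLift_π_assoc, h₂]
  · rw [Category.assoc, pow_map_homπ, homLift_π]
    by_cases hy : y ∈ (boundary ρ r).obj (op g.tgt)
    · rw [h₃ _ (comp_mem_boundary g.hom hy), ← pullbackCotensor_app_fst ρ p y hy, reassoc_of% s.bot_w,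
        cornerObj_map_fst]
    · have hy' := Rm_of_notMem_boundary hy
      have hd := (ρ.le₁ _ hy').trans_lt g.deg_lt
      rw [h₄ _ (Rm.comp_mem _ _ g.mem hy') hd,
        ← s.mat_w (g := g) (g' := ⟨r, g.hom ≫ y, Rm.comp_mem _ _ g.mem hy', hd⟩) ⟨y, hy', rfl⟩,
        Category.assoc]
      exact s.mat g ≫= (pow_map_homπ y (𝟙 r)).trans (by rw [Category.comp_id])

end

end Lifting

/-! ### Relative maps when lower degrees are already known -/

section RelativeMaps

variable {R : Type v} [SmallCategory R] {Rm Rp : MorphismProperty R}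
  [Rm.IsMultiplicative] [Rp.IsMultiplicative] (ρ : ReedyStructure Rm Rp ℕ)
  {M : Type u} [Category.{v} M] {Φ Z Ψ : R ⥤ M} (r : R)

variable {ρ r} in
lemma exists_eq_eqToHom_of_notMem_boundary {d : R} {x : d ⟶ r}
    (hx : x ∉ (boundary ρ r).obj (op d)) (h : ρ.deg d ≤ ρ.deg r) : ∃ e : d = r, x = eqToHom e := by
  obtain ⟨⟩ := identities_of_notMem_boundary hx h
  exact ⟨rfl, rfl⟩

variable {ρ r} in
lemma eq_id_of_notMem_boundary {x : r ⟶ r} (hx : x ∉ (boundary ρ r).obj (op r)) : x = 𝟙 r :=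
  (exists_eq_eqToHom_of_notMem_boundary hx le_rfl).choose_spec

section

variable [HasColimits M]

lemma latchingObjMap_comp (i : Φ ⟶ Z) (q : Z ⟶ Ψ) :
    latchingObjMap ρ r (i ≫ q) = latchingObjMap ρ r i ≫ latchingObjMap ρ r q :=
  colimit.hom_ext (fun g => by
    rw [ι_latchingObjMap, ι_latchingObjMap_assoc, ι_latchingObjMap, NatTrans.comp_app,
      Category.assoc])

lemma isIso_latchingObjMap (i : Φ ⟶ Z) (hi : ∀ s, ρ.deg s < ρ.deg r → IsIso (i.app s)) :
    IsIso (latchingObjMap ρ r i) := by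
  have (g : LatchingCategory ρ r) : IsIso ((Functor.whiskerLeft (latchingForget ρ r) i).app g) :=
    hi _ g.deg_lt
  have := NatIso.isIso_of_isIso_app (Functor.whiskerLeft (latchingForget ρ r) i)
  exact inferInstanceAs (IsIso (colimMap _))

lemma exists_iso_pushout_latching {i : Φ ⟶ Z} {q : Z ⟶ Ψ} {f : Φ ⟶ Ψ} (hf : i ≫ q = f)
    (hq : ∀ s, ρ.deg s < ρ.deg r → IsIso (q.app s)) :
    ∃ e : pushout (latchingMap ρ r Φ) (latchingObjMap ρ r i) ≅
        pushout (latchingMap ρ r Φ) (latchingObjMap ρ r f),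
      pushout.inl _ _ ≫ e.hom = pushout.inl _ _ ∧
      pushout.inr _ _ ≫ e.hom = latchingObjMap ρ r q ≫ pushout.inr _ _ := by
  subst hf
  have := isIso_latchingObjMap ρ r q hq
  let φ := pushout.map (latchingMap ρ r Φ) (latchingObjMap ρ r i) (latchingMap ρ r Φ)
    (latchingObjMap ρ r (i ≫ q)) (𝟙 _) (latchingObjMap ρ r q) (𝟙 _) (by simp)
    (by rw [latchingObjMap_comp, Category.id_comp])
  have : IsIso φ := pushout.map_isIso _ _ _ _ _ _ _ _ _
  exact ⟨asIso φ, (pushout.inl_desc _ _ _).trans (Category.id_comp _), pushout.inr_desc _ _ _⟩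

lemma isIso_inl_of_isIso_app (i : Φ ⟶ Z) (hi : ∀ s, ρ.deg s < ρ.deg r → IsIso (i.app s)) :
    IsIso (pushout.inl (latchingMap ρ r Φ) (latchingObjMap ρ r i)) := by
  have := isIso_latchingObjMap ρ r i hi
  infer_instance

/-- Induction on the degree: if `i` is invertible in lower degrees, then `i` at `r` is the relative
latching map up to isomorphism. -/
lemma isIso_of_isIso_relativeLatchingMap (i : Φ ⟶ Z)
    (hi : ∀ r, IsIso (relativeLatchingMap ρ r i)) : IsIso i := by
  have h (n : ℕ) : ∀ r, ρ.deg r = n → IsIso (i.app r) := by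
    induction n using Nat.strong_induction_on with
    | _ n hn =>
      rintro r rfl
      have := isIso_inl_of_isIso_app ρ r i (fun s hs => hn _ hs s rfl)
      have := hi r
      rw [← inl_relativeLatchingMap ρ i r]
      infer_instance
  have (r : R) : IsIso (i.app r) := h _ r rfl
  exact NatIso.isIso_of_isIso_app i

end

section

variable [HasLimits M]

lemma matchingObjMap_comp (i : Φ ⟶ Z) (q : Z ⟶ Ψ) :
    matchingObjMap ρ r (i ≫ q) = matchingObjMap ρ r i ≫ matchingObjMap ρ r q :=
  limit.hom_ext (fun g => by
    rw [Category.assoc, matchingObjMap_π, matchingObjMap_π, matchingObjMap_π_assoc,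
      NatTrans.comp_app])

lemma isIso_matchingObjMap (i : Φ ⟶ Z) (hi : ∀ s, ρ.deg s < ρ.deg r → IsIso (i.app s)) :
    IsIso (matchingObjMap ρ r i) := by
  have (g : MatchingCategory ρ r) : IsIso ((Functor.whiskerLeft (matchingForget ρ r) i).app g) :=
    hi _ g.deg_lt
  have := NatIso.isIso_of_isIso_app (Functor.whiskerLeft (matchingForget ρ r) i)
  exact inferInstanceAs (IsIso (limMap _))

/-- `Z r` is `M_r Z ×_{M_r Ψ} Ψ r` because `m_r(q)` is invertible, and `M_r Φ ≅ M_r Z` because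
matching objects see only lower degrees. -/
lemma nonempty_arrowIso_relativeMatchingMap {i : Φ ⟶ Z} {q : Z ⟶ Ψ} {f : Φ ⟶ Ψ} (hf : i ≫ q = f)
    (hi : ∀ s, ρ.deg s < ρ.deg r → IsIso (i.app s)) (hq : IsIso (relativeMatchingMap ρ r q)) :
    Nonempty (Arrow.mk (i.app r) ≅ Arrow.mk (relativeMatchingMap ρ r f)) := by
  subst hf
  have := isIso_matchingObjMap ρ r i hi
  let φ := pullback.map (matchingObjMap ρ r (i ≫ q)) (matchingMap ρ r Ψ)
    (matchingObjMap ρ r q) (matchingMap ρ r Ψ) (matchingObjMap ρ r i) (𝟙 _) (𝟙 _)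
    (by rw [matchingObjMap_comp, Category.comp_id]) (by simp)
  have : IsIso φ := pullback.map_isIso _ _ _ _ _ _ _ _ _
  have hφ : relativeMatchingMap ρ r (i ≫ q) ≫ φ = i.app r ≫ relativeMatchingMap ρ r q := by
    apply pullback.hom_ext
    · rw [Category.assoc, Category.assoc, relativeMatchingMap_fst]
      refine (_ ≫= pullback.lift_fst _ _ _).trans ?_
      rw [relativeMatchingMap_fst_assoc, matchingMap_naturality]
    · rw [Category.assoc, Category.assoc, relativeMatchingMap_snd]
      refine (_ ≫= pullback.lift_snd _ _ _).trans ?_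
      rw [relativeMatchingMap_snd_assoc, Category.comp_id, NatTrans.comp_app]
  exact ⟨Arrow.isoMk (Iso.refl _) (asIso (relativeMatchingMap ρ r q) ≪≫ (asIso φ).symm) (by
    dsimp
    rw [Category.id_comp, ← reassoc_of% hφ, IsIso.hom_inv_id, Category.comp_id])⟩

variable {r}

/-- The identity is the only endomorphism of `r` outside the boundary, so `p` enters exactly once.
-/
lemma isPullback_pullbackCotensor_app {E B : M} (p : E ⟶ B) :
    IsPullback (homπ E (𝟙 r)) ((pullbackCotensor ρ p r).app r) p (cornerSnd ρ p (𝟙 r)) := by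
  refine ⟨⟨(pullbackCotensor_app_snd ρ p (𝟙 r)).symm⟩, ⟨PullbackCone.IsLimit.mk _
    (fun s => homLift (fun x => by
      classical
      exact if hx : x ∈ (boundary ρ r).obj (op r) then s.snd ≫ cornerFst ρ p x hx else s.fst))
    (fun s => ?_) (fun s => ?_) (fun s m h₁ h₂ => ?_)⟩⟩
  · rw [homLift_π, dif_neg (notMem_boundary_of_Rm (Rm.id_mem r))]
  · refine corner_hom_ext ρ p (fun x hx => ?_) (fun x => ?_)
    · rw [Category.assoc, pullbackCotensor_app_fst, homLift_π, dif_pos hx]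
    · rw [Category.assoc, pullbackCotensor_app_snd, homLift_π_assoc]
      split_ifs with hx
      · rw [Category.assoc, cornerFst_comp]
      · obtain rfl := eq_id_of_notMem_boundary hx
        exact s.condition
  · refine hom_hom_ext (fun x => ?_)
    rw [homLift_π]
    split_ifs with hx
    · rw [← h₂, Category.assoc, pullbackCotensor_app_fst]
    · obtain rfl := eq_id_of_notMem_boundary hx
      exact h₁

variable (r) in
-- With every component dictated by the boundary, the map lifts against itself.
lemma isIso_pullbackCotensor_app {E B : M} (p : E ⟶ B) (d : R)
    (h : ∀ x : d ⟶ r, x ∈ (boundary ρ r).obj (op d)) : IsIso ((pullbackCotensor ρ p r).app d) := by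
  have := hasLiftingProperty_pullbackCotensor_app ρ ((pullbackCotensor ρ p r).app d) p r d
    (fun x hx => absurd (h x) hx)
  have sq : CommSq (𝟙 _) ((pullbackCotensor ρ p r).app d) ((pullbackCotensor ρ p r).app d) (𝟙 _) :=
    ⟨by simp⟩
  exact ⟨sq.lift, sq.fac_left, sq.fac_right⟩

end

end RelativeMaps

/-! ### Pulling back a product of maps -/

section Attach

variable {N : Type u} [Category.{v} N] [HasLimits N] {S : Type v} {Z : N} {A B : S → N}
  (P : ∀ s, A s ⟶ B s) (b : ∀ s, Z ⟶ B s)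

/-- The pullback of a product of morphisms. -/
noncomputable def attach : N := pullback (Limits.Pi.lift b) (Limits.Pi.map P)

/-- The projection of the pullback of a product of morphisms to the base. -/
noncomputable def attachProj : attach P b ⟶ Z := pullback.fst _ _

/-- The projections of the pullback of a product of morphisms. -/
noncomputable def attachπ (s : S) : attach P b ⟶ A s := pullback.snd _ _ ≫ Limits.Pi.π A s

lemma attachπ_comp (s : S) : attachπ P b s ≫ P s = attachProj P b ≫ b s := by
  have := pullback.condition (f := Limits.Pi.lift b) (g := Limits.Pi.map P) =≫ Limits.Pi.π B s
  rw [Category.assoc, Category.assoc, Limits.Pi.lift_π, Limits.Pi.map_π] at this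
  exact (Category.assoc _ _ _).trans this.symm

lemma exists_attach_lift {T : N} (z : T ⟶ Z) (a : ∀ s, T ⟶ A s) (h : ∀ s, a s ≫ P s = z ≫ b s) :
    ∃ l : T ⟶ attach P b, l ≫ attachProj P b = z ∧ ∀ s, l ≫ attachπ P b s = a s := by
  have h' : z ≫ Limits.Pi.lift b = Limits.Pi.lift a ≫ Limits.Pi.map P :=
    Limits.Pi.hom_ext _ _ (fun s => by
      rw [Category.assoc, Category.assoc, Limits.Pi.lift_π, Limits.Pi.map_π,
        Limits.Pi.lift_π_assoc, h])
  exact ⟨pullback.lift _ _ h', pullback.lift_fst _ _ _, fun s =>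
    (pullback.lift_snd_assoc _ _ _ _).trans (Limits.Pi.lift_π _ _)⟩

lemma IsTowerClosed.attachProj {Q : MorphismProperty N} (hQ : IsTowerClosed Q)
    (h : ∀ s, Q (P s)) : Q (attachProj P b) := by
  have := hQ.isStableUnderBaseChange
  exact Q.of_isPullback (IsPullback.of_hasPullback _ _).flip (hQ.piMap P h)

/-- Once `G` inverts the other factors, pulling back the product amounts to pulling back `P s₀`. It
is applied to evaluation at an object, to isolate one object among those of its degree. -/
lemma isPullback_map_attach {D : Type*} [Category.{v} D] [HasLimits D] (G : N ⥤ D)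
    [PreservesLimits G] (s₀ : S) (h : ∀ s, s ≠ s₀ → IsIso (G.map (P s))) :
    IsPullback (G.map (attachπ P b s₀)) (G.map (attachProj P b)) (G.map (P s₀))
      (G.map (b s₀)) := by
  have h₁ := (IsPullback.of_hasPullback (Limits.Pi.lift b) (Limits.Pi.map P)).flip.map G
  have h₂ : IsPullback (G.map (Limits.Pi.π A s₀)) (G.map (Limits.Pi.map P)) (G.map (P s₀))
      (G.map (Limits.Pi.π B s₀)) := by
    have hπ (A : S → N) (s : S) : Limits.Pi.π (fun s => G.obj (A s)) s =
        (PreservesProduct.iso G A).inv ≫ G.map (Limits.Pi.π A s) := by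
      rw [Iso.eq_inv_comp, PreservesProduct.iso_hom, piComparison_comp_π]
    refine IsPullback.of_iso (isPullback_piMap (fun s => G.map (P s)) s₀ h)
      (PreservesProduct.iso G A).symm (Iso.refl _) (PreservesProduct.iso G B).symm (Iso.refl _)
      ((Category.comp_id _).trans (hπ A s₀)) ?_ (by simp) ((Category.comp_id _).trans (hπ B s₀))
    rw [Iso.symm_hom, Iso.symm_hom, Iso.eq_inv_comp, ← Category.assoc, Iso.comp_inv_eq]
    refine Limits.Pi.hom_ext _ _ (fun s => ?_)
    rw [Category.assoc, Category.assoc, PreservesProduct.iso_hom, PreservesProduct.iso_hom,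
      Limits.Pi.map_π, piComparison_comp_π, piComparison_comp_π_assoc, ← G.map_comp, ← G.map_comp,
      Limits.Pi.map_π]
  have := h₁.paste_horiz h₂
  rwa [← G.map_comp, ← G.map_comp, Limits.Pi.lift_π] at this

end Attach

/-! ### One step of the Reedy tower -/

section Step

variable {R : Type v} [SmallCategory R] {Rm Rp : MorphismProperty R}
  [Rm.IsMultiplicative] [Rp.IsMultiplicative] (ρ : ReedyStructure Rm Rp ℕ)
  {M : Type u} [Category.{v} M] [HasLimits M] [HasColimits M]
  (W₁ W₂ : MorphismProperty M) [W₁.HasFactorization W₂] {Φ Z : R ⥤ M}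

/-- A chosen factorization of the relative latching map of `i`. -/
noncomputable abbrev latchingFactorization (i : Φ ⟶ Z) (r : R) :
    MorphismProperty.MapFactorizationData W₁ W₂ (relativeLatchingMap ρ r i) :=
  MorphismProperty.factorizationData W₁ W₂ (relativeLatchingMap ρ r i)

variable (i : Φ ⟶ Z)

/-- The lifting problem given by a chosen factorization of the relative latching map. -/
noncomputable def factorizationSquare (r : R) :
    LatchingSquare ρ i (latchingFactorization ρ W₁ W₂ i r).p r where
  top := pushout.inl _ _ ≫ (latchingFactorization ρ W₁ W₂ i r).i
  latch g := colimit.ι (latchingForget ρ r ⋙ Z) g ≫ pushout.inr _ _ ≫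
    (latchingFactorization ρ W₁ W₂ i r).i
  bot := 𝟙 _
  latch_w α := colimit.w_assoc (latchingForget ρ r ⋙ Z) α _
  top_w g := by
    have := colimit.ι (latchingForget ρ r ⋙ Φ) g ≫=
      pushout.condition_assoc (f := latchingMap ρ r Φ) (g := latchingObjMap ρ r i)
        (latchingFactorization ρ W₁ W₂ i r).i
    rw [ι_latchingMap_assoc, ι_latchingObjMap_assoc] at this
    exact this.symm
  bot_w g := by
    rw [Category.assoc, Category.assoc, MorphismProperty.MapFactorizationData.fac,
      inr_relativeLatchingMap, ι_latchingMap, Category.comp_id]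
  w := by
    rw [Category.assoc, MorphismProperty.MapFactorizationData.fac, inl_relativeLatchingMap,
      Category.comp_id]

variable (n : ℕ)

/-- The source of the pullback-cotensor of a chosen factorization. -/
noncomputable def stepTotal (i : Φ ⟶ Z) (r : R) : R ⥤ M :=
  pow (yoneda.obj r) (latchingFactorization ρ W₁ W₂ i r).Z

/-- The target of the pullback-cotensor of a chosen factorization. -/
noncomputable def stepBase (i : Φ ⟶ Z) (r : R) : R ⥤ M :=
  cornerObj ρ (latchingFactorization ρ W₁ W₂ i r).p r

/-- The pullback-cotensor of a chosen factorization. -/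
noncomputable def stepMap (i : Φ ⟶ Z) (r : R) : stepTotal ρ W₁ W₂ i r ⟶ stepBase ρ W₁ W₂ i r :=
  pullbackCotensor ρ (latchingFactorization ρ W₁ W₂ i r).p r

/-- The attaching map of a step of the Reedy tower. -/
noncomputable def stepBot (i : Φ ⟶ Z) (r : R) : Z ⟶ stepBase ρ W₁ W₂ i r :=
  (factorizationSquare ρ W₁ W₂ i r).cornerBot

/-- The map from the source to the pullback-cotensor of a chosen factorization. -/
noncomputable def stepTop (i : Φ ⟶ Z) (r : R) : Φ ⟶ stepTotal ρ W₁ W₂ i r :=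
  (factorizationSquare ρ W₁ W₂ i r).cornerTop

/-- A step of the Reedy tower. -/
noncomputable def stepObj : R ⥤ M :=
  attach (fun r : {r : R // ρ.deg r = n} => stepMap ρ W₁ W₂ i r.1)
    (fun r => stepBot ρ W₁ W₂ i r.1)

/-- The projection of a step of the Reedy tower. -/
noncomputable def stepProj : stepObj ρ W₁ W₂ i n ⟶ Z :=
  attachProj (fun r : {r : R // ρ.deg r = n} => stepMap ρ W₁ W₂ i r.1)
    (fun r => stepBot ρ W₁ W₂ i r.1)

variable {n} in
/-- The projection of a step of the Reedy tower. -/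
noncomputable def stepπ (r : R) (hr : ρ.deg r = n) :
    stepObj ρ W₁ W₂ i n ⟶ stepTotal ρ W₁ W₂ i r :=
  attachπ (fun r : {r : R // ρ.deg r = n} => stepMap ρ W₁ W₂ i r.1)
    (fun r => stepBot ρ W₁ W₂ i r.1) ⟨r, hr⟩

lemma exists_stepLift : ∃ l : Φ ⟶ stepObj ρ W₁ W₂ i n, l ≫ stepProj ρ W₁ W₂ i n = i ∧
    ∀ r : {r : R // ρ.deg r = n}, l ≫ stepπ ρ W₁ W₂ i r.1 r.2 = stepTop ρ W₁ W₂ i r.1 :=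
  exists_attach_lift _ _ i _ (fun r => (factorizationSquare ρ W₁ W₂ i r.1).commSq.w)

/-- The lift of `i` to a step of the Reedy tower. -/
noncomputable def stepLift : Φ ⟶ stepObj ρ W₁ W₂ i n := (exists_stepLift ρ W₁ W₂ i n).choose

lemma stepLift_proj : stepLift ρ W₁ W₂ i n ≫ stepProj ρ W₁ W₂ i n = i :=
  (exists_stepLift ρ W₁ W₂ i n).choose_spec.1

variable {n}

lemma IsTowerClosed.stepProj {Q : MorphismProperty (R ⥤ M)} (hQ : IsTowerClosed Q)
    (h : ∀ r, ρ.deg r = n → Q (pullbackCotensor ρ (latchingFactorization ρ W₁ W₂ i r).p r)) :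
    Q (stepProj ρ W₁ W₂ i n) :=
  hQ.attachProj _ _ (fun r => h r.1 r.2)

/-- Every morphism from `d` to an object of degree `n` lies in the boundary. -/
lemma isIso_stepProj_app {d : R} (hd : ρ.deg d < n) : IsIso ((stepProj ρ W₁ W₂ i n).app d) :=
  (IsTowerClosed.isomorphisms.inverseImage ((evaluation R M).obj d)).stepProj ρ W₁ W₂ i
    (fun r hr => isIso_pullbackCotensor_app ρ r _ d (fun x => by
      rw [mem_boundary_iff, hr]
      exact (ρ.degHom_le_deg_left x).trans_lt hd))

variable (r : R) (hr : ρ.deg r = n)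

lemma stepLift_π : stepLift ρ W₁ W₂ i n ≫ stepπ ρ W₁ W₂ i r hr = stepTop ρ W₁ W₂ i r :=
  (exists_stepLift ρ W₁ W₂ i n).choose_spec.2 ⟨r, hr⟩

lemma stepπ_comp : stepπ ρ W₁ W₂ i r hr ≫ stepMap ρ W₁ W₂ i r =
    stepProj ρ W₁ W₂ i n ≫ stepBot ρ W₁ W₂ i r :=
  attachπ_comp (fun r : {r : R // ρ.deg r = n} => stepMap ρ W₁ W₂ i r.1)
    (fun r => stepBot ρ W₁ W₂ i r.1) ⟨r, hr⟩

/-- The comparison of a step of the Reedy tower with the chosen factorization. -/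
noncomputable def stepComp :
    (stepObj ρ W₁ W₂ i n).obj r ⟶ (latchingFactorization ρ W₁ W₂ i r).Z :=
  (stepπ ρ W₁ W₂ i r hr).app r ≫ homπ _ (𝟙 r)

lemma stepLift_comp : (stepLift ρ W₁ W₂ i n).app r ≫ stepComp ρ W₁ W₂ i r hr =
    pushout.inl _ _ ≫ (latchingFactorization ρ W₁ W₂ i r).i := by
  have h₁ := congr_app (stepLift_π ρ W₁ W₂ i r hr) r
  have h₂ := LatchingSquare.cornerTop_app_π _ _ _ _ (factorizationSquare ρ W₁ W₂ i r) (𝟙 r)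
  rw [Φ.map_id, Category.id_comp] at h₂
  refine Eq.trans ?_ h₂
  dsimp only [stepComp]
  exact (Category.assoc _ _ _).symm.trans (congr_arg (fun k => k ≫ homπ _ (𝟙 r)) h₁)

lemma map_stepComp (g : LatchingCategory ρ r) :
    (stepObj ρ W₁ W₂ i n).map g.hom ≫ stepComp ρ W₁ W₂ i r hr =
      (stepProj ρ W₁ W₂ i n).app g.src ≫ colimit.ι (latchingForget ρ r ⋙ Z) g ≫
        pushout.inr _ _ ≫ (latchingFactorization ρ W₁ W₂ i r).i := by
  have h₁ : (stepπ ρ W₁ W₂ i r hr).app g.src ≫ (stepMap ρ W₁ W₂ i r).app g.src =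
    (stepProj ρ W₁ W₂ i n).app g.src ≫ (stepBot ρ W₁ W₂ i r).app g.src :=
      congr_app (stepπ_comp ρ W₁ W₂ i r hr) g.src
  have h₂ : (stepMap ρ W₁ W₂ i r).app g.src ≫
      cornerFst ρ (latchingFactorization ρ W₁ W₂ i r).p g.hom g.hom_mem_boundary =
        homπ _ g.hom := pullbackCotensor_app_fst _ _ _ _
  have h₃ : (stepBot ρ W₁ W₂ i r).app g.src ≫
      cornerFst ρ (latchingFactorization ρ W₁ W₂ i r).p g.hom g.hom_mem_boundary =
        (factorizationSquare ρ W₁ W₂ i r).latch g :=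
    (LatchingSquare.cornerBot_app_fst _ _ _ _ (factorizationSquare ρ W₁ W₂ i r) _ _).trans
      (latchingExtend_hom _ (factorizationSquare ρ W₁ W₂ i r).latch_w g)
  have h₄ : (stepTotal ρ W₁ W₂ i r).map g.hom ≫ homπ _ (𝟙 r) = homπ _ g.hom :=
    (pow_map_homπ _ _).trans (by rw [Category.comp_id])
  dsimp only [stepComp]
  refine (Category.assoc _ _ _).symm.trans
    (((stepπ ρ W₁ W₂ i r hr).naturality g.hom =≫ homπ _ (𝟙 r)).trans ?_)
  refine (Category.assoc _ _ _).trans ?_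
  refine (_ ≫= (h₄.trans h₂.symm)).trans ?_
  refine (Category.assoc _ _ _).symm.trans ((h₁ =≫ _).trans ((Category.assoc _ _ _).trans ?_))
  exact _ ≫= h₃

/-- Morphisms between distinct objects of equal degree lie in the boundary, so at `r` only the
factor of `r` matters. It is a base change of `p` along the bottom map of the chosen square, an
identity; hence the new value at `r` is the middle object of the factorization. -/
lemma isPullback_stepComp : IsPullback (stepComp ρ W₁ W₂ i r hr) ((stepProj ρ W₁ W₂ i n).app r)
    (latchingFactorization ρ W₁ W₂ i r).p (𝟙 _) := by
  have h₁ : IsPullback ((stepπ ρ W₁ W₂ i r hr).app r) ((stepProj ρ W₁ W₂ i n).app r)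
      ((stepMap ρ W₁ W₂ i r).app r) ((stepBot ρ W₁ W₂ i r).app r) :=
    isPullback_map_attach (fun r : {r : R // ρ.deg r = n} => stepMap ρ W₁ W₂ i r.1)
      (fun r => stepBot ρ W₁ W₂ i r.1) ((evaluation R M).obj r) ⟨r, hr⟩
      (fun s hs => isIso_pullbackCotensor_app ρ s.1 _ r (fun x => by
        by_contra hx
        obtain ⟨e, -⟩ := exists_eq_eqToHom_of_notMem_boundary hx (hr.trans s.2.symm).le
        exact hs (Subtype.ext e.symm)))
  have h₂ := h₁.paste_horiz (isPullback_pullbackCotensor_app ρ (latchingFactorization ρ W₁ W₂ i r).p)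
  have h₃ := LatchingSquare.cornerBot_app_snd _ _ _ _ (factorizationSquare ρ W₁ W₂ i r) (𝟙 r)
  rw [Z.map_id, Category.id_comp] at h₃
  exact h₂.of_iso (Iso.refl _) (Iso.refl _) (Iso.refl _) (Iso.refl _)
    ((Category.comp_id _).trans (Category.id_comp _).symm)
    ((Category.comp_id _).trans (Category.id_comp _).symm)
    ((Category.comp_id _).trans (Category.id_comp _).symm)
    ((Category.comp_id _).trans (h₃.trans (Category.id_comp _).symm))

lemma isIso_stepComp : IsIso (stepComp ρ W₁ W₂ i r hr) :=
  (isPullback_stepComp ρ W₁ W₂ i r hr).isIso_fst_of_isIso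

end Step

/-! ### The Reedy tower and its limit -/

lemma map_mem_of_forall_succ {C : Type*} [Category* C] (Q : MorphismProperty C) [Q.IsMultiplicative]
    (F : ℕᵒᵖ ⥤ C) {m n : ℕ} (h : m ≤ n)
    (hF : ∀ k, m ≤ k → k < n → Q (F.map (homOfLE (Nat.le_add_right k 1)).op)) :
    Q (F.map (homOfLE h).op) := by
  induction n, h using Nat.le_induction with
  | base => exact (congr_arg (fun k => Q k) (F.map_id _)).mpr (Q.id_mem _)
  | succ n h hn =>
    have : (homOfLE (h.trans (Nat.le_add_right n 1))).op =
      (homOfLE (Nat.le_add_right n 1)).op ≫ (homOfLE h).op := rfl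
    rw [this, F.map_comp]
    exact Q.comp_mem _ _ (hF n h (Nat.lt_succ_self n))
      (hn (fun k hk hk' => hF k hk (hk'.trans (Nat.lt_succ_self n))))

section Tower

variable {R : Type v} [SmallCategory R] {Rm Rp : MorphismProperty R}
  [Rm.IsMultiplicative] [Rp.IsMultiplicative] (ρ : ReedyStructure Rm Rp ℕ)
  {M : Type u} [Category.{v} M] [HasLimits M] [HasColimits M]
  (W₁ W₂ : MorphismProperty M) [W₁.HasFactorization W₂] {Φ Ψ : R ⥤ M}

/-- A step of the Reedy tower, as an object under the source. -/
noncomputable def nextStage (n : ℕ) (S : Under Φ) : Under Φ :=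
  Under.mk (stepLift ρ W₁ W₂ S.hom n)

/-- The projection of a step of the Reedy tower. -/
noncomputable def nextStageProj (n : ℕ) (S : Under Φ) : nextStage ρ W₁ W₂ n S ⟶ S :=
  Under.homMk (stepProj ρ W₁ W₂ S.hom n) (stepLift_proj ρ W₁ W₂ S.hom n)

/-- The stages of the Reedy tower. -/
noncomputable def stage (f : Φ ⟶ Ψ) : ℕ → Under Φ
  | 0 => Under.mk f
  | n + 1 => nextStage ρ W₁ W₂ n (stage f n)

variable (f : Φ ⟶ Ψ)

/-- The Reedy tower under the source. -/
noncomputable def underTower : ℕᵒᵖ ⥤ Under Φ :=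
  Functor.ofOpSequence (X := stage ρ W₁ W₂ f)
    (fun n => nextStageProj ρ W₁ W₂ n (stage ρ W₁ W₂ f n))

/-- The Reedy tower. -/
noncomputable abbrev tower : ℕᵒᵖ ⥤ R ⥤ M := underTower ρ W₁ W₂ f ⋙ Under.forget Φ

/-- The map from the source to a stage of the Reedy tower. -/
noncomputable def towerι (n : ℕ) : Φ ⟶ (tower ρ W₁ W₂ f).obj (op n) :=
  ((underTower ρ W₁ W₂ f).obj (op n)).hom

lemma towerι_zero : towerι ρ W₁ W₂ f 0 = f := rfl

lemma towerι_map {m n : ℕ} (h : m ≤ n) :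
    towerι ρ W₁ W₂ f n ≫ (tower ρ W₁ W₂ f).map (homOfLE h).op = towerι ρ W₁ W₂ f m :=
  Under.w _

lemma tower_map_succ (n : ℕ) : (tower ρ W₁ W₂ f).map (homOfLE (Nat.le_add_right n 1)).op =
    stepProj ρ W₁ W₂ (towerι ρ W₁ W₂ f n) n := by
  have := Functor.ofOpSequence_map_homOfLE_succ
    (X := stage ρ W₁ W₂ f)
    (fun n => nextStageProj ρ W₁ W₂ n (stage ρ W₁ W₂ f n)) n
  exact congr_arg (Under.forget Φ).map this

lemma isIso_tower_map_app {d : R} {m n : ℕ} (hd : ρ.deg d < m) (h : m ≤ n) :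
    IsIso (((tower ρ W₁ W₂ f).map (homOfLE h).op).app d) :=
  map_mem_of_forall_succ
    ((MorphismProperty.isomorphisms M).inverseImage ((evaluation R M).obj d)) _ h
    (fun k hk _ => by
      rw [tower_map_succ]
      exact isIso_stepProj_app ρ W₁ W₂ _ (hd.trans_le hk))

/-- The limit of the Reedy tower. -/
noncomputable def towerLimit : R ⥤ M := limit (tower ρ W₁ W₂ f)

/-- The projections of the limit of the Reedy tower. -/
noncomputable def towerπ (n : ℕ) : towerLimit ρ W₁ W₂ f ⟶ (tower ρ W₁ W₂ f).obj (op n) :=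
  limit.π _ _

/-- The map from the source to the limit of the Reedy tower. -/
noncomputable def towerLift : Φ ⟶ towerLimit ρ W₁ W₂ f :=
  limit.lift (tower ρ W₁ W₂ f)
    { pt := Φ
      π :=
        { app := fun n => towerι ρ W₁ W₂ f n.unop
          naturality := fun _ _ a =>
            (Category.id_comp _).trans (Under.w ((underTower ρ W₁ W₂ f).map a)).symm } }

lemma towerLift_π (n : ℕ) : towerLift ρ W₁ W₂ f ≫ towerπ ρ W₁ W₂ f n = towerι ρ W₁ W₂ f n :=
  limit.lift_π _ _

lemma towerπ_map {m n : ℕ} (h : m ≤ n) :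
    towerπ ρ W₁ W₂ f n ≫ (tower ρ W₁ W₂ f).map (homOfLE h).op = towerπ ρ W₁ W₂ f m :=
  limit.w _ _

lemma isIso_towerπ_app {d : R} {n : ℕ} (hd : ρ.deg d < n) :
    IsIso ((towerπ ρ W₁ W₂ f n).app d) := by
  have h : (tower ρ W₁ W₂ f ⋙ (evaluation R M).obj d).IsEventuallyConstantTo (op n) :=
    fun m a => isIso_tower_map_app ρ W₁ W₂ f hd (leOfHom a.unop)
  exact h.isIso_π_of_isLimit (isLimitOfPreserves ((evaluation R M).obj d)
    (limit.isLimit (tower ρ W₁ W₂ f)))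

/-- The relative latching maps of the map to the limit of the Reedy tower are the first parts of
the chosen factorizations. -/
lemma nonempty_arrowIso_relativeLatchingMap_towerLift (r : R) :
    Nonempty (Arrow.mk (latchingFactorization ρ W₁ W₂ (towerι ρ W₁ W₂ f (ρ.deg r)) r).i ≅
      Arrow.mk (relativeLatchingMap ρ r (towerLift ρ W₁ W₂ f))) := by
  -- Stage `deg r` agrees with the limit in degrees below `deg r`, so it gives the same source for
  -- the relative latching map. Stage `deg r + 1` agrees with the limit at `r` itself, where its
  -- value is the middle object of the factorization.
  obtain ⟨e, h₁, h₂⟩ := exists_iso_pushout_latching ρ r (towerLift_π ρ W₁ W₂ f (ρ.deg r))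
    (fun s hs => isIso_towerπ_app ρ W₁ W₂ f hs)
  let π : towerLimit ρ W₁ W₂ f ⟶ stepObj ρ W₁ W₂ (towerι ρ W₁ W₂ f (ρ.deg r)) (ρ.deg r) :=
    towerπ ρ W₁ W₂ f (ρ.deg r + 1)
  have hπ₁ : towerLift ρ W₁ W₂ f ≫ π = stepLift ρ W₁ W₂ (towerι ρ W₁ W₂ f (ρ.deg r)) (ρ.deg r) :=
    towerLift_π ρ W₁ W₂ f (ρ.deg r + 1)
  have hπ₂ : π ≫ stepProj ρ W₁ W₂ (towerι ρ W₁ W₂ f (ρ.deg r)) (ρ.deg r) =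
      towerπ ρ W₁ W₂ f (ρ.deg r) := by
    rw [← tower_map_succ]
    exact towerπ_map ρ W₁ W₂ f _
  have : IsIso (π.app r) := isIso_towerπ_app ρ W₁ W₂ f (Nat.lt_succ_self _)
  have := isIso_stepComp ρ W₁ W₂ (towerι ρ W₁ W₂ f (ρ.deg r)) r rfl
  have hw : e.hom ≫ (latchingFactorization ρ W₁ W₂ (towerι ρ W₁ W₂ f (ρ.deg r)) r).i =
      relativeLatchingMap ρ r (towerLift ρ W₁ W₂ f) ≫ π.app r ≫
        stepComp ρ W₁ W₂ (towerι ρ W₁ W₂ f (ρ.deg r)) r rfl := by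
    apply pushout.hom_ext
    · rw [reassoc_of% h₁, inl_relativeLatchingMap_assoc, ← stepLift_comp ρ W₁ W₂ _ r rfl,
        ← hπ₁, NatTrans.comp_app, Category.assoc]
    · refine colimit.hom_ext (fun g => ?_)
      rw [reassoc_of% h₂, inr_relativeLatchingMap_assoc, ι_latchingMap_assoc,
        ι_latchingObjMap_assoc, NatTrans.naturality_assoc, map_stepComp, ← hπ₂, NatTrans.comp_app,
        Category.assoc]
      rfl
  exact ⟨(Arrow.isoMk (f := Arrow.mk (relativeLatchingMap ρ r (towerLift ρ W₁ W₂ f)))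
    (g := Arrow.mk (latchingFactorization ρ W₁ W₂ (towerι ρ W₁ W₂ f (ρ.deg r)) r).i) e
    (asIso (π.app r ≫ stepComp ρ W₁ W₂ (towerι ρ W₁ W₂ f (ρ.deg r)) r rfl)) hw).symm⟩

/-- The projection of the limit of the Reedy tower belongs to a tower-closed class. -/
lemma IsTowerClosed.towerπ_zero {Q : MorphismProperty (R ⥤ M)} (hQ : IsTowerClosed Q)
    (h : ∀ r, Q (pullbackCotensor ρ
      (latchingFactorization ρ W₁ W₂ (towerι ρ W₁ W₂ f (ρ.deg r)) r).p r)) :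
    Q (towerπ ρ W₁ W₂ f 0) :=
  hQ.sequential _ (fun n => by
    rw [tower_map_succ]
    exact hQ.stepProj ρ W₁ W₂ _ (by rintro r rfl; exact h r)) (limit.isLimit _)

lemma IsTowerClosed.tower_map {Q : MorphismProperty (R ⥤ M)} [Q.IsMultiplicative]
    (hQ : IsTowerClosed Q) (n : ℕ) (h : ∀ r, ρ.deg r < n → Q (pullbackCotensor ρ
      (latchingFactorization ρ W₁ W₂ (towerι ρ W₁ W₂ f (ρ.deg r)) r).p r)) :
    Q ((tower ρ W₁ W₂ f).map (homOfLE (Nat.zero_le n)).op) :=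
  map_mem_of_forall_succ Q _ _ (fun k _ hk => by
    rw [tower_map_succ]
    exact hQ.stepProj ρ W₁ W₂ _ (by rintro r rfl; exact h r hk))

/-- Only layers at objects of degree below `deg r` occur, and their relative matching maps at `r`
lift against every map of `M`. By `tensorCorner` this is a right lifting property, so it passes to
the composite. -/
lemma isIso_relativeMatchingMap_tower_map (r : R) : IsIso (relativeMatchingMap ρ r
    ((tower ρ W₁ W₂ f).map (homOfLE (Nat.zero_le (ρ.deg r))).op)) := by
  let T : MorphismProperty (R ⥤ M) := MorphismProperty.ofHoms
    (fun (x : Arrow M) => tensorCorner ρ r x.hom)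
  have h := (IsTowerClosed.rlp T).tower_map ρ W₁ W₂ f (ρ.deg r) (fun s hs => by
    rintro _ _ _ ⟨x⟩
    rw [hasLiftingProperty_tensorCorner_iff]
    refine matchingSquare_pullbackCotensor_hasLift ρ x.hom _ (fun hr => ?_)
    subst hr
    exact absurd hs (lt_irrefl _))
  have h' {A B : M} (j : A ⟶ B) : HasLiftingProperty j (relativeMatchingMap ρ r
    ((tower ρ W₁ W₂ f).map (homOfLE (Nat.zero_le (ρ.deg r))).op)) := by
    rw [hasLiftingProperty_relativeMatchingMap_iff, ← hasLiftingProperty_tensorCorner_iff]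
    exact h _ (MorphismProperty.ofHoms.mk (Arrow.mk j))
  have := h' (relativeMatchingMap ρ r
    ((tower ρ W₁ W₂ f).map (homOfLE (Nat.zero_le (ρ.deg r))).op))
  have sq : CommSq (𝟙 _) (relativeMatchingMap ρ r
    ((tower ρ W₁ W₂ f).map (homOfLE (Nat.zero_le (ρ.deg r))).op)) (relativeMatchingMap ρ r
    ((tower ρ W₁ W₂ f).map (homOfLE (Nat.zero_le (ρ.deg r))).op)) (𝟙 _) := ⟨by simp⟩
  exact ⟨sq.lift, sq.fac_left, sq.fac_right⟩

end Tower

/-! ### Every morphism as the tower of its relative matching maps -/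

section MatchingTower

variable {R : Type v} [SmallCategory R] {Rm Rp : MorphismProperty R}
  [Rm.IsMultiplicative] [Rp.IsMultiplicative] (ρ : ReedyStructure Rm Rp ℕ)
  {M : Type u} [Category.{v} M] [HasLimits M] [HasColimits M] {Φ Ψ : R ⥤ M} (f : Φ ⟶ Ψ)

instance hasFactorization_isomorphisms_top {C : Type*} [Category* C] :
    (MorphismProperty.isomorphisms C).HasFactorization ⊤ where
  nonempty_mapFactorizationData {X _} f :=
    ⟨{ Z := X
       i := 𝟙 X
       p := f
       hi := MorphismProperty.isomorphisms.infer_property _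
       hp := trivial }⟩

/-- The first factors are isomorphisms, hence so are all relative latching maps: `Φ` is the limit of
its own tower. -/
lemma isIso_towerLift_isomorphisms :
    IsIso (towerLift ρ (MorphismProperty.isomorphisms M) ⊤ f) :=
  isIso_of_isIso_relativeLatchingMap ρ _ (fun r => by
    obtain ⟨e⟩ := nonempty_arrowIso_relativeLatchingMap_towerLift ρ
      (MorphismProperty.isomorphisms M) ⊤ f r
    exact ((MorphismProperty.isomorphisms M).arrow_mk_iso_iff e).1
      (MorphismProperty.MapFactorizationData.hi _))

lemma isIso_towerι_app_isomorphisms {d : R} {n : ℕ} (hd : ρ.deg d < n) :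
    IsIso ((towerι ρ (MorphismProperty.isomorphisms M) ⊤ f n).app d) := by
  have := isIso_towerLift_isomorphisms ρ f
  have := isIso_towerπ_app ρ (MorphismProperty.isomorphisms M) ⊤ f hd
  rw [← towerLift_π, NatTrans.comp_app]
  infer_instance

lemma nonempty_arrowIso_towerι (r : R) :
    Nonempty (Arrow.mk ((towerι ρ (MorphismProperty.isomorphisms M) ⊤ f (ρ.deg r)).app r) ≅
      Arrow.mk (relativeMatchingMap ρ r f)) :=
  nonempty_arrowIso_relativeMatchingMap ρ r
    (towerι_map ρ (MorphismProperty.isomorphisms M) ⊤ f (Nat.zero_le (ρ.deg r)))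
    (fun _ hs => isIso_towerι_app_isomorphisms ρ f hs)
    (isIso_relativeMatchingMap_tower_map ρ _ _ f r)

/-- Stage `deg r` already agrees with `Φ` in lower degrees. So the relative latching map of `Φ ⟶
Z_{deg r}` at `r`, and with it the second factor, is the component at `r`, which is `m_r(f)`. -/
lemma nonempty_arrowIso_latchingFactorization (r : R) :
    Nonempty (Arrow.mk (latchingFactorization ρ (MorphismProperty.isomorphisms M) ⊤
      (towerι ρ (MorphismProperty.isomorphisms M) ⊤ f (ρ.deg r)) r).p ≅
      Arrow.mk (relativeMatchingMap ρ r f)) := by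
  let i := towerι ρ (MorphismProperty.isomorphisms M) ⊤ f (ρ.deg r)
  let D := latchingFactorization ρ (MorphismProperty.isomorphisms M) ⊤ i r
  have : IsIso D.i := D.hi
  have := isIso_inl_of_isIso_app ρ r i (fun _ hs => isIso_towerι_app_isomorphisms ρ f hs)
  obtain ⟨e⟩ := nonempty_arrowIso_towerι ρ f r
  refine ⟨(Arrow.isoMk (f := Arrow.mk (i.app r)) (g := Arrow.mk D.p)
    (asIso (pushout.inl _ _ ≫ D.i)) (Iso.refl _) ?_).symm ≪≫ e⟩
  change (pushout.inl _ _ ≫ D.i) ≫ D.p = i.app r ≫ 𝟙 _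
  rw [Category.assoc, D.fac, inl_relativeLatchingMap, Category.comp_id]

variable {f}

/-- A tower-closed class contains a morphism as soon as it contains the pullback-cotensors of its
relative matching maps. -/
lemma IsTowerClosed.of_pullbackCotensor {Q : MorphismProperty (R ⥤ M)} (hQ : IsTowerClosed Q)
    (h : ∀ (r : R) {E B : M} (p : E ⟶ B),
      Nonempty (Arrow.mk p ≅ Arrow.mk (relativeMatchingMap ρ r f)) →
        Q (pullbackCotensor ρ p r)) : Q f := by
  have := hQ.isStableUnderBaseChange
  have := isIso_towerLift_isomorphisms ρ f
  have hf := towerLift_π ρ (MorphismProperty.isomorphisms M) ⊤ f 0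
  rw [towerι_zero] at hf
  rw [← hf]
  exact (Q.cancel_left_of_respectsIso _ _).2 (hQ.towerπ_zero ρ _ _ f (fun r => h r _
    (nonempty_arrowIso_latchingFactorization ρ f r)))

/-- Cut the tower of `f` at stage `deg r`: `q` involves only layers of lower degree, and what is
left at `r` is `m_r(f)`. This is the form suited to induction on the degree. -/
lemma IsTowerClosed.exists_fac {Q : MorphismProperty (R ⥤ M)} (hQ : IsTowerClosed Q)
    [Q.IsMultiplicative] (r : R)
    (h : ∀ (s : R) {E B : M} (p : E ⟶ B), ρ.deg s < ρ.deg r →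
      Nonempty (Arrow.mk p ≅ Arrow.mk (relativeMatchingMap ρ s f)) →
        Q (pullbackCotensor ρ p s)) :
    ∃ (Z : R ⥤ M) (i : Φ ⟶ Z) (q : Z ⟶ Ψ), i ≫ q = f ∧ Q q ∧
      Nonempty (Arrow.mk (i.app r) ≅ Arrow.mk (relativeMatchingMap ρ r f)) :=
  ⟨_, _, _, towerι_map ρ (MorphismProperty.isomorphisms M) ⊤ f (Nat.zero_le (ρ.deg r)),
    hQ.tower_map ρ _ _ f _ (fun s hs => h s _ hs (nonempty_arrowIso_latchingFactorization ρ f s)),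
    nonempty_arrowIso_towerι ρ f r⟩

/-- Right lifting properties of the relative matching maps are inherited by the components. -/
lemma rlp_app_of_relativeMatchingMap {T : MorphismProperty M}
    (h : ∀ r, T.rlp (relativeMatchingMap ρ r f)) (d : R) : T.rlp (f.app d) :=
  ((IsTowerClosed.rlp T).inverseImage ((evaluation R M).obj d)).of_pullbackCotensor ρ
    (fun r _ _ p ⟨e⟩ _ _ j hj => hasLiftingProperty_pullbackCotensor_app ρ j p r d
      (fun _ _ => (T.rlp.arrow_mk_iso_iff e).2 (h r) j hj))

/-- Left lifting properties of the relative latching maps are inherited by the components. -/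
lemma llp_app_of_relativeLatchingMap {T : MorphismProperty M}
    (h : ∀ r, T.llp (relativeLatchingMap ρ r f)) (d : R) : T.llp (f.app d) := by
  have := rlp_app_of_relativeMatchingMap ρ.op (f := NatTrans.op f) (T := T.op) (fun r A B j hj => by
    rw [hasLiftingProperty_relativeMatchingMap_iff]
    have := h r.unop _ hj
    rw [hasLiftingProperty_relativeLatchingMap_iff, forall_latchingSquare_hasLift_iff] at this
    exact this) (op d)
  intro A B p hp
  exact HasLiftingProperty.iff_op.2 (this p.op hp)

end MatchingTower

/-! ### Lifting and factorization for the Reedy classes -/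

section Lifting

variable {R : Type v} [SmallCategory R] {Rm Rp : MorphismProperty R}
  [Rm.IsMultiplicative] [Rp.IsMultiplicative] (ρ : ReedyStructure Rm Rp ℕ)
  {M : Type u} [Category.{v} M] [HasLimits M] [HasColimits M]

/-- The morphisms whose relative matching maps belong to a given class. -/
def matchingClass (W : MorphismProperty M) : MorphismProperty (R ⥤ M) :=
  fun _ _ f => ∀ r, W (relativeMatchingMap ρ r f)

/-- The morphisms whose relative latching maps belong to a given class. -/
def latchingClass (W : MorphismProperty M) : MorphismProperty (R ⥤ M) :=
  fun _ _ f => ∀ r, W (relativeLatchingMap ρ r f)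

variable {ρ}

/-- `q` is a tower of the maps `m_r(q) ⋔̂ κ^r`, and `i` lifts against each of these by adjunction.
-/
lemma hasLiftingProperty_of_latchingClass {W : MorphismProperty M} {Φ Ψ Φ' Ψ' : R ⥤ M}
    {i : Φ ⟶ Ψ} (hi : latchingClass ρ W i) {q : Φ' ⟶ Ψ'} (hq : matchingClass ρ W.rlp q) :
    HasLiftingProperty i q :=
  (IsTowerClosed.rlp (MorphismProperty.ofHoms (fun _ : PUnit.{1} => i))).of_pullbackCotensor ρ
    (fun r _ _ p ⟨e⟩ => by
      rintro _ _ _ ⟨⟩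
      rw [hasLiftingProperty_pullbackCotensor_iff_relativeLatchingMap]
      exact (W.rlp.arrow_mk_iso_iff e).2 (hq r) _ (hi r)) i ⟨⟨⟩⟩

variable (ρ) in
-- Makes closure under retracts and under towers automatic.
lemma matchingClass_rlp_eq (T : MorphismProperty M) :
    matchingClass ρ T.rlp = MorphismProperty.rlp (MorphismProperty.ofHoms
      (fun x : R × {j : Arrow M // T j.hom} => tensorCorner ρ x.1 x.2.1.hom)) := by
  ext Φ Ψ f
  constructor
  · rintro h _ _ _ ⟨r, j, hj⟩
    rw [hasLiftingProperty_tensorCorner_iff, ← hasLiftingProperty_relativeMatchingMap_iff]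
    exact h r _ hj
  · intro h r A B j hj
    rw [hasLiftingProperty_relativeMatchingMap_iff, ← hasLiftingProperty_tensorCorner_iff]
    exact h _ (MorphismProperty.ofHoms.mk (⟨r, Arrow.mk j, hj⟩ : R × {j : Arrow M // T j.hom}))

variable (ρ) in
lemma isTowerClosed_matchingClass_rlp (T : MorphismProperty M) :
    IsTowerClosed (matchingClass ρ T.rlp) := by
  rw [matchingClass_rlp_eq]
  exact .rlp _

omit [HasColimits M] in
lemma matchingClass_rlp_pullbackCotensor {T : MorphismProperty M} {E B : M} {p : E ⟶ B}
    (hp : T.rlp p) (r : R) : matchingClass ρ T.rlp (pullbackCotensor ρ p r) := by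
  intro s _ _ j hj
  rw [hasLiftingProperty_relativeMatchingMap_iff]
  exact matchingSquare_pullbackCotensor_hasLift ρ j p (fun _ => hp j hj)

lemma hasFactorization_latchingClass {T : MorphismProperty M} {W : MorphismProperty M}
    [W.RespectsIso] [W.HasFactorization T.rlp] :
    (latchingClass ρ W).HasFactorization (matchingClass ρ T.rlp) where
  nonempty_mapFactorizationData {Φ Ψ} f :=
    ⟨{ Z := towerLimit ρ W T.rlp f
       i := towerLift ρ W T.rlp f
       p := towerπ ρ W T.rlp f 0
       fac := towerLift_π ρ W T.rlp f 0
       hi := fun r => by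
        obtain ⟨e⟩ := nonempty_arrowIso_relativeLatchingMap_towerLift ρ W T.rlp f r
        exact (W.arrow_mk_iso_iff e).1 (MorphismProperty.MapFactorizationData.hi _)
       hp := (isTowerClosed_matchingClass_rlp ρ T).towerπ_zero ρ W T.rlp f (fun r =>
        matchingClass_rlp_pullbackCotensor (MorphismProperty.MapFactorizationData.hp _) r) }⟩

end Lifting

/-! ### Pullback-cotensors of Postnikov towers -/

section

variable {C D : Type*} [Category* C] [Category* D] {F G : C ⥤ D} (κ : F ⟶ G)

/-- The pullback-corner maps of a natural transformation are compatible with base change. -/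
lemma exists_isPullback_corner {E B E' B' : C} {a : E ⟶ E'} {p : E ⟶ B} {x : E' ⟶ B'} {b : B ⟶ B'}
    (sq : IsPullback a p x b) [PreservesLimitsOfShape WalkingCospan F]
    [PreservesLimitsOfShape WalkingCospan G] {K K' : D} {fst : K ⟶ G.obj E} {snd : K ⟶ F.obj B}
    (hK : IsPullback fst snd (G.map p) (κ.app B)) {fst' : K' ⟶ G.obj E'} {snd' : K' ⟶ F.obj B'}
    (hK' : IsPullback fst' snd' (G.map x) (κ.app B')) {π : F.obj E ⟶ K}
    (hπ₁ : π ≫ fst = κ.app E) (hπ₂ : π ≫ snd = F.map p) {π' : F.obj E' ⟶ K'}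
    (hπ₁' : π' ≫ fst' = κ.app E') (hπ₂' : π' ≫ snd' = F.map x) :
    ∃ m : K ⟶ K', IsPullback (F.map a) π π' m := by
  have h₁ := hK.paste_horiz (sq.map G)
  rw [← κ.naturality] at h₁
  have h₂ : (fst ≫ G.map a) ≫ G.map x = (snd ≫ F.map b) ≫ κ.app B' := by
    rw [h₁.w, Category.assoc]
  have h₃ : IsPullback (hK'.lift _ _ h₂) snd snd' (F.map b) :=
    IsPullback.of_right (by rwa [hK'.lift_fst]) (hK'.lift_snd _ _ h₂) hK'
  refine ⟨hK'.lift _ _ h₂, IsPullback.of_bot ?_ ?_ h₃⟩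
  · rw [hπ₂, hπ₂']
    exact sq.map F
  · apply hK'.hom_ext
    · rw [Category.assoc, Category.assoc, hπ₁', hK'.lift_fst, reassoc_of% hπ₁, κ.naturality]
    · rw [Category.assoc, Category.assoc, hπ₂', hK'.lift_snd, reassoc_of% hπ₂, ← F.map_comp,
        ← F.map_comp, sq.w]

end

section

variable {R : Type v} [SmallCategory R] {M : Type u} [Category.{v} M] [HasLimits M]

instance preservesLimitsOfShape_power (S : Rᵒᵖ ⥤ Type v) (J : Type*) [Category* J] :
    PreservesLimitsOfShape J ((power R M).obj (op S)) where
  preservesLimit {K} := ⟨fun {c} hc => ⟨evaluationJointlyReflectsLimits _ (fun d =>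
    { lift := fun s => powLift (fun x => hc.lift
        { pt := s.pt
          π :=
            { app := fun j => s.π.app j ≫ powπ (K.obj j) x
              naturality := fun i j φ => by
                have := s.w φ
                refine (Category.id_comp _).trans ((this.symm =≫ _).trans ?_)
                rw [Category.assoc, Category.assoc]
                exact _ ≫= powerMap_app_π _ _ } })
      fac := fun s j => pow_hom_ext (fun x => by
        rw [Category.assoc]
        refine (_ ≫= powerMap_app_π (c.π.app j) x).trans ?_
        refine (Category.assoc _ _ _).symm.trans ((powLift_π _ x =≫ _).trans ?_)
        exact hc.fac _ j)
      uniq := fun s m hm => pow_hom_ext (fun x => by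
        rw [powLift_π]
        refine hc.hom_ext (fun j => ?_)
        rw [hc.fac, Category.assoc]
        refine (_ ≫= (powerMap_app_π (c.π.app j) x).symm).trans ?_
        rw [← Category.assoc]
        exact hm j =≫ _) })⟩⟩

end

section

variable {R : Type v} [SmallCategory R] {Rm Rp : MorphismProperty R}
  [Rm.IsMultiplicative] [Rp.IsMultiplicative] (ρ : ReedyStructure Rm Rp ℕ)
  {M : Type u} [Category.{v} M] [HasLimits M] {E B : M} {p : E ⟶ B}

lemma retracts_pullbackCotensor {W : MorphismProperty M} {W' : MorphismProperty (R ⥤ M)} (r : R)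
    (hW : ∀ ⦃E B : M⦄ (p : E ⟶ B), W p → W' (pullbackCotensor ρ p r)) (hp : W.retracts p) :
    W'.retracts (pullbackCotensor ρ p r) := by
  obtain ⟨E', B', p', h, hp'⟩ := hp
  let sq {E B : M} (p : E ⟶ B) : (power R M).PullbackObjObj
      (Arrow.mk (boundaryInclusion ρ r)).hom (Arrow.mk p).hom :=
    Functor.PullbackObjObj.ofHasPullback (power R M) (boundaryInclusion ρ r) p
  refine ⟨_, _, _, (?_ : RetractArrow _ (pullbackCotensor ρ p' r)), hW p' hp'⟩
  exact
    { i := Functor.PullbackObjObj.mapArrowRight (sq p) (sq p') h.i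
      r := Functor.PullbackObjObj.mapArrowRight (sq p') (sq p) h.r
      retract := by
        rw [Functor.PullbackObjObj.mapArrowRight_comp, h.retract,
          Functor.PullbackObjObj.mapArrowRight_id] }

/-- The corner object is given by an arbitrary pullback square because
`transfiniteCompositions_corner` quantifies over arbitrary pushout squares in the opposite category.
-/
lemma isPullback_pullbackCotensor {X : MorphismProperty M} (r : R) (hp : X.pullbacks p)
    {K : R ⥤ M} {fst : K ⟶ pow (boundary ρ r).toFunctor E} {snd : K ⟶ pow (yoneda.obj r) B}
    (hK : IsPullback fst snd (((power R M).obj (op (boundary ρ r).toFunctor)).map p)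
      (((power R M).map (boundaryInclusion ρ r).op).app B))
    {π : pow (yoneda.obj r) E ⟶ K}
    (hπ₁ : π ≫ fst = ((power R M).map (boundaryInclusion ρ r).op).app E)
    (hπ₂ : π ≫ snd = ((power R M).obj (op (yoneda.obj r))).map p) :
    (reedyCotensor ρ X).pullbacks π := by
  obtain ⟨E', B', x, a, b, hx, sq⟩ := hp
  obtain ⟨m, hm⟩ := exists_isPullback_corner ((power R M).map (boundaryInclusion ρ r).op) sq hK
    (isPullback_cornerObj ρ x r) hπ₁ hπ₂
    (Functor.PullbackObjObj.ofHasPullback (power R M) (boundaryInclusion ρ r) x).π_fst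
    (Functor.PullbackObjObj.ofHasPullback (power R M) (boundaryInclusion ρ r) x).π_snd
  exact ⟨_, _, _, _, _, .mk x hx r, hm⟩

/-- Powers preserve limits, so in the opposite categories `- ⋔ ∂R(-, r)` and `- ⋔ R(-, r)` preserve
colimits, and the corner lemma applies to the transformation induced by `κ^r`. -/
lemma post_pullbackCotensor {X : MorphismProperty M} (r : R) (hp : post X p) :
    post (reedyCotensor ρ X) (pullbackCotensor ρ p r) := by
  have (S : Rᵒᵖ ⥤ Type v) : PreservesColimitsOfSize.{v, v} ((power R M).obj (op S)).op :=
    have : PreservesLimitsOfSize.{v, v} ((power R M).obj (op S)) := {}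
    preservesColimitsOfSize_op _
  refine transfiniteCompositions_corner
    (NatTrans.op ((power R M).map (boundaryInclusion ρ r).op)) (W := X.pullbacks.op) ?_ p.op hp
    (Functor.PullbackObjObj.ofHasPullback (power R M) (boundaryInclusion ρ r) p).snd.op
    (Functor.PullbackObjObj.ofHasPullback (power R M) (boundaryInclusion ρ r) p).fst.op
    (pullbackCotensor ρ p r).op (isPullback_cornerObj ρ p r).op ?_ ?_
  · intro Y Z w hw P i k c h hi hk
    exact isPullback_pullbackCotensor ρ r hw h.unop (congr_arg Quiver.Hom.unop hk)
      (congr_arg Quiver.Hom.unop hi)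
  · exact congr_arg Quiver.Hom.op
      (Functor.PullbackObjObj.ofHasPullback (power R M) (boundaryInclusion ρ r) p).π_snd
  · exact congr_arg Quiver.Hom.op
      (Functor.PullbackObjObj.ofHasPullback (power R M) (boundaryInclusion ρ r) p).π_fst

end

section

variable {C : Type u} [Category.{v} C]

lemma le_retracts_post (X : MorphismProperty C) : X ≤ (post X).retracts :=
  fun _ _ f hf => (post X).le_retracts f (MorphismProperty.le_transfiniteCompositions
    X.pullbacks.op f.op (X.le_pullbacks f hf))

lemma retracts_post_le_rlp {X T : MorphismProperty C} (h : X ≤ T.rlp) :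
    (post X).retracts ≤ T.rlp := by
  have h₁ : X.pullbacks.op ≤ T.op.llp := by
    intro A B f hf C D g hg
    have hf' : T.rlp f.unop :=
      T.rlp.pullbacks_le _ (MorphismProperty.pullbacks_monotone h _ hf)
    exact (HasLiftingProperty.iff_unop _ _).2 (hf' _ hg)
  have h₂ : post X ≤ T.rlp := by
    intro A B f hf C D g hg
    have hf' := MorphismProperty.transfiniteCompositions_le_iff.2 h₁ f.op hf
    exact HasLiftingProperty.iff_op.2 (hf' _ hg)
  exact (MorphismProperty.retracts_monotone h₂).trans T.rlp.retracts_le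

end

/-! ### Reedy weak factorization systems and their Postnikov generation -/

section

variable {R : Type v} [SmallCategory R] {Rm Rp : MorphismProperty R}
  [Rm.IsMultiplicative] [Rp.IsMultiplicative] (ρ : ReedyStructure Rm Rp ℕ)
  {M : Type u} [Category.{v} M] [HasLimits M] [HasColimits M]

lemma latchingClass_llp (T : MorphismProperty M) :
    latchingClass ρ T.llp = (reedyCotensor ρ T).llp := by
  ext Φ Ψ f
  constructor
  · rintro h _ _ _ ⟨p, hp, r⟩
    rw [hasLiftingProperty_pullbackCotensor_iff_relativeLatchingMap]
    exact h r p hp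
  · intro h r E B p hp
    rw [← hasLiftingProperty_pullbackCotensor_iff_relativeLatchingMap]
    exact h _ (.mk p hp r)

/-- Lifting and factorization come from the tower; stability under retracts comes from writing both
classes as lifting classes. -/
instance isWeakFactorizationSystem_reedy (L F : MorphismProperty M)
    [L.IsWeakFactorizationSystem F] :
    (latchingClass ρ L).IsWeakFactorizationSystem (matchingClass ρ F) := by
  have hF := L.rlp_eq_of_wfs F
  have hL := L.llp_eq_of_wfs F
  have : L.RespectsIso := by rw [← hL]; infer_instance
  subst hF
  have := hasFactorization_latchingClass (ρ := ρ) (T := L) (W := L)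
  have : (latchingClass ρ L).IsStableUnderRetracts := by
    rw [← hL, latchingClass_llp]
    infer_instance
  have : (matchingClass ρ L.rlp).IsStableUnderRetracts := by
    rw [matchingClass_rlp_eq]
    infer_instance
  exact MorphismProperty.IsWeakFactorizationSystem.mk' _ _
    (fun i p hi hp => hasLiftingProperty_of_latchingClass hi hp)

/-- If `F` is generated by `V` then so are the corresponding classes of diagrams. -/
lemma matchingClass_eq_retracts_post (L F : MorphismProperty M) [L.IsWeakFactorizationSystem F]
    (V : MorphismProperty M) (hV : F = (post V).retracts) :
    matchingClass ρ F = (post (reedyCotensor ρ V)).retracts := by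
  have hF := L.rlp_eq_of_wfs F
  refine le_antisymm (fun Φ Ψ f hf => ?_) ?_
  -- `f` is a tower of the maps `m_r(f) ⋔̂ κ^r`, and these are retracts of Postnikov towers because
  -- `m_r(f)` is one.
  · refine (isTowerClosed_retracts_post (reedyCotensor ρ V)).of_pullbackCotensor ρ
      (fun r E B p ⟨e⟩ => ?_)
    have : F.RespectsIso := by rw [← hF]; infer_instance
    have hf' := (F.arrow_mk_iso_iff e).2 (hf r)
    rw [hV] at hf'
    exact retracts_pullbackCotensor ρ r (fun _ _ _ hp => post_pullbackCotensor ρ r hp) hf'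
  -- Conversely the right-hand class of a weak factorization system absorbs towers and retracts, so
  -- it suffices to treat the generators.
  · rw [← (latchingClass ρ L).rlp_eq_of_wfs (matchingClass ρ F)]
    refine retracts_post_le_rlp ?_
    rw [(latchingClass ρ L).rlp_eq_of_wfs (matchingClass ρ F)]
    intro _ _ _ hf
    obtain ⟨p, hp, r⟩ := hf
    have hp' : F p := by
      rw [hV]
      exact le_retracts_post V p hp
    rw [← hF] at hp' ⊢
    exact matchingClass_rlp_pullbackCotensor hp' r

end

/-! ### Acyclic Reedy classes and the model structure -/

section

variable {R : Type v} [SmallCategory R] {Rm Rp : MorphismProperty R}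
  [Rm.IsMultiplicative] [Rp.IsMultiplicative] (ρ : ReedyStructure Rm Rp ℕ)
  (M : Type u) [Category.{v} M] [HasLimits M] [HasColimits M] [ModelCategory M]

/-- The objectwise weak equivalences. -/
def objectwiseWeakEquivalences (R : Type v) [SmallCategory R] (M : Type u) [Category.{v} M]
    [ModelCategory M] : MorphismProperty (R ⥤ M) :=
  fun _ _ f => ∀ r, weakEquivalences M (f.app r)

instance : (objectwiseWeakEquivalences R M).HasTwoOutOfThreeProperty where
  comp_mem _ _ hf hg r := (weakEquivalences M).comp_mem _ _ (hf r) (hg r)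
  of_postcomp _ _ hg hfg r := (weakEquivalences M).of_postcomp _ _ (hg r) (hfg r)
  of_precomp _ _ hf hfg r := (weakEquivalences M).of_precomp _ _ (hf r) (hfg r)

lemma matchingClass_trivialFibrations :
    matchingClass ρ (trivialFibrations M) =
      matchingClass ρ (fibrations M) ⊓ objectwiseWeakEquivalences R M := by
  have hTF := (cofibrations M).rlp_eq_of_wfs (trivialFibrations M)
  apply le_antisymm
  · intro Φ Ψ f hf
    refine ⟨fun r => (hf r).1, fun r => ?_⟩
    have : (cofibrations M).rlp (f.app r) :=
      rlp_app_of_relativeMatchingMap ρ (fun r => by rw [hTF]; exact hf r) r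
    rw [hTF] at this
    exact this.2
  · intro Φ Ψ f hf
    -- Induction on the degree. Write `f = i ≫ q` with `q` built from the layers of degree below
    -- `deg r`. By induction these come from trivial fibrations, so `q` is a trivial fibration at
    -- every object, and two-out-of-three at `r` gives the component of `i`, which is `m_r(f)`.
    have key (n : ℕ) : ∀ r, ρ.deg r = n → weakEquivalences M (relativeMatchingMap ρ r f) := by
      induction n using Nat.strong_induction_on with
      | _ n hn =>
        rintro r rfl
        have hQ := IsTowerClosed.iInf (fun d : R =>
          (IsTowerClosed.rlp (cofibrations M)).inverseImage ((evaluation R M).obj d))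
        have : MorphismProperty.IsMultiplicative (fun X Y g => ∀ d : R,
            (cofibrations M).rlp.inverseImage ((evaluation R M).obj d) g :
              MorphismProperty (R ⥤ M)) :=
          { id_mem := fun X d => MorphismProperty.id_mem _ _
            comp_mem := fun f g hf hg d => MorphismProperty.comp_mem _ _ _ (hf d) (hg d) }
        obtain ⟨Z, i, q, rfl, hq, ⟨e⟩⟩ := hQ.exists_fac ρ (f := f) r
          (fun s E B p hs ⟨e⟩ d A A' j hj =>
            hasLiftingProperty_pullbackCotensor_app ρ j p s d (fun _ _ => by
              have hp : trivialFibrations M p :=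
                ⟨((fibrations M).arrow_mk_iso_iff e).2 (hf.1 s),
                  ((weakEquivalences M).arrow_mk_iso_iff e).2 (hn _ hs s rfl)⟩
              rw [← hTF] at hp
              exact hp j hj))
        rw [← (weakEquivalences M).arrow_mk_iso_iff e]
        have h₁ : trivialFibrations M (q.app r) := by
          rw [← hTF]
          exact hq r
        exact (weakEquivalences M).of_postcomp _ _ h₁.2 (hf.2 r)
    exact fun r => ⟨hf.1 r, key _ r rfl⟩

/-- One inclusion is the lifting property of the components. The other is the retract argument: by
two-out-of-three the second factor of `f` is a trivial Reedy fibration, so `f` is a retract of the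
first. No dual induction is needed. -/
lemma latchingClass_trivialCofibrations :
    latchingClass ρ (trivialCofibrations M) =
      latchingClass ρ (cofibrations M) ⊓ objectwiseWeakEquivalences R M := by
  have hTC := (trivialCofibrations M).llp_eq_of_wfs (fibrations M)
  have h : latchingClass ρ (trivialCofibrations M) ≤ objectwiseWeakEquivalences R M := by
    intro Φ Ψ f hf r
    have : (fibrations M).llp (f.app r) :=
      llp_app_of_relativeLatchingMap ρ (fun r => by rw [hTC]; exact hf r) r
    rw [hTC] at this
    exact this.2
  refine le_antisymm (fun Φ Ψ f hf => ⟨fun r => (hf r).1, h _ hf⟩) (fun Φ Ψ f hf => ?_)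
  have D := MorphismProperty.factorizationData (latchingClass ρ (trivialCofibrations M))
    (matchingClass ρ (fibrations M)) f
  have hp : matchingClass ρ (trivialFibrations M) D.p := by
    rw [matchingClass_trivialFibrations]
    refine ⟨D.hp, (objectwiseWeakEquivalences R M).of_precomp _ _ (h _ D.hi) ?_⟩
    rw [D.fac]
    exact hf.2
  have : HasLiftingProperty f D.p := MorphismProperty.hasLiftingProperty_of_wfs
    (W₁ := latchingClass ρ (cofibrations M)) _ _ hf.1 hp
  have : (latchingClass ρ (trivialCofibrations M)).IsStableUnderRetracts := by
    rw [← (latchingClass ρ (trivialCofibrations M)).llp_eq_of_wfs (matchingClass ρ (fibrations M))]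
    infer_instance
  exact MorphismProperty.of_retract (RetractArrow.ofLeftLiftingProperty D.fac) D.hi

/-- The Reedy model structure. -/
@[reducible]
noncomputable def reedyModelCategory : ModelCategory (R ⥤ M) :=
  letI : CategoryWithFibrations (R ⥤ M) := ⟨matchingClass ρ (fibrations M)⟩
  letI : CategoryWithCofibrations (R ⥤ M) := ⟨latchingClass ρ (cofibrations M)⟩
  letI : CategoryWithWeakEquivalences (R ⥤ M) := ⟨objectwiseWeakEquivalences R M⟩
  haveI : (weakEquivalences (R ⥤ M)).HasTwoOutOfThreeProperty :=
    inferInstanceAs (objectwiseWeakEquivalences R M).HasTwoOutOfThreeProperty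
  haveI : (cofibrations (R ⥤ M)).IsWeakFactorizationSystem (trivialFibrations (R ⥤ M)) := by
    have : trivialFibrations (R ⥤ M) = matchingClass ρ (trivialFibrations M) :=
      (matchingClass_trivialFibrations ρ M).symm
    rw [this]
    exact isWeakFactorizationSystem_reedy ρ (cofibrations M) (trivialFibrations M)
  haveI : (trivialCofibrations (R ⥤ M)).IsWeakFactorizationSystem (fibrations (R ⥤ M)) := by
    have : trivialCofibrations (R ⥤ M) = latchingClass ρ (trivialCofibrations M) :=
      (latchingClass_trivialCofibrations ρ M).symm
    rw [this]
    exact isWeakFactorizationSystem_reedy ρ (trivialCofibrations M) (fibrations M)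
  ModelCategory.mk' (C := R ⥤ M)

end

end ReedyPostnikov

theorem theorem5p8 {M : Type u} [Category.{v} M] [HasLimits M] [HasColimits M] [ModelCategory M]
    {R : Type v} [SmallCategory R] {Rm Rp : MorphismProperty R}
    [Rm.IsMultiplicative] [Rp.IsMultiplicative] (ρ : ReedyStructure Rm Rp ℕ)
    (X Z : MorphismProperty M) (hXZ : ReedyPostnikov.IsPostnikovPresentation M X Z) :
    ∃ K : ModelCategory (R ⥤ M),
      ReedyPostnikov.IsReedyModelStructure ρ K ∧
      ReedyPostnikov.IsPostnikovPresentation (R ⥤ M)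
        (ReedyPostnikov.reedyCotensor ρ X) (ReedyPostnikov.reedyCotensor ρ Z) :=
  letI K : ModelCategory (R ⥤ M) := ReedyPostnikov.reedyModelCategory ρ M
  ⟨K,
    { weakEquivalences_iff := fun _ => Iff.rfl
      cofibrations_iff := fun _ => Iff.rfl
      fibrations_iff := fun _ => Iff.rfl },
    { fibrations_eq := ReedyPostnikov.matchingClass_eq_retracts_post ρ (trivialCofibrations M)
        (fibrations M) X hXZ.fibrations_eq
      trivialFibrations_eq := (ReedyPostnikov.matchingClass_trivialFibrations ρ M).symm.trans
        (ReedyPostnikov.matchingClass_eq_retracts_post ρ (cofibrations M) (trivialFibrations M) Z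
          hXZ.trivialFibrations_eq) }⟩
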